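/- **Setting.** Let $H_{\mathbb Z}$ be a lattice of finite rank, $H=H_{\mathbb Z}\otimes\mathbb C$, $n\ge 0$ an integer, $Q$ a bilinear form on $H_{\mathbb R}=H_{\mathbb Z}\otimes\mathbb R$ (for instance one that is integral on $H_{\mathbb Z}$), symmetric if $n$ is even and skew-symmetric if $n$ is odd, extended bilinearly to $H$, and let $h^{p,n-p}$ $(0\le p\le n)$ be given numbers. The classifying space $D=G/V$ is the set of filtrations $H=F^0\supseteq F^1\supseteq\dots\supseteq F^n\supseteq F^{n+1}=0$ with $\dim F^p=\sum_{j\ge p}h^{j,n-j}$ and $H=F^p\oplus\overline{F^{n-p+1}}$ such that, with $H^{p,q}=F^p\cap\overline{F^q}$ $(p+q=n)$, one has $Q(F^p,F^{n-p+1})=0$ and $(\sqrt{-1})^{p-q}Q(v,\bar v)>0$ for $0\ne v\in H^{p,q}$. The group $G=\mathrm{Aut}(H_{\mathbb R},Q)$ acts on $D$ by left translations $F^p\mapsto gF^p$. The holomorphic tangent space of $D$ lies in $\bigoplus_p\mathrm{Hom}(F^p,H/F^p)$, and also in $\bigoplus_{r>0,\,p+q=n}\mathrm{Hom}(H^{p,q},H^{p-r,q+r})\subset\mathrm{End}(H)$.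 The natural invariant Hermitian metric of $D$ is $\langle A,B\rangle=\mathrm{tr}(AB^*)$ on the latter space, with $B^*$ the adjoint for the Hermitian inner product $Q(Cu,\bar v)$, where $C=(\sqrt{-1})^{p-q}$ on $H^{p,q}$. Let $U$ be a connected complex manifold. A horizontal slice is a holomorphic immersion $f:U\to D$ whose differential takes values in the horizontal distribution $T_h(D)=\{\xi:\ \xi F^p\subset F^{p-1}/F^p \text{ for all } p\}$. Its Hodge metric is the restriction to it of the invariant Hermitian metric of $D$. Let $\Gamma$ be a group acting on $U$ by biholomorphic maps. Smooth functions on $\Gamma\backslash U$, their complex Hessians and their plurisubharmonicity are understood on $U$, through the corresponding $\Gamma$-invariant functions. Call $\Gamma\backslash U$ concave if there is a $C^2$ function $\varphi:\Gamma\backslash U\to\mathbb R$ with all sublevel sets $\{\varphi\le c\}$ compact, whose complex Hessian has at least two negative eigenvalues at each point outside some compact set. **Theorem 4.1.** Let $f_1,f_2:U\to D$ be two horizontal slices, equivariant for the same homomorphism $\rho$ from $\Gamma$ to the group of left translations of $D$: $f_i(\gamma x)=\rho(\gamma)f_i(x)$ for $\gamma\in\Gamma$, $x\in U$, $i=1,2$.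 1. If every smooth plurisubharmonic function on $\Gamma\backslash U$ is constant, then there is an isometry $f:f_1(U)\to f_2(U)$ for the Hodge metrics with $f\circ f_1=f_2$: a homeomorphism $f$ with $f\circ f_1=f_2$ such that, for all $x\in U$ and all tangent vectors $w,w'$ of $U$ at $x$, the Hodge inner product of $df_1(w),df_1(w')$ equals that of $df_2(w),df_2(w')$. 2. The hypothesis of 1 holds if $\Gamma\backslash U$ is concave. So the Hodge metric does not depend on the chosen horizontal immersion. -/

import Mathlib

open scoped ContDiff Manifold ComplexOrder

noncomputable section

namespace HodgeSlice

/-! ### Linear algebra on `H = H_ℝ ⊗ ℂ`, in coordinates with respect to a basis of the lattice -/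

/-- The complex vector space `H`; the standard basis is a basis of the lattice `H_ℤ`.  The
Euclidean norm is only used to describe the topology of Grassmannians. -/
abbrev HodgeVec (ι : Type*) := EuclideanSpace ℂ ι

/-- Complex conjugation `v ↦ v̄` of `H` with respect to `H_ℝ`. -/
def conj (ι : Type*) : HodgeVec ι →ₛₗ[starRingEnd ℂ] HodgeVec ι where
  toFun v := WithLp.toLp 2 fun i => star (v i)
  map_add' u v := by ext i; simp
  map_smul' c v := by ext i; simp

theorem conj_conj {ι : Type*} (v : HodgeVec ι) : conj ι (conj ι v) = v := by
  ext i; simp [conj]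

/-- The conjugate subspace `F̄`. -/
def conjSub {ι : Type*} (F : Submodule ℂ (HodgeVec ι)) : Submodule ℂ (HodgeVec ι) :=
  F.map (conj ι)

/-- The complex bilinear extension of a real bilinear form, given by its matrix. -/
def bilin {ι : Type*} [Fintype ι] (Q : Matrix ι ι ℝ) (u v : HodgeVec ι) : ℂ :=
  ∑ i, ∑ j, u i * (Q i j : ℂ) * v j

/-! ### The classifying space of polarized Hodge structures -/

/-- The discrete data of a polarized Hodge structure: the weight `n`, the bilinear form `Q`
(symmetric for `n` even, skew-symmetric for `n` odd), and the Hodge numbers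
`h p = h^{p, n - p}`. -/
structure HodgeData (ι : Type*) where
  weight : ℕ
  form : Matrix ι ι ℝ
  form_transpose : form.transpose = (-1 : ℝ) ^ weight • form
  hodgeNumber : ℕ → ℕ

/-- A point of the classifying space `D`: a filtration
`H = F⁰ ⊇ F¹ ⊇ ⋯ ⊇ Fⁿ ⊇ Fⁿ⁺¹ = 0` with `dim F^p = h^{n,0} + ⋯ + h^{p,n-p}` and
`H = F^p ⊕ conj F^{n-p+1}` which satisfies the two Hodge-Riemann relations, with
`H^{p,q} = F^p ∩ conj F^q`. (For `p > n` the truncated difference `n + 1 - p` is `0`, and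
the conditions say that `F^p = 0`.) -/
@[ext]
structure ClassifyingSpace {ι : Type*} [Fintype ι] (P : HodgeData ι) where
  F : ℕ → Submodule ℂ (HodgeVec ι)
  F_antitone : Antitone F
  F_zero : F 0 = ⊤
  finrank_F : ∀ p, Module.finrank ℂ (F p) = ∑ j ∈ Finset.Icc p P.weight, P.hodgeNumber j
  isCompl : ∀ p, IsCompl (F p) (conjSub (F (P.weight + 1 - p)))
  riemann_one : ∀ p, ∀ u ∈ F p, ∀ v ∈ F (P.weight + 1 - p), bilin P.form u v = 0
  riemann_two : ∀ p q : ℕ, p + q = P.weight → ∀ v ∈ F p ⊓ conjSub (F q), v ≠ 0 →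
    0 < Complex.I ^ ((p : ℤ) - (q : ℤ)) * bilin P.form v (conj ι v)

/-- The topology of `D` as a subspace of a product of Grassmannians (a subspace of `H` being
identified with the orthogonal projection onto it). -/
instance {ι : Type*} [Fintype ι] (P : HodgeData ι) : TopologicalSpace (ClassifyingSpace P) :=
  TopologicalSpace.induced (fun x (p : ℕ) => (x.F p).starProjection) inferInstance

/-! ### The group `G` and its left translations of `D` -/

/-- The real group `G = Aut(H_ℝ, Q)`. -/
def isometryGroup {ι : Type*} [Fintype ι] [DecidableEq ι] (P : HodgeData ι) :
    Subgroup (GL ι ℝ) where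
  carrier := {g | (g : Matrix ι ι ℝ).transpose * P.form * (g : Matrix ι ι ℝ) = P.form}
  mul_mem' := by
    intro a b ha hb
    simp only [Set.mem_ofPred_eq] at ha hb ⊢
    calc _ = (b : Matrix ι ι ℝ).transpose *
          ((a : Matrix ι ι ℝ).transpose * P.form * (a : Matrix ι ι ℝ)) * (b : Matrix ι ι ℝ) := by
            simp [Matrix.transpose_mul, Matrix.mul_assoc]
      _ = _ := by rw [ha, hb]
  one_mem' := by simp
  inv_mem' := by
    intro a ha
    simp only [Set.mem_ofPred_eq] at ha ⊢
    have h1 : (a : Matrix ι ι ℝ) * ((a⁻¹ : GL ι ℝ) : Matrix ι ι ℝ) = 1 := by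
      rw [← Units.val_mul]; simp
    have h2 : ((a⁻¹ : GL ι ℝ) : Matrix ι ι ℝ).transpose * (a : Matrix ι ι ℝ).transpose = 1 := by
      rw [← Matrix.transpose_mul, h1, Matrix.transpose_one]
    calc _ = ((a⁻¹ : GL ι ℝ) : Matrix ι ι ℝ).transpose *
          ((a : Matrix ι ι ℝ).transpose * P.form * (a : Matrix ι ι ℝ)) *
            ((a⁻¹ : GL ι ℝ) : Matrix ι ι ℝ) := by rw [ha]
      _ = (((a⁻¹ : GL ι ℝ) : Matrix ι ι ℝ).transpose * (a : Matrix ι ι ℝ).transpose) * P.form *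
          ((a : Matrix ι ι ℝ) * ((a⁻¹ : GL ι ℝ) : Matrix ι ι ℝ)) := by
            simp only [Matrix.mul_assoc]
      _ = P.form := by rw [h1, h2]; simp

/-- The complex linear extension to `H` of a real matrix. -/
def realLin {ι : Type*} [Fintype ι] [DecidableEq ι] (g : Matrix ι ι ℝ) :
    HodgeVec ι →ₗ[ℂ] HodgeVec ι where
  toFun v := WithLp.toLp 2 fun i => ∑ j, (g i j : ℂ) * v j
  map_add' u v := by ext i; simp [mul_add, Finset.sum_add_distrib]
  map_smul' c v := by
    ext i
    simp only [PiLp.smul_apply, smul_eq_mul, RingHom.id_apply, Finset.mul_sum]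
    exact Finset.sum_congr rfl fun j _ => by ring

theorem realLin_mul {ι : Type*} [Fintype ι] [DecidableEq ι] (g h : Matrix ι ι ℝ)
    (v : HodgeVec ι) : realLin (g * h) v = realLin g (realLin h v) := by
  ext i
  simp only [realLin, LinearMap.coe_mk, AddHom.coe_mk, Matrix.mul_apply, Complex.ofReal_sum,
    Complex.ofReal_mul, Finset.sum_mul, Finset.mul_sum]
  rw [Finset.sum_comm]
  exact Finset.sum_congr rfl fun j _ => Finset.sum_congr rfl fun k _ => by ring

theorem realLin_one {ι : Type*} [Fintype ι] [DecidableEq ι] (v : HodgeVec ι) :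
    realLin (1 : Matrix ι ι ℝ) v = v := by
  ext i
  simp [realLin, Matrix.one_apply, apply_ite Complex.ofReal, ite_mul]

theorem realLin_conj {ι : Type*} [Fintype ι] [DecidableEq ι] (g : Matrix ι ι ℝ)
    (v : HodgeVec ι) : realLin g (conj ι v) = conj ι (realLin g v) := by
  ext i
  simp [realLin, conj]

theorem bilin_realLin {ι : Type*} [Fintype ι] [DecidableEq ι] (Q g : Matrix ι ι ℝ)
    (u v : HodgeVec ι) :
    bilin Q (realLin g u) (realLin g v) = bilin (g.transpose * Q * g) u v := by
  have key : ∀ (A : Matrix ι ι ℝ) (a b : HodgeVec ι), bilin A a b =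
      (fun i => a i) ⬝ᵥ ((A.map Complex.ofReal).mulVec (fun j => b j)) := by
    intro A a b
    simp only [bilin, dotProduct, Matrix.mulVec, Matrix.map_apply, Finset.mul_sum]
    exact Finset.sum_congr rfl fun i _ => Finset.sum_congr rfl fun j _ => by ring
  have hl : ∀ a : HodgeVec ι, (fun i => realLin g a i) =
      (g.map Complex.ofReal).mulVec (fun j => a j) := by
    intro a; ext i; simp [realLin, Matrix.mulVec, dotProduct]
  have hm : (g.transpose * Q * g).map Complex.ofReal =
      (g.map Complex.ofReal).transpose * Q.map Complex.ofReal * g.map Complex.ofReal := by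
    ext i j
    simp [Matrix.mul_apply]
  rw [key, key, hl, hl, hm, ← Matrix.mulVec_mulVec, ← Matrix.mulVec_mulVec,
    Matrix.dotProduct_mulVec _ (g.map Complex.ofReal).transpose, Matrix.vecMul_transpose]

/-- An element of `GL(H_ℝ)`, acting on `H`. -/
def realEquiv {ι : Type*} [Fintype ι] [DecidableEq ι] (g : GL ι ℝ) :
    HodgeVec ι ≃ₗ[ℂ] HodgeVec ι :=
  LinearEquiv.ofLinearMap (realLin (g : Matrix ι ι ℝ)) (realLin ((g⁻¹ : GL ι ℝ) : Matrix ι ι ℝ))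
    (by ext1 v; simp [← realLin_mul, realLin_one])
    (by ext1 v; simp [← realLin_mul, realLin_one])

theorem conjSub_map {ι : Type*} [Fintype ι] [DecidableEq ι] (g : GL ι ℝ)
    (F : Submodule ℂ (HodgeVec ι)) :
    conjSub (F.map (realEquiv g).toLinearMap) = (conjSub F).map (realEquiv g).toLinearMap := by
  ext v
  constructor
  · rintro ⟨_, ⟨u, hu, rfl⟩, rfl⟩
    exact ⟨conj ι u, ⟨u, hu, rfl⟩, realLin_conj _ u⟩
  · rintro ⟨_, ⟨u, hu, rfl⟩, rfl⟩
    exact ⟨realLin (g : Matrix ι ι ℝ) u, ⟨u, hu, rfl⟩, (realLin_conj _ u).symm⟩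

/-- The left translation of `D` by `g ∈ G`: `F^p ↦ g F^p`. -/
def translate {ι : Type*} [Fintype ι] [DecidableEq ι] {P : HodgeData ι} (g : isometryGroup P)
    (x : ClassifyingSpace P) : ClassifyingSpace P where
  F p := (x.F p).map (realEquiv (g : GL ι ℝ)).toLinearMap
  F_antitone _ _ h := Submodule.map_mono (x.F_antitone h)
  F_zero := by
    rw [x.F_zero, Submodule.map_top]
    exact LinearEquiv.range (realEquiv (g : GL ι ℝ))
  finrank_F p := by
    rw [← x.finrank_F p]
    exact LinearEquiv.finrank_map_eq (realEquiv (g : GL ι ℝ)) (x.F p)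
  isCompl p := by
    rw [conjSub_map]
    exact (Submodule.orderIsoMapComap (realEquiv (g : GL ι ℝ))).isCompl (x.isCompl p)
  riemann_one p := by
    rintro _ ⟨u, hu, rfl⟩ _ ⟨v, hv, rfl⟩
    have hg : ((g : GL ι ℝ) : Matrix ι ι ℝ).transpose * P.form * ((g : GL ι ℝ) : Matrix ι ι ℝ) =
        P.form := g.2
    have := bilin_realLin P.form ((g : GL ι ℝ) : Matrix ι ι ℝ) u v
    rw [hg, x.riemann_one p u hu v hv] at this
    exact this
  riemann_two p q hpq := by
    rintro w ⟨hw1, hw2⟩ hw0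
    rw [conjSub_map] at hw2
    obtain ⟨v, hv, rfl⟩ := hw1
    obtain ⟨v', hv', hvv⟩ := hw2
    obtain rfl : v' = v := (realEquiv (g : GL ι ℝ)).injective hvv
    have hg : ((g : GL ι ℝ) : Matrix ι ι ℝ).transpose * P.form * ((g : GL ι ℝ) : Matrix ι ι ℝ) =
        P.form := g.2
    have hne : v' ≠ 0 := by
      rintro rfl
      exact hw0 (map_zero _)
    have h1 := x.riemann_two p q hpq v' ⟨hv, hv'⟩ hne
    have h2 := bilin_realLin P.form ((g : GL ι ℝ) : Matrix ι ι ℝ) v' (conj ι v')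
    rw [hg, realLin_conj] at h2
    rw [← h2] at h1
    exact h1

/-- The action of `G` on `D` by left translations. -/
instance {ι : Type*} [Fintype ι] [DecidableEq ι] (P : HodgeData ι) :
    MulAction (isometryGroup P) (ClassifyingSpace P) where
  smul := translate
  one_smul x := by
    apply ClassifyingSpace.ext
    funext p
    have : (realEquiv (1 : GL ι ℝ)).toLinearMap = LinearMap.id := by
      ext1 v; exact realLin_one v
    change (x.F p).map (realEquiv (1 : GL ι ℝ)).toLinearMap = x.F p
    rw [this, Submodule.map_id]
  mul_smul g h x := by
    apply ClassifyingSpace.ext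
    funext p
    have : (realEquiv ((g : GL ι ℝ) * (h : GL ι ℝ))).toLinearMap =
        (realEquiv (g : GL ι ℝ)).toLinearMap ∘ₗ (realEquiv (h : GL ι ℝ)).toLinearMap := by
      ext1 v; exact realLin_mul ((g : GL ι ℝ) : Matrix ι ι ℝ) ((h : GL ι ℝ) : Matrix ι ι ℝ) v
    change (x.F p).map (realEquiv ((g : GL ι ℝ) * (h : GL ι ℝ))).toLinearMap =
      ((x.F p).map (realEquiv (h : GL ι ℝ)).toLinearMap).map (realEquiv (g : GL ι ℝ)).toLinearMap
    rw [this, Submodule.map_comp]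

/-- The group of left translations of `D`, as a group of transformations of `D`. -/
def leftTranslations {ι : Type*} [Fintype ι] [DecidableEq ι] (P : HodgeData ι) :
    Subgroup (Equiv.Perm (ClassifyingSpace P)) :=
  (MulAction.toPermHom (isometryGroup P) (ClassifyingSpace P)).range

/-! ### The Hodge decomposition and the invariant Hermitian metric of `D` -/

/-- The component `H → H^{p, n - p} ⊆ F^p` of the Hodge decomposition at `x`: the projection
onto `F^p` along `conj F^{n-p+1}` minus the projection onto `F^{p+1}` along `conj F^{n-p}`. -/
def hodgeComponent {ι : Type*} [Fintype ι] {P : HodgeData ι} (x : ClassifyingSpace P) (p : ℕ) :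
    HodgeVec ι →ₗ[ℂ] x.F p :=
  Submodule.projectionOnto _ _ (x.isCompl p) -
    Submodule.inclusion (x.F_antitone (Nat.le_succ p)) ∘ₗ Submodule.projectionOnto _ _ (x.isCompl (p + 1))

/-- The Weil operator `C`, equal to `i^{p-q}` on `H^{p,q}`. -/
def weilOperator {ι : Type*} [Fintype ι] {P : HodgeData ι} (x : ClassifyingSpace P) :
    HodgeVec ι →ₗ[ℂ] HodgeVec ι :=
  ∑ p ∈ Finset.range (P.weight + 1),
    Complex.I ^ ((p : ℤ) - ((P.weight : ℤ) - (p : ℤ))) • ((x.F p).subtype ∘ₗ hodgeComponent x p)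

/-- The Hermitian inner product `Q(C u, v̄)` on `H` (linear in `u`, antilinear in `v`). -/
def hodgeForm {ι : Type*} [Fintype ι] {P : HodgeData ι} (x : ClassifyingSpace P)
    (u v : HodgeVec ι) : ℂ :=
  bilin P.form (weilOperator x u) (conj ι v)

/-- The Gram matrix of the Hermitian inner product `Q(C u, v̄)` in the standard basis. -/
def gram {ι : Type*} [Fintype ι] [DecidableEq ι] {P : HodgeData ι} (x : ClassifyingSpace P) :
    Matrix ι ι ℂ :=
  Matrix.of fun i j => hodgeForm x (EuclideanSpace.single i 1) (EuclideanSpace.single j 1)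

/-- The Hermitian inner product `tr(A B*)` on `End H` induced by `Q(C u, v̄)`, where `B*` is the
adjoint of `B`; equivalently `∑ₖ ⟨A eₖ, B eₖ⟩` for any unitary basis `e`. It is written here in the
standard basis, by means of the inverse of the Gram matrix. -/
def endForm {ι : Type*} [Fintype ι] [DecidableEq ι] {P : HodgeData ι} (x : ClassifyingSpace P)
    (A B : HodgeVec ι →ₗ[ℂ] HodgeVec ι) : ℂ :=
  ∑ i, ∑ j, (gram x)⁻¹ j i *
    hodgeForm x (A (EuclideanSpace.single i 1)) (B (EuclideanSpace.single j 1))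

/-- The space `⨁ₚ Hom(F^p, H/F^p)` in which the holomorphic tangent space of `D` at `x` lies. -/
abbrev TangentVector {ι : Type*} [Fintype ι] {P : HodgeData ι} (x : ClassifyingSpace P) :=
  (p : ℕ) → x.F p →ₗ[ℂ] (HodgeVec ι ⧸ x.F p)

/-- The realization of a tangent vector in `⨁_{r>0} Hom(H^{p,q}, H^{p-r,q+r}) ⊆ End H`: on
`H^{p,q} ⊆ F^p` it is `ξ_p`, with `H/F^p` identified with
`conj F^{q+1} = ⨁_{r>0} H^{p-r,q+r}`. -/
def toEnd {ι : Type*} [Fintype ι] {P : HodgeData ι} (x : ClassifyingSpace P)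
    (ξ : TangentVector x) : HodgeVec ι →ₗ[ℂ] HodgeVec ι :=
  ∑ p ∈ Finset.range (P.weight + 1),
    (conjSub (x.F (P.weight + 1 - p))).subtype ∘ₗ
      (Submodule.quotientEquivOfIsCompl _ _ (x.isCompl p)).toLinearMap ∘ₗ ξ p ∘ₗ hodgeComponent x p

/-- The natural invariant Hermitian metric of `D`: the trace metric of
`⨁_{r>0} Hom(H^{p,q}, H^{p-r,q+r})` for the Hermitian inner product `Q(C u, v̄)` of `H`. -/
def invariantMetric {ι : Type*} [Fintype ι] [DecidableEq ι] {P : HodgeData ι}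
    (x : ClassifyingSpace P) (ξ η : TangentVector x) : ℂ :=
  endForm x (toEnd x ξ) (toEnd x η)

/-! ### Horizontal slices -/

/-- The differential of `f : U → D` at `x` in the real tangent direction `w`, as an element of
`⨁ₚ Hom(F^p, H/F^p)`: it sends `v ∈ F^p` to the class modulo `F^p` of the derivative of the
section `y ↦ pr_{F^p(f y)} v` of the bundle with fibres `F^p(f y)`, which has the value `v` at `x`
(the orthogonal projection `pr` serves to choose a smooth section; the class does not depend on
the choice). -/
def differential {ι : Type*} [Fintype ι] {P : HodgeData ι}
    {E : Type*} [NormedAddCommGroup E] [NormedSpace ℂ E]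
    {U : Type*} [TopologicalSpace U] [ChartedSpace E U]
    (f : U → ClassifyingSpace P) (x : U) (w : E) : TangentVector (f x) :=
  fun p =>
    ((f x).F p).mkQ ∘ₗ
      ((mfderiv 𝓘(ℝ, E) 𝓘(ℝ, HodgeVec ι →L[ℂ] HodgeVec ι)
          (fun y => ((f y).F p).starProjection) x :
        E →L[ℝ] (HodgeVec ι →L[ℂ] HodgeVec ι)) w).toLinearMap ∘ₗ
      ((f x).F p).subtype

/-- `f : U → D` is holomorphic: it is smooth as a map to a product of Grassmannians and its
differential is complex linear. -/
def IsHolomorphic {ι : Type*} [Fintype ι] {P : HodgeData ι}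
    {E : Type*} [NormedAddCommGroup E] [NormedSpace ℂ E]
    {U : Type*} [TopologicalSpace U] [ChartedSpace E U]
    (f : U → ClassifyingSpace P) : Prop :=
  (∀ p : ℕ, ContMDiff 𝓘(ℝ, E) 𝓘(ℝ, HodgeVec ι →L[ℂ] HodgeVec ι) ∞
    (fun y => ((f y).F p).starProjection)) ∧
  ∀ (x : U) (w : E), differential f x (Complex.I • w) = Complex.I • differential f x w

/-- `(U, f)` is a horizontal slice: `f` is a holomorphic immersion which is tangent to the
horizontal distribution `T_h(D) = {ξ | ξ F^p ⊆ F^{p-1}/F^p}`. -/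
structure IsHorizontalSlice {ι : Type*} [Fintype ι] {P : HodgeData ι}
    {E : Type*} [NormedAddCommGroup E] [NormedSpace ℂ E]
    {U : Type*} [TopologicalSpace U] [ChartedSpace E U]
    (f : U → ClassifyingSpace P) : Prop where
  holomorphic : IsHolomorphic (E := E) f
  immersion : ∀ (x : U) (w : E), differential f x w = 0 → w = 0
  horizontal : ∀ (x : U) (w : E) (p : ℕ),
    LinearMap.range (differential f x w p) ≤ ((f x).F (p - 1)).map ((f x).F p).mkQ

/-- The Hodge metric of a horizontal slice `f : U → D`: the restriction of the invariant Hermitian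
metric of `D`, on the tangent vectors `df(w)`, `df(w')`. -/
def hodgeMetric {ι : Type*} [Fintype ι] [DecidableEq ι] {P : HodgeData ι}
    {E : Type*} [NormedAddCommGroup E] [NormedSpace ℂ E]
    {U : Type*} [TopologicalSpace U] [ChartedSpace E U]
    (f : U → ClassifyingSpace P) (x : U) (w w' : E) : ℂ :=
  invariantMetric (f x) (differential f x w) (differential f x w')

/-- `F : f₁(U) → f₂(U)` satisfies `F ∘ f₁ = f₂` and is an isometry for the Hodge metrics: since
`dF (df₁ w) = df₂ w`, and every tangent vector of the slice `f₁(U)` is of the form `df₁ w`, this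
says that `df₁ w` and `df₁ w'` have the same inner product as `df₂ w` and `df₂ w'`. -/
structure IsHodgeIsometry {ι : Type*} [Fintype ι] [DecidableEq ι] {P : HodgeData ι}
    {E : Type*} [NormedAddCommGroup E] [NormedSpace ℂ E]
    {U : Type*} [TopologicalSpace U] [ChartedSpace E U]
    (f₁ f₂ : U → ClassifyingSpace P) (F : Set.range f₁ ≃ₜ Set.range f₂) : Prop where
  comp_eq : ∀ x : U, (F ⟨f₁ x, Set.mem_range_self x⟩ : ClassifyingSpace P) = f₂ x
  metric_eq : ∀ (x : U) (w w' : E), hodgeMetric f₁ x w w' = hodgeMetric f₂ x w w'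

/-! ### Plurisubharmonic functions on `Γ \ U` and concavity -/

/-- The Levi form (complex Hessian) of `u` at `x` on the vector `v`, in the chart at `x`:
`∂²u/∂z∂z̄` along the complex line through `v`. -/
def leviForm {E : Type*} [NormedAddCommGroup E] [NormedSpace ℂ E]
    {U : Type*} [TopologicalSpace U] [ChartedSpace E U] (u : U → ℝ) (x : U) (v : E) : ℝ :=
  (1 / 4 : ℝ) *
    (iteratedFDeriv ℝ 2 (u ∘ (chartAt E x).symm) (chartAt E x x) ![v, v] +
      iteratedFDeriv ℝ 2 (u ∘ (chartAt E x).symm) (chartAt E x x)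
        ![Complex.I • v, Complex.I • v])

/-- Every smooth plurisubharmonic function on `Γ \ U` is constant. A function on `Γ \ U` is
smooth, plurisubharmonic, when its pull-back to `U` is. -/
def OnlyConstantPsh (E : Type*) [NormedAddCommGroup E] [NormedSpace ℂ E]
    (U : Type*) [TopologicalSpace U] [ChartedSpace E U]
    (Γ : Type*) [Group Γ] [MulAction Γ U] : Prop :=
  ∀ u : MulAction.orbitRel.Quotient Γ U → ℝ,
    ContMDiff 𝓘(ℝ, E) 𝓘(ℝ, ℝ) ∞ (fun x : U => u (Quotient.mk'' x)) →
    (∀ (x : U) (v : E), 0 ≤ leviForm (fun y : U => u (Quotient.mk'' y)) x v) →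
    ∀ a b, u a = u b

/-- `Γ \ U` is concave: there is an exhaustion function `φ` (all sublevel sets are compact), of
class `C²`, whose complex Hessian has at least two negative eigenvalues (that is, it is negative
definite on a subspace of complex dimension `2`) at each point outside some compact set. -/
def IsConcave (E : Type*) [NormedAddCommGroup E] [NormedSpace ℂ E]
    (U : Type*) [TopologicalSpace U] [ChartedSpace E U]
    (Γ : Type*) [Group Γ] [MulAction Γ U] : Prop :=
  ∃ φ : MulAction.orbitRel.Quotient Γ U → ℝ,
    ContMDiff 𝓘(ℝ, E) 𝓘(ℝ, ℝ) 2 (fun x : U => φ (Quotient.mk'' x)) ∧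
    (∀ c : ℝ, IsCompact {q | φ q ≤ c}) ∧
    ∃ K : Set (MulAction.orbitRel.Quotient Γ U), IsCompact K ∧
      ∀ x : U, (Quotient.mk'' x : MulAction.orbitRel.Quotient Γ U) ∉ K →
        ∃ W : Submodule ℂ E, Module.finrank ℂ W = 2 ∧
          ∀ v ∈ W, v ≠ 0 → leviForm (fun y : U => φ (Quotient.mk'' y)) x v < 0

end HodgeSlice

end

/-!
Let `S = i ^ n C` be the operator which is `(-1) ^ p` on `H^{p,q}`. The two slices give two such
operators `S₁`, `S₂` at each point of `U`, and the function `tr (S₁ S₂)` is the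
squared norm of the identity of `H`, as a map from `H` with the Hodge form of `f₁ x` to
`H` with the Hodge form of `f₂ x`. As `f₁` and `f₂` are equivariant for the same homomorphism to
the isometry group of `Q`, this function is `Γ`-invariant.

Let `θ` be the Higgs field of a slice, that is, its differential as an endomorphism of `H` of
degree `(-1, 1)`, and let `β` be the adjoint of `θ` for the flat sesquilinear form `Q(u, v̄)`. The
projection onto `F^p` along the conjugate of `F^{n-p+1}` has a holomorphic range and an
antiholomorphic kernel, and this determines its complex Hessian from its first derivatives
(`secondDeriv_projection`). Summation over `p` gives the complex Hessian of `S`, which is a multiple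
of `(θ β + β θ) S` (`IsHorizontalSlice.hessian_grading`). By horizontality, `θ` and `β` anticommute
with `S`, and then the complex Hessian of `tr (S₁ S₂)` is a sum of two squared norms, of `θ₁ - θ₂`
and of its adjoint (`trace_hessian`, `leviForm_identityNorm`). So `tr (S₁ S₂)` is plurisubharmonic.
If it is constant, then `θ₁ = θ₂` (`higgsField_eq_of_onlyConstantPsh`).

The Hodge metric is `-tr (β(w') θ(w))`, and `β` is determined by `θ` and `Q`, so that the Hodge
metrics of the two slices agree. The images are compared by means of the operator `W` which is
`2 ^ p` on `H^{p,q}`: as a function on `D` it is a topological embedding (`isEmbedding_grading`),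
and `W⁻¹ dW = θ + β / 2` along a slice. Hence `W₂ W₁⁻¹` is constant on `U`, and multiplication by
this constant induces the homeomorphism `f₁(U) → f₂(U)`.

Finally, let `Γ \ U` be concave, with exhaustion function `φ`, and let `u` be plurisubharmonic. If
the complex Hessian of `φ` is negative definite on a plane, then the real and the imaginary axis of
some holomorphic disc `ζ ↦ z + ζ v + ζ² b` stay in the sublevel set of `φ` through `z` for small `ζ`
(`exists_disc`), so that `u - ε φ` has no maximum at `z` on this sublevel set. Letting `ε` tend to
`0`, one finds that `u` attains its maximum on a fixed compact sublevel set, and the strong maximum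
principle, proved here by Hopf's barrier on complex lines in charts
(`not_subharmonic_of_touching_disc`, `eq_of_psh_of_le`), shows that `u` is constant.
-/

set_option linter.unusedSectionVars false

noncomputable section

open scoped Matrix Topology

namespace HodgeSlice

section

/-! ### The algebra of endomorphisms of `H` -/

/-- The algebra of endomorphisms of `H`, with its operator norm. It is kept opaque to instance
search, so that its algebraic structure always comes from the normed star algebra below. -/
def HodgeEnd (ι : Type*) [Fintype ι] : Type _ := HodgeVec ι →L[ℂ] HodgeVec ι

section HodgeEndInstances

variable (ι : Type*) [Fintype ι]

instance : NormedRing (HodgeEnd ι) := inferInstanceAs (NormedRing (HodgeVec ι →L[ℂ] HodgeVec ι))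

instance : NormedAlgebra ℂ (HodgeEnd ι) :=
  inferInstanceAs (NormedAlgebra ℂ (HodgeVec ι →L[ℂ] HodgeVec ι))

instance : StarRing (HodgeEnd ι) := inferInstanceAs (StarRing (HodgeVec ι →L[ℂ] HodgeVec ι))

instance : NormedStarGroup (HodgeEnd ι) :=
  inferInstanceAs (NormedStarGroup (HodgeVec ι →L[ℂ] HodgeVec ι))

instance : StarModule ℂ (HodgeEnd ι) :=
  inferInstanceAs (StarModule ℂ (HodgeVec ι →L[ℂ] HodgeVec ι))

instance : CompleteSpace (HodgeEnd ι) :=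
  inferInstanceAs (CompleteSpace (HodgeVec ι →L[ℂ] HodgeVec ι))

instance : FiniteDimensional ℂ (HodgeEnd ι) :=
  inferInstanceAs (FiniteDimensional ℂ (HodgeVec ι →L[ℂ] HodgeVec ι))

instance : FunLike (HodgeEnd ι) (HodgeVec ι) (HodgeVec ι) :=
  inferInstanceAs (FunLike (HodgeVec ι →L[ℂ] HodgeVec ι) (HodgeVec ι) (HodgeVec ι))

instance : ContinuousLinearMapClass (HodgeEnd ι) ℂ (HodgeVec ι) (HodgeVec ι) :=
  inferInstanceAs
    (ContinuousLinearMapClass (HodgeVec ι →L[ℂ] HodgeVec ι) ℂ (HodgeVec ι) (HodgeVec ι))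

end HodgeEndInstances

namespace HodgeEnd

variable {ι : Type*} [Fintype ι]

/-- A linear endomorphism of `H` as an element of the normed algebra of endomorphisms. -/
def of (X : HodgeVec ι →ₗ[ℂ] HodgeVec ι) : HodgeEnd ι := LinearMap.toContinuousLinearMap X

@[simp] theorem of_apply (X : HodgeVec ι →ₗ[ℂ] HodgeVec ι) (v : HodgeVec ι) : of X v = X v := rfl

@[ext] theorem ext {X Y : HodgeEnd ι} (h : ∀ v, X v = Y v) : X = Y := DFunLike.ext _ _ h

theorem mul_apply (X Y : HodgeEnd ι) (v : HodgeVec ι) : (X * Y) v = X (Y v) := rfl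

@[simp] theorem one_apply (v : HodgeVec ι) : (1 : HodgeEnd ι) v = v := rfl

@[simp] theorem zero_apply (v : HodgeVec ι) : (0 : HodgeEnd ι) v = 0 := rfl

@[simp] theorem smul_apply (c : ℂ) (X : HodgeEnd ι) (v : HodgeVec ι) : (c • X) v = c • X v := rfl

@[simp] theorem add_apply (X Y : HodgeEnd ι) (v : HodgeVec ι) : (X + Y) v = X v + Y v := rfl

@[simp] theorem sum_apply {κ : Type*} (s : Finset κ) (X : κ → HodgeEnd ι) (v : HodgeVec ι) :
    (∑ i ∈ s, X i) v = ∑ i ∈ s, X i v := by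
  classical
  induction s using Finset.induction_on with
  | empty => simp
  | insert a s ha ih => rw [Finset.sum_insert ha, Finset.sum_insert ha, add_apply, ih]

theorem star_inner_right (X : HodgeEnd ι) (u v : HodgeVec ι) :
    inner ℂ v (star X u) = inner ℂ (X v) u :=
  ContinuousLinearMap.adjoint_inner_right (X : HodgeVec ι →L[ℂ] HodgeVec ι) v u

/-- The trace of an endomorphism of `H`. -/
def trace : HodgeEnd ι →ₗ[ℂ] ℂ where
  toFun X := LinearMap.trace ℂ (HodgeVec ι) (LinearMapClass.linearMap X)
  map_add' X Y := (LinearMap.trace ℂ (HodgeVec ι)).map_add (LinearMapClass.linearMap X)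
    (LinearMapClass.linearMap Y)
  map_smul' c X := (LinearMap.trace ℂ (HodgeVec ι)).map_smul c (LinearMapClass.linearMap X)

theorem trace_mul_comm (X Y : HodgeEnd ι) : trace (X * Y) = trace (Y * X) :=
  LinearMap.trace_mul_comm ℂ (LinearMapClass.linearMap X) (LinearMapClass.linearMap Y)

theorem trace_eq_sum [DecidableEq ι] (X : HodgeEnd ι) :
    trace X = ∑ i, X (EuclideanSpace.single i 1) i := by
  change LinearMap.trace ℂ (HodgeVec ι) (LinearMapClass.linearMap X) = _
  rw [LinearMap.trace_eq_matrix_trace ℂ (EuclideanSpace.basisFun ι ℂ).toBasis, Matrix.trace]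
  refine Finset.sum_congr rfl fun i _ => ?_
  simp [LinearMap.toMatrix_apply]

end HodgeEnd

/-! ### The flat sesquilinear form `Q(u, v̄)` -/

variable {ι : Type*} [Fintype ι] [DecidableEq ι] {P : HodgeData ι}

/-- The operator `K` with `Q(u, v̄) = ⟪v, K u⟫`, where `⟪·, ·⟫` is the Euclidean inner product. -/
def formOp (P : HodgeData ι) : HodgeEnd ι :=
  HodgeEnd.of (realLin P.form.transpose)

theorem bilin_conj_eq_inner (u v : HodgeVec ι) :
    bilin P.form u (conj ι v) = inner ℂ v (formOp P u) := by
  simp only [bilin, conj, formOp, realLin, PiLp.inner_apply, LinearMap.coe_mk, AddHom.coe_mk,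
    HodgeEnd.of_apply, Matrix.transpose_apply, RCLike.inner_apply,
    Finset.sum_mul]
  rw [Finset.sum_comm]
  refine Finset.sum_congr rfl fun j _ => Finset.sum_congr rfl fun i _ => ?_
  simp only [starRingEnd_apply]
  ring

theorem bilin_swap (u v : HodgeVec ι) :
    bilin P.form v u = (-1 : ℂ) ^ P.weight * bilin P.form u v := by
  have h : ∀ i j, P.form j i = (-1 : ℝ) ^ P.weight * P.form i j := fun i j => by
    simpa using congrFun (congrFun P.form_transpose i) j
  simp only [bilin, Finset.mul_sum]
  rw [Finset.sum_comm]
  refine Finset.sum_congr rfl fun j _ => Finset.sum_congr rfl fun i _ => ?_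
  rw [h]
  push_cast
  ring

theorem bilin_conj_conj (u v : HodgeVec ι) :
    bilin P.form (conj ι u) (conj ι v) = starRingEnd ℂ (bilin P.form u v) := by
  simp [bilin, conj, map_sum]

theorem star_formOp : star (formOp P) = (-1 : ℂ) ^ P.weight • formOp P := by
  ext1 u
  refine ext_inner_left ℂ fun v => ?_
  rw [HodgeEnd.star_inner_right,
    HodgeEnd.smul_apply, inner_smul_right, ← bilin_conj_eq_inner,
    ← inner_conj_symm, ← bilin_conj_eq_inner, ← bilin_conj_conj, conj_conj, bilin_swap]

/-- `Y` is the adjoint of `X` for the form `Q(u, v̄)`. -/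
def IsFormAdjoint (P : HodgeData ι) (X Y : HodgeEnd ι) : Prop :=
  formOp P * X = star Y * formOp P

namespace IsFormAdjoint

variable {X X' Y Y' : HodgeEnd ι}

theorem symm (h : IsFormAdjoint P X Y) : IsFormAdjoint P Y X := by
  have h1 := congrArg star h
  rw [star_mul, star_mul, star_star, star_formOp, smul_mul_assoc, mul_smul_comm] at h1
  exact (smul_right_injective (HodgeEnd ι)
    (pow_ne_zero P.weight (neg_ne_zero.2 one_ne_zero : (-1 : ℂ) ≠ 0)) h1).symm

theorem mul (h : IsFormAdjoint P X Y) (h' : IsFormAdjoint P X' Y') :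
    IsFormAdjoint P (X * X') (Y' * Y) := by
  unfold IsFormAdjoint at *
  rw [star_mul, ← mul_assoc, h, mul_assoc, h', mul_assoc]

theorem sub (h : IsFormAdjoint P X Y) (h' : IsFormAdjoint P X' Y') :
    IsFormAdjoint P (X - X') (Y - Y') := by
  unfold IsFormAdjoint at *
  rw [mul_sub, h, h', star_sub, sub_mul]

theorem sum {κ : Type*} {s : Finset κ} {X Y : κ → HodgeEnd ι}
    (h : ∀ i ∈ s, IsFormAdjoint P (X i) (Y i)) :
    IsFormAdjoint P (∑ i ∈ s, X i) (∑ i ∈ s, Y i) := by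
  unfold IsFormAdjoint at *
  rw [Finset.mul_sum, star_sum, Finset.sum_mul]
  exact Finset.sum_congr rfl h

theorem smul (c : ℂ) (h : IsFormAdjoint P X Y) :
    IsFormAdjoint P (c • X) (starRingEnd ℂ c • Y) := by
  unfold IsFormAdjoint at *
  rw [mul_smul_comm, h, star_smul, smul_mul_assoc]
  simp

theorem apply (h : IsFormAdjoint P X Y) (u v : HodgeVec ι) :
    bilin P.form (X u) (conj ι v) = bilin P.form u (conj ι (Y v)) := by
  rw [bilin_conj_eq_inner, bilin_conj_eq_inner, ← HodgeEnd.mul_apply, h,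
    HodgeEnd.mul_apply, HodgeEnd.star_inner_right]

theorem of_apply (h : ∀ u v : HodgeVec ι,
    bilin P.form (X u) (conj ι v) = bilin P.form u (conj ι (Y v))) : IsFormAdjoint P X Y := by
  ext1 u
  refine ext_inner_left ℂ fun v => ?_
  rw [HodgeEnd.mul_apply, HodgeEnd.mul_apply,
    HodgeEnd.star_inner_right,
    ← bilin_conj_eq_inner, ← bilin_conj_eq_inner, h]

end IsFormAdjoint

theorem mem_conjSub {F : Submodule ℂ (HodgeVec ι)} {v : HodgeVec ι} :
    v ∈ conjSub F ↔ conj ι v ∈ F := by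
  constructor
  · rintro ⟨u, hu, rfl⟩
    rwa [conj_conj]
  · intro h
    exact ⟨conj ι v, h, conj_conj v⟩

/-! ### The projections onto the Hodge filtration -/

namespace ClassifyingSpace

variable (x : ClassifyingSpace P)

/-- The projection of `H` onto `F^p` along `conj F^{n-p+1}`. -/
def proj (p : ℕ) : HodgeEnd ι :=
  HodgeEnd.of ((x.F p).projection _ (x.isCompl p))

theorem proj_mem (p : ℕ) (v : HodgeVec ι) : x.proj p v ∈ x.F p :=
  Submodule.projection_apply_mem _ _

theorem proj_of_mem {p : ℕ} {v : HodgeVec ι} (hv : v ∈ x.F p) : x.proj p v = v :=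
  Submodule.projection_apply_left (x.isCompl p) ⟨v, hv⟩

theorem proj_eq_zero_iff {p : ℕ} {v : HodgeVec ι} :
    x.proj p v = 0 ↔ v ∈ conjSub (x.F (P.weight + 1 - p)) :=
  Submodule.projection_apply_eq_zero_iff (x.isCompl p)

theorem sub_proj_mem (p : ℕ) (v : HodgeVec ι) :
    v - x.proj p v ∈ conjSub (x.F (P.weight + 1 - p)) := by
  rw [← proj_eq_zero_iff, map_sub, x.proj_of_mem (x.proj_mem p v), sub_self]

/-- A projection is determined by its range and its kernel. -/
theorem proj_eq_of {p : ℕ} {X : HodgeEnd ι} (h1 : ∀ v ∈ x.F p, X v = v)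
    (h2 : ∀ v ∈ conjSub (x.F (P.weight + 1 - p)), X v = 0) : X = x.proj p := by
  ext1 v
  conv_lhs => rw [← sub_add_cancel v (x.proj p v), map_add, h2 _ (x.sub_proj_mem p v),
    h1 _ (x.proj_mem p v), zero_add]

theorem proj_mul_of_le {p q : ℕ} (h : p ≤ q) : x.proj p * x.proj q = x.proj q := by
  ext1 v
  exact x.proj_of_mem (x.F_antitone h (x.proj_mem q v))

theorem proj_mul_of_ge {p q : ℕ} (h : p ≤ q) : x.proj q * x.proj p = x.proj q := by
  ext1 v
  have h1 : v - x.proj p v ∈ conjSub (x.F (P.weight + 1 - q)) :=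
    Submodule.map_mono (x.F_antitone (by omega)) (x.sub_proj_mem p v)
  rw [← proj_eq_zero_iff, map_sub, sub_eq_zero] at h1
  exact h1.symm

theorem proj_mul_proj (p q : ℕ) : x.proj p * x.proj q = x.proj (max p q) := by
  rcases le_total p q with h | h
  · rw [x.proj_mul_of_le h, max_eq_right h]
  · rw [x.proj_mul_of_ge h, max_eq_left h]

theorem proj_zero : x.proj 0 = 1 := by
  ext1 v
  exact x.proj_of_mem (by rw [x.F_zero]; trivial)

theorem proj_of_weight_lt {p : ℕ} (h : P.weight < p) : x.proj p = 0 := by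
  ext1 v
  rw [HodgeEnd.zero_apply, proj_eq_zero_iff, mem_conjSub,
    Nat.sub_eq_zero_of_le (by omega), x.F_zero]
  trivial

/-- By the first Riemann relation, the projections are self-adjoint for `Q(u, v̄)`. -/
theorem isFormAdjoint_proj (p : ℕ) : IsFormAdjoint P (x.proj p) (x.proj p) := by
  have hz : ∀ u ∈ x.F p, ∀ v, bilin P.form u (conj ι (v - x.proj p v)) = 0 := fun u hu v =>
    x.riemann_one p u hu _ (mem_conjSub.1 (x.sub_proj_mem p v))
  have hz' : ∀ u ∈ x.F p, ∀ v, bilin P.form (v - x.proj p v) (conj ι u) = 0 := by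
    intro u hu v
    rw [← conj_conj (v - x.proj p v), bilin_conj_conj, bilin_swap, hz u hu v]
    simp
  refine IsFormAdjoint.of_apply fun u v => ?_
  have h1 := hz _ (x.proj_mem p u) v
  have h2 := hz' _ (x.proj_mem p v) u
  rw [bilin_conj_eq_inner] at h1 h2 ⊢
  rw [bilin_conj_eq_inner]
  rw [inner_sub_left] at h1
  rw [map_sub, inner_sub_right] at h2
  linear_combination h1 - h2

/-- The projection of `H` onto `H^{p, n-p}` given by the Hodge decomposition. -/
def hodgeProj (p : ℕ) : HodgeEnd ι := x.proj p - x.proj (p + 1)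

theorem coe_hodgeComponent (p : ℕ) (v : HodgeVec ι) :
    (hodgeComponent x p v : HodgeVec ι) = x.hodgeProj p v := rfl

theorem hodgeProj_mul_self (p : ℕ) : x.hodgeProj p * x.hodgeProj p = x.hodgeProj p := by
  simp [hodgeProj, mul_sub, sub_mul, proj_mul_proj]

theorem hodgeProj_mul_of_ne {p q : ℕ} (h : p ≠ q) : x.hodgeProj p * x.hodgeProj q = 0 := by
  rcases lt_or_gt_of_ne h with h | h
  · simp [hodgeProj, mul_sub, sub_mul, proj_mul_proj, max_eq_right (show p ≤ q by omega),
      max_eq_right (show p ≤ q + 1 by omega), max_eq_right (show p + 1 ≤ q by omega)]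
  · simp [hodgeProj, mul_sub, sub_mul, proj_mul_proj, max_eq_left (show q ≤ p by omega),
      max_eq_left (show q ≤ p + 1 by omega), max_eq_left (show q + 1 ≤ p by omega)]

theorem isFormAdjoint_hodgeProj (p : ℕ) : IsFormAdjoint P (x.hodgeProj p) (x.hodgeProj p) :=
  (x.isFormAdjoint_proj p).sub (x.isFormAdjoint_proj (p + 1))

theorem sum_hodgeProj : ∑ p ∈ Finset.range (P.weight + 1), x.hodgeProj p = 1 := by
  unfold hodgeProj
  rw [Finset.sum_range_sub', x.proj_zero, x.proj_of_weight_lt (Nat.lt_succ_self _), sub_zero]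

theorem proj_eq_sum_hodgeProj (p : ℕ) :
    x.proj p = ∑ q ∈ Finset.range (P.weight + 1), if p ≤ q then x.hodgeProj q else 0 := by
  conv_lhs => rw [← mul_one (x.proj p), ← x.sum_hodgeProj, Finset.mul_sum]
  refine Finset.sum_congr rfl fun q _ => ?_
  split_ifs with h
  · simp [hodgeProj, mul_sub, proj_mul_proj, max_eq_right h, max_eq_right (show p ≤ q + 1 by omega)]
  · simp [hodgeProj, mul_sub, proj_mul_proj, max_eq_left (show q ≤ p by omega),
      max_eq_left (show q + 1 ≤ p by omega)]

theorem ext_proj {x y : ClassifyingSpace P} (h : ∀ p, x.proj p = y.proj p) : x = y := by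
  refine ClassifyingSpace.ext (funext fun p => le_antisymm (fun v hv => ?_) fun v hv => ?_)
  · rw [← x.proj_of_mem hv, h]
    exact y.proj_mem p v
  · rw [← y.proj_of_mem hv, ← h]
    exact x.proj_mem p v

/-! ### The grading operators -/

/-- The operator which multiplies `H^{p, n-p}` by `t ^ p`. -/
def grading (t : ℂ) : HodgeEnd ι :=
  ∑ p ∈ Finset.range (P.weight + 1), t ^ p • x.hodgeProj p

theorem grading_mul_hodgeProj (t : ℂ) {p : ℕ} (hp : p ≤ P.weight) :
    x.grading t * x.hodgeProj p = t ^ p • x.hodgeProj p := by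
  rw [grading, Finset.sum_mul, Finset.sum_eq_single p]
  · rw [smul_mul_assoc, hodgeProj_mul_self]
  · intro q _ hq
    rw [smul_mul_assoc, x.hodgeProj_mul_of_ne hq, smul_zero]
  · intro h
    exact absurd (Finset.mem_range.2 (by omega)) h

theorem hodgeProj_mul_grading (t : ℂ) {p : ℕ} (hp : p ≤ P.weight) :
    x.hodgeProj p * x.grading t = t ^ p • x.hodgeProj p := by
  rw [grading, Finset.mul_sum, Finset.sum_eq_single p]
  · rw [mul_smul_comm, hodgeProj_mul_self]
  · intro q _ hq
    rw [mul_smul_comm, x.hodgeProj_mul_of_ne hq.symm, smul_zero]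
  · intro h
    exact absurd (Finset.mem_range.2 (by omega)) h

theorem grading_mul_grading (s t : ℂ) : x.grading s * x.grading t = x.grading (s * t) := by
  conv_lhs => rw [grading, Finset.sum_mul]
  refine Finset.sum_congr rfl fun p hp => ?_
  rw [smul_mul_assoc, x.hodgeProj_mul_grading t (by simpa [Nat.lt_succ_iff] using hp), smul_smul,
    mul_pow]

theorem grading_one : x.grading 1 = 1 := by
  simp [grading, sum_hodgeProj]

theorem grading_mul_inv {t : ℂ} (ht : t ≠ 0) : x.grading t * x.grading t⁻¹ = 1 := by
  rw [grading_mul_grading, mul_inv_cancel₀ ht, grading_one]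

theorem grading_inv_mul {t : ℂ} (ht : t ≠ 0) : x.grading t⁻¹ * x.grading t = 1 := by
  rw [grading_mul_grading, inv_mul_cancel₀ ht, grading_one]

theorem isFormAdjoint_grading (t : ℂ) :
    IsFormAdjoint P (x.grading t) (x.grading (starRingEnd ℂ t)) := by
  refine IsFormAdjoint.sum fun p _ => ?_
  have := (x.isFormAdjoint_hodgeProj p).smul (t ^ p)
  rwa [map_pow] at this

/-- Abel summation: the grading operators in terms of the projections onto the filtration. -/
theorem grading_eq (t : ℂ) :
    x.grading t = 1 + ∑ p ∈ Finset.range P.weight, (t ^ (p + 1) - t ^ p) • x.proj (p + 1) := by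
  have h : ∀ m : ℕ, ∑ p ∈ Finset.range (m + 1), t ^ p • x.hodgeProj p =
      1 + ∑ p ∈ Finset.range m, (t ^ (p + 1) - t ^ p) • x.proj (p + 1) -
        t ^ m • x.proj (m + 1) := by
    intro m
    induction m with
    | zero => simp [hodgeProj, proj_zero]
    | succ m ih =>
      rw [Finset.sum_range_succ, ih, Finset.sum_range_succ, hodgeProj, smul_sub, sub_smul]
      abel
  rw [grading, h, x.proj_of_weight_lt (Nat.lt_succ_self _)]
  simp

/-- The Weil operator is `i^{-n}` times the grading operator with `t = -1`. -/
theorem weilOperator_eq (v : HodgeVec ι) :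
    weilOperator x v = Complex.I ^ (-(P.weight : ℤ)) • x.grading (-1) v := by
  simp only [weilOperator, grading, LinearMap.sum_apply, HodgeEnd.sum_apply,
    Finset.smul_sum, LinearMap.smul_apply, HodgeEnd.smul_apply, smul_smul]
  refine Finset.sum_congr rfl fun p _ => ?_
  congr 1
  have : (-1 : ℂ) ^ p = Complex.I ^ (2 * (p : ℤ)) := by
    rw [zpow_mul, zpow_natCast]
    congr 1
    exact Complex.I_sq.symm
  rw [this, ← zpow_add₀ Complex.I_ne_zero]
  congr 1
  ring

theorem hodgeForm_eq (u v : HodgeVec ι) :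
    hodgeForm x u v =
      Complex.I ^ (-(P.weight : ℤ)) * bilin P.form (x.grading (-1) u) (conj ι v) := by
  rw [hodgeForm, weilOperator_eq, bilin_conj_eq_inner, bilin_conj_eq_inner, map_smul,
    inner_smul_right]

theorem hodgeProj_mem (p : ℕ) (v : HodgeVec ι) :
    x.hodgeProj p v ∈ x.F p ⊓ conjSub (x.F (P.weight - p)) := by
  refine ⟨(hodgeComponent x p v).2, ?_⟩
  have h : x.proj (p + 1) * x.hodgeProj p = 0 := by
    simp [hodgeProj, mul_sub, proj_mul_proj]
  have h1 : x.proj (p + 1) (x.hodgeProj p v) = 0 := by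
    rw [← HodgeEnd.mul_apply, h, HodgeEnd.zero_apply]
  rwa [proj_eq_zero_iff, Nat.add_sub_add_right] at h1

theorem hodgeForm_self (v : HodgeVec ι) :
    hodgeForm x v v = ∑ p ∈ Finset.range (P.weight + 1),
      Complex.I ^ ((p : ℤ) - ((P.weight - p : ℕ) : ℤ)) *
        bilin P.form (x.hodgeProj p v) (conj ι (x.hodgeProj p v)) := by
  have h : ∀ p, bilin P.form (x.hodgeProj p v) (conj ι (x.hodgeProj p v)) =
      bilin P.form (x.hodgeProj p v) (conj ι v) := fun p => by
    rw [← (x.isFormAdjoint_hodgeProj p).apply, ← HodgeEnd.mul_apply,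
      hodgeProj_mul_self]
  rw [hodgeForm, bilin_conj_eq_inner, weilOperator]
  simp only [LinearMap.sum_apply, map_sum, inner_sum, LinearMap.smul_apply, map_smul,
    inner_smul_right]
  refine Finset.sum_congr rfl fun p hp => ?_
  rw [h, bilin_conj_eq_inner, Nat.cast_sub (by simpa [Nat.lt_succ_iff] using hp)]
  rfl

/-- The second Riemann relation: `Q(C u, v̄)` is positive definite. -/
theorem hodgeForm_self_pos {v : HodgeVec ι} (hv : v ≠ 0) : 0 < hodgeForm x v v := by
  have hp : ∀ p ∈ Finset.range (P.weight + 1), x.hodgeProj p v ≠ 0 →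
      0 < Complex.I ^ ((p : ℤ) - ((P.weight - p : ℕ) : ℤ)) *
        bilin P.form (x.hodgeProj p v) (conj ι (x.hodgeProj p v)) := fun p hp h0 =>
    x.riemann_two p (P.weight - p) (by rw [Finset.mem_range] at hp; omega) _
      (x.hodgeProj_mem p v) h0
  have hz : ∀ q : ℕ, x.hodgeProj q v = 0 →
      Complex.I ^ ((q : ℤ) - ((P.weight - q : ℕ) : ℤ)) *
        bilin P.form (x.hodgeProj q v) (conj ι (x.hodgeProj q v)) = 0 := fun q h0 => by
    rw [h0, bilin_conj_eq_inner, inner_zero_left, mul_zero]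
  rw [hodgeForm_self]
  obtain ⟨p, hpm, hpv⟩ : ∃ p ∈ Finset.range (P.weight + 1), x.hodgeProj p v ≠ 0 := by
    by_contra! hcon
    apply hv
    have := congrArg (fun X : HodgeEnd ι => X v) x.sum_hodgeProj
    simp only [HodgeEnd.sum_apply, HodgeEnd.one_apply] at this
    rw [← this]
    exact Finset.sum_eq_zero hcon
  refine Finset.sum_pos' (fun q hq => ?_) ⟨p, hpm, hp p hpm hpv⟩
  by_cases h0 : x.hodgeProj q v = 0
  · exact (hz q h0).ge
  · exact (hp q hq h0).le

/-- The form `Q` is nondegenerate as soon as `D` is not empty. -/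
theorem formOp_injective (x : ClassifyingSpace P) : Function.Injective (formOp P) := by
  refine (injective_iff_map_eq_zero _).2 fun u hu => ?_
  by_contra h
  have h1 := x.hodgeForm_self_pos h
  rw [hodgeForm_eq, (x.isFormAdjoint_grading (-1)).apply, bilin_conj_eq_inner, hu] at h1
  simp at h1

theorem isFormAdjoint_unique (x : ClassifyingSpace P) {X Y Y' : HodgeEnd ι}
    (h : IsFormAdjoint P X Y) (h' : IsFormAdjoint P X Y') : Y = Y' := by
  ext1 v
  refine x.formOp_injective ?_
  rw [← HodgeEnd.mul_apply, ← HodgeEnd.mul_apply, h.symm, h'.symm]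

/-! ### The trace of an endomorphism in terms of the Gram matrix -/

theorem hodgeForm_conj_symm (u v : HodgeVec ι) :
    starRingEnd ℂ (hodgeForm x u v) = hodgeForm x v u := by
  have hI : starRingEnd ℂ (Complex.I ^ (-(P.weight : ℤ))) * (-1) ^ P.weight =
      Complex.I ^ (-(P.weight : ℤ)) := by
    rw [map_zpow₀, Complex.conj_I, zpow_neg, zpow_neg, zpow_natCast, zpow_natCast,
      neg_pow Complex.I, mul_inv, mul_assoc, mul_comm (Complex.I ^ P.weight)⁻¹, ← mul_assoc,
      inv_mul_cancel₀ (pow_ne_zero _ (neg_ne_zero.2 one_ne_zero)), one_mul]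
  rw [hodgeForm_eq, hodgeForm_eq, (x.isFormAdjoint_grading (-1)).apply u, map_mul,
    ← bilin_conj_conj, conj_conj, bilin_swap, ← mul_assoc, hI]
  simp

theorem hodgeForm_eq_inner (u v : HodgeVec ι) :
    hodgeForm x u v =
      inner ℂ v ((Complex.I ^ (-(P.weight : ℤ)) • (formOp P * x.grading (-1))) u) := by
  rw [hodgeForm_eq, bilin_conj_eq_inner, HodgeEnd.smul_apply, inner_smul_right]
  rfl

theorem hodgeForm_sum (a b : ι → ℂ) (X Y : HodgeVec ι →ₗ[ℂ] HodgeVec ι) :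
    hodgeForm x (∑ i, a i • X (EuclideanSpace.single i 1))
      (∑ j, b j • Y (EuclideanSpace.single j 1)) =
    ∑ i, ∑ j, a i * starRingEnd ℂ (b j) *
      hodgeForm x (X (EuclideanSpace.single i 1)) (Y (EuclideanSpace.single j 1)) := by
  simp only [hodgeForm_eq_inner, map_sum, map_smul, sum_inner, inner_sum, inner_smul_left,
    inner_smul_right]
  refine Finset.sum_congr rfl fun i _ => ?_
  rw [Finset.mul_sum]
  exact Finset.sum_congr rfl fun j _ => by ring

theorem sum_smul_single (v : HodgeVec ι) :
    ∑ i, v i • (EuclideanSpace.single i 1 : HodgeVec ι) = v := by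
  ext j
  simp [Pi.single_apply]

theorem gram_posDef : (gram x).PosDef := by
  refine Matrix.PosDef.of_dotProduct_mulVec_pos ?_ fun w hw => ?_
  · ext i j
    exact x.hodgeForm_conj_symm _ _
  · have h := x.hodgeForm_sum (fun i => star (w i)) (fun i => star (w i)) LinearMap.id LinearMap.id
    have hv : ∑ i, star (w i) • (EuclideanSpace.single i 1 : HodgeVec ι) ≠ 0 := by
      intro h0
      apply hw
      ext i
      rw [sum_smul_single (WithLp.toLp 2 fun i => star (w i))] at h0
      simpa using congrArg (fun v : HodgeVec ι => v i) h0
    have hp := x.hodgeForm_self_pos hv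
    simp only [LinearMap.id_apply] at h
    rw [h] at hp
    refine hp.trans_eq ?_
    simp only [dotProduct, Matrix.mulVec, gram, Matrix.of_apply, Finset.mul_sum, Pi.star_apply]
    refine Finset.sum_congr rfl fun i _ => Finset.sum_congr rfl fun j _ => ?_
    rw [starRingEnd_apply, star_star]
    ring

/-- The trace of `Y` is the trace of the inverse Gram matrix against the matrix of
`(u, v) ↦ h(Y u, v)`. -/
theorem sum_gram_inv_mul (Y : HodgeEnd ι) :
    ∑ i, ∑ j, (gram x)⁻¹ j i *
      hodgeForm x (Y (EuclideanSpace.single i 1)) (EuclideanSpace.single j 1) =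
    Y.trace := by
  have hexp : ∀ (v : HodgeVec ι) (j : ι),
      hodgeForm x v (EuclideanSpace.single j 1) = ∑ l, v l * gram x l j := by
    intro v j
    conv_lhs => rw [← sum_smul_single v]
    simp [gram, hodgeForm_eq_inner]
  have hdet : IsUnit (gram x).det := (Matrix.isUnit_iff_isUnit_det _).1 x.gram_posDef.isUnit
  rw [HodgeEnd.trace_eq_sum]
  refine Finset.sum_congr rfl fun i _ => ?_
  have h1 : ∀ l, ∑ j, (gram x) l j * (gram x)⁻¹ j i = if l = i then 1 else 0 := fun l => by
    rw [← Matrix.mul_apply, Matrix.mul_nonsing_inv _ hdet, Matrix.one_apply]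
  calc _ = ∑ j, ∑ l, (gram x)⁻¹ j i * (Y (EuclideanSpace.single i 1) l * gram x l j) :=
        Finset.sum_congr rfl fun j _ => by rw [hexp, Finset.mul_sum]
    _ = ∑ l, Y (EuclideanSpace.single i 1) l * ∑ j, (gram x) l j * (gram x)⁻¹ j i := by
        rw [Finset.sum_comm]
        refine Finset.sum_congr rfl fun l _ => ?_
        rw [Finset.mul_sum]
        exact Finset.sum_congr rfl fun j _ => by ring
    _ = _ := by simp [h1]

theorem hodgeForm_isFormAdjoint {X Y : HodgeEnd ι} (h : IsFormAdjoint P X Y) (u v : HodgeVec ι) :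
    hodgeForm x u (Y v) = hodgeForm x ((x.grading (-1) * X * x.grading (-1)) u) v := by
  have hS : ∀ w, x.grading (-1) (x.grading (-1) w) = w := fun w => by
    rw [← HodgeEnd.mul_apply, grading_mul_grading, neg_one_mul, neg_neg, grading_one]
    rfl
  rw [hodgeForm_eq, hodgeForm_eq, HodgeEnd.mul_apply, HodgeEnd.mul_apply, hS, h.apply]

/-- The invariant Hermitian metric on `End H`, by means of the flat form `Q(u, v̄)`. -/
theorem endForm_eq_trace (A B B' : HodgeEnd ι) (h : IsFormAdjoint P B' B) :
    endForm x (LinearMapClass.linearMap A) (LinearMapClass.linearMap B) =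
      (x.grading (-1) * B' * x.grading (-1) * A).trace := by
  rw [← x.sum_gram_inv_mul]
  refine Finset.sum_congr rfl fun i _ => Finset.sum_congr rfl fun j _ => ?_
  congr 1
  exact x.hodgeForm_isFormAdjoint h _ _

/-- The squared norm of an endomorphism `X` of `H`, as a map from `H` with the Hodge form at `x`
to `H` with the Hodge form at `y`, is nonnegative, and zero only for `X = 0`. -/
theorem trace_norm_nonneg (x y : ClassifyingSpace P) {X Y : HodgeEnd ι} (h : IsFormAdjoint P X Y) :
    0 ≤ (x.grading (-1) * Y * y.grading (-1) * X).trace ∧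
      ((x.grading (-1) * Y * y.grading (-1) * X).trace = 0 → X = 0) := by
  set M : Matrix ι ι ℂ := Matrix.of fun i j =>
    hodgeForm y (X (EuclideanSpace.single i 1)) (X (EuclideanSpace.single j 1)) with hM
  have htr : (x.grading (-1) * Y * y.grading (-1) * X).trace = ((gram x)⁻¹ * M).trace := by
    rw [← x.sum_gram_inv_mul, Finset.sum_comm]
    refine Finset.sum_congr rfl fun j _ => Finset.sum_congr rfl fun i _ => ?_
    congr 1
    change hodgeForm x (x.grading (-1) (Y (y.grading (-1) (X _)))) _ = hodgeForm y _ _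
    have hS : ∀ w, x.grading (-1) (x.grading (-1) w) = w := fun w => by
      rw [← HodgeEnd.mul_apply, grading_mul_grading, neg_one_mul, neg_neg, grading_one]
      rfl
    rw [hodgeForm_eq, hodgeForm_eq, hS, h.symm.apply]
  have hMpos : M.PosSemidef := by
    refine Matrix.PosSemidef.of_dotProduct_mulVec_nonneg ?_ fun w => ?_
    · ext i j
      exact y.hodgeForm_conj_symm _ _
    · have h := y.hodgeForm_sum (fun i => star (w i)) (fun i => star (w i))
        (LinearMapClass.linearMap X) (LinearMapClass.linearMap X)
      have hp : ∀ v, 0 ≤ hodgeForm y v v := fun v => by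
        by_cases hv : v = 0
        · rw [hv, hodgeForm_eq_inner, inner_zero_left]
        · exact (y.hodgeForm_self_pos hv).le
      refine ((hp _).trans_eq h).trans_eq ?_
      simp only [dotProduct, Matrix.mulVec, hM, Matrix.of_apply, Finset.mul_sum, Pi.star_apply]
      refine Finset.sum_congr rfl fun i _ => Finset.sum_congr rfl fun j _ => ?_
      rw [starRingEnd_apply, star_star]
      exact (mul_right_comm _ _ _).trans (mul_assoc _ _ _)
  obtain ⟨R, hR⟩ : ∃ R : Matrix ι ι ℂ, (gram x)⁻¹ = Rᴴ * R := by
    open scoped MatrixOrder in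
    exact CStarAlgebra.nonneg_iff_eq_star_mul_self.mp x.gram_posDef.inv.posSemidef.nonneg
  have hRM : ((gram x)⁻¹ * M).trace = (R * M * Rᴴ).trace := by
    rw [hR, Matrix.mul_assoc, Matrix.trace_mul_comm]
  have hpos := hMpos.mul_mul_conjTranspose_same R
  rw [htr, hRM]
  refine ⟨hpos.trace_nonneg, fun h0 => ?_⟩
  have hRu : IsUnit R := by
    have h1 : IsUnit (Rᴴ * R) := hR ▸ x.gram_posDef.inv.isUnit
    rw [Matrix.isUnit_iff_isUnit_det] at h1 ⊢
    rw [Matrix.det_mul] at h1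
    exact isUnit_of_mul_isUnit_right h1
  have hM0 : M = 0 := by
    have h1 := hpos.trace_eq_zero_iff.1 h0
    have h2 : R * M = 0 := (hRu.star.mul_left_eq_zero).1 h1
    exact (hRu.mul_right_eq_zero).1 h2
  ext1 v
  rw [← sum_smul_single v, map_sum, HodgeEnd.zero_apply]
  refine Finset.sum_eq_zero fun i _ => ?_
  by_contra hne
  have h1 : X (EuclideanSpace.single i 1) ≠ 0 := fun h1 => hne (by rw [map_smul, h1, smul_zero])
  exact (y.hodgeForm_self_pos h1).ne' (congrFun (congrFun hM0 i) i)

end ClassifyingSpace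

end

section

/-! ### Infinitesimal horizontal variations of the Hodge filtration -/

variable {ι : Type*} [Fintype ι] [DecidableEq ι] {P : HodgeData ι}

/-- The first-order relations satisfied by the derivatives `T p` of the projections onto `F^p`
along a curve in `D` which is tangent to the horizontal distribution. -/
structure IsHorizontalVariation (x : ClassifyingSpace P) (T : ℕ → HodgeEnd ι) : Prop where
  leibniz : ∀ p q, T p * x.proj q + x.proj p * T q = T (max p q)
  formAdjoint : ∀ p, IsFormAdjoint P (T p) (T p)
  horizontal : ∀ p, x.proj (p - 1) * (T p * x.proj p) = T p * x.proj p

namespace IsHorizontalVariation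

variable {x : ClassifyingSpace P} {T : ℕ → HodgeEnd ι}

theorem proj_mul_mul_proj (h : IsHorizontalVariation x T) (p : ℕ) :
    x.proj p * T p * x.proj p = 0 := by
  have h1 := congrArg (x.proj p * ·) (h.leibniz p p)
  simp only [max_self, mul_add, ← mul_assoc, x.proj_mul_proj] at h1
  exact add_eq_right.1 h1

theorem hodgeProj_mul (h : IsHorizontalVariation x T) (p : ℕ) :
    x.hodgeProj p * (T (p + 1) * x.proj (p + 1)) = T (p + 1) * x.proj (p + 1) := by
  have h1 := h.horizontal (p + 1)
  rw [Nat.add_sub_cancel] at h1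
  rw [ClassifyingSpace.hodgeProj, sub_mul, h1, ← mul_assoc, h.proj_mul_mul_proj, sub_zero]

theorem mul_hodgeProj (h : IsHorizontalVariation x T) (p : ℕ) :
    T (p + 1) * x.proj (p + 1) * x.hodgeProj (p + 1) = T (p + 1) * x.proj (p + 1) := by
  have h1 := congrArg (· * x.proj (p + 2)) (h.leibniz (p + 1) (p + 2))
  have h2 := h.horizontal (p + 2)
  rw [show p + 2 - 1 = p + 1 by omega] at h2
  simp only [add_mul, mul_assoc, x.proj_mul_proj, max_self, h2] at h1
  rw [max_eq_right (by omega : p + 1 ≤ p + 2)] at h1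
  rw [ClassifyingSpace.hodgeProj, mul_sub, mul_assoc, mul_assoc, x.proj_mul_proj, x.proj_mul_proj,
    max_self, max_eq_right (by omega : p + 1 ≤ p + 1 + 1), add_eq_right.1 h1, sub_zero]

theorem isFormAdjoint (h : IsHorizontalVariation x T) (p : ℕ) :
    IsFormAdjoint P (T p * x.proj p) (x.proj p * T p) :=
  (h.formAdjoint p).mul (x.isFormAdjoint_proj p)

theorem hodgeProj_mul' (h : IsHorizontalVariation x T) (p : ℕ) :
    x.hodgeProj (p + 1) * (x.proj (p + 1) * T (p + 1)) = x.proj (p + 1) * T (p + 1) := by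
  have h1 := (h.isFormAdjoint (p + 1)).mul (x.isFormAdjoint_hodgeProj (p + 1))
  rw [h.mul_hodgeProj] at h1
  exact x.isFormAdjoint_unique h1 (h.isFormAdjoint (p + 1))

theorem mul_hodgeProj' (h : IsHorizontalVariation x T) (p : ℕ) :
    x.proj (p + 1) * T (p + 1) * x.hodgeProj p = x.proj (p + 1) * T (p + 1) := by
  have h1 := (x.isFormAdjoint_hodgeProj p).mul (h.isFormAdjoint (p + 1))
  rw [h.hodgeProj_mul] at h1
  exact x.isFormAdjoint_unique h1 (h.isFormAdjoint (p + 1))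

end IsHorizontalVariation

/-- The Higgs field: the endomorphism of `H` which represents the tangent vector with the
derivatives `T p` of the projections onto `F^p`. It maps `H^{p,q}` to `H^{p-1,q+1}`. -/
def higgs (x : ClassifyingSpace P) (T : ℕ → HodgeEnd ι) : HodgeEnd ι :=
  ∑ p ∈ Finset.range P.weight, T (p + 1) * x.proj (p + 1)

/-- The adjoint of the Higgs field for `Q(u, v̄)`. It maps `H^{p,q}` to `H^{p+1,q-1}`. -/
def higgsAdj (x : ClassifyingSpace P) (T : ℕ → HodgeEnd ι) : HodgeEnd ι :=
  ∑ p ∈ Finset.range P.weight, x.proj (p + 1) * T (p + 1)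

namespace IsHorizontalVariation

variable {x : ClassifyingSpace P} {T : ℕ → HodgeEnd ι}

theorem isFormAdjoint_higgs (h : IsHorizontalVariation x T) :
    IsFormAdjoint P (higgs x T) (higgsAdj x T) :=
  IsFormAdjoint.sum fun p _ => h.isFormAdjoint (p + 1)

theorem mul_grading (h : IsHorizontalVariation x T) (t : ℂ) {p : ℕ} (hp : p < P.weight) :
    T (p + 1) * x.proj (p + 1) * x.grading t = t ^ (p + 1) • (T (p + 1) * x.proj (p + 1)) := by
  rw [← h.mul_hodgeProj, mul_assoc, x.hodgeProj_mul_grading t (by omega), mul_smul_comm]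

theorem grading_mul (h : IsHorizontalVariation x T) (t : ℂ) {p : ℕ} (hp : p < P.weight) :
    x.grading t * (T (p + 1) * x.proj (p + 1)) = t ^ p • (T (p + 1) * x.proj (p + 1)) := by
  rw [← h.hodgeProj_mul, ← mul_assoc, x.grading_mul_hodgeProj t hp.le, smul_mul_assoc]

theorem mul_grading' (h : IsHorizontalVariation x T) (t : ℂ) {p : ℕ} (hp : p < P.weight) :
    x.proj (p + 1) * T (p + 1) * x.grading t = t ^ p • (x.proj (p + 1) * T (p + 1)) := by
  rw [← h.mul_hodgeProj', mul_assoc, x.hodgeProj_mul_grading t hp.le, mul_smul_comm]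

theorem grading_mul' (h : IsHorizontalVariation x T) (t : ℂ) {p : ℕ} (hp : p < P.weight) :
    x.grading t * (x.proj (p + 1) * T (p + 1)) = t ^ (p + 1) • (x.proj (p + 1) * T (p + 1)) := by
  rw [← h.hodgeProj_mul', ← mul_assoc, x.grading_mul_hodgeProj t (by omega), smul_mul_assoc]

theorem higgs_mul_grading (h : IsHorizontalVariation x T) (t : ℂ) :
    higgs x T * x.grading t = t • (x.grading t * higgs x T) := by
  rw [higgs, Finset.sum_mul, Finset.mul_sum, Finset.smul_sum]
  refine Finset.sum_congr rfl fun p hp => ?_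
  rw [h.mul_grading t (Finset.mem_range.1 hp), h.grading_mul t (Finset.mem_range.1 hp), smul_smul,
    pow_succ']

theorem grading_mul_higgsAdj (h : IsHorizontalVariation x T) (t : ℂ) :
    x.grading t * higgsAdj x T = t • (higgsAdj x T * x.grading t) := by
  rw [higgsAdj, Finset.sum_mul, Finset.mul_sum, Finset.smul_sum]
  refine Finset.sum_congr rfl fun p hp => ?_
  rw [h.mul_grading' t (Finset.mem_range.1 hp), h.grading_mul' t (Finset.mem_range.1 hp),
    smul_smul, pow_succ']

/-- The derivative of the grading operators in terms of the Higgs field. -/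
theorem sum_smul_eq (h : IsHorizontalVariation x T) {t : ℂ} (ht : t ≠ 0) :
    ∑ p ∈ Finset.range P.weight, (t ^ (p + 1) - t ^ p) • T (p + 1) =
      x.grading t * ((t - 1) • higgs x T + (1 - t⁻¹) • higgsAdj x T) := by
  rw [higgs, higgsAdj, Finset.smul_sum, Finset.smul_sum, ← Finset.sum_add_distrib, Finset.mul_sum]
  refine Finset.sum_congr rfl fun p hp => ?_
  have hp' := Finset.mem_range.1 hp
  rw [mul_add, mul_smul_comm, mul_smul_comm, h.grading_mul t hp', h.grading_mul' t hp', smul_smul,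
    smul_smul]
  have h1 := h.leibniz (p + 1) (p + 1)
  rw [max_self] at h1
  conv_lhs => rw [← h1]
  rw [smul_add]
  congr 2
  · ring
  · field_simp
    ring

theorem higgs_mul_higgsAdj (h : IsHorizontalVariation x T) :
    higgs x T * higgsAdj x T = ∑ p ∈ Finset.range P.weight,
      T (p + 1) * x.proj (p + 1) * (x.proj (p + 1) * T (p + 1)) := by
  rw [higgs, higgsAdj, Finset.sum_mul_sum]
  refine Finset.sum_congr rfl fun p hp => ?_
  refine Finset.sum_eq_single_of_mem p hp fun q _ hq => ?_
  rw [← h.mul_hodgeProj, ← h.hodgeProj_mul' q, mul_assoc, ← mul_assoc (x.hodgeProj _),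
    x.hodgeProj_mul_of_ne (by omega), zero_mul, mul_zero]

theorem higgsAdj_mul_higgs (h : IsHorizontalVariation x T) :
    higgsAdj x T * higgs x T = ∑ p ∈ Finset.range P.weight,
      x.proj (p + 1) * T (p + 1) * (T (p + 1) * x.proj (p + 1)) := by
  rw [higgs, higgsAdj, Finset.sum_mul_sum]
  refine Finset.sum_congr rfl fun p hp => ?_
  refine Finset.sum_eq_single_of_mem p hp fun q _ hq => ?_
  rw [← h.mul_hodgeProj', ← h.hodgeProj_mul q, mul_assoc, ← mul_assoc (x.hodgeProj _),
    x.hodgeProj_mul_of_ne (by omega), zero_mul, mul_zero]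

/-- The complex Hessian of the Weil operator in terms of the Higgs field. -/
theorem sum_smul_commutator (h : IsHorizontalVariation x T) :
    ∑ p ∈ Finset.range P.weight, ((-1 : ℂ) ^ (p + 1) - (-1) ^ p) •
      (T (p + 1) * x.proj (p + 1) * (x.proj (p + 1) * T (p + 1)) -
        x.proj (p + 1) * T (p + 1) * (T (p + 1) * x.proj (p + 1))) =
    (-2 : ℂ) • ((higgs x T * higgsAdj x T + higgsAdj x T * higgs x T) * x.grading (-1)) := by
  rw [h.higgs_mul_higgsAdj, h.higgsAdj_mul_higgs, ← Finset.sum_add_distrib, Finset.sum_mul,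
    Finset.smul_sum]
  refine Finset.sum_congr rfl fun p hp => ?_
  have hp' := Finset.mem_range.1 hp
  rw [add_mul, mul_assoc (T (p + 1) * x.proj (p + 1)) _ (x.grading (-1)),
    mul_assoc (x.proj (p + 1) * T (p + 1)) _ (x.grading (-1)), h.mul_grading _ hp',
    h.mul_grading' _ hp', mul_smul_comm, mul_smul_comm, smul_add, smul_sub, smul_smul, smul_smul,
    sub_eq_add_neg, ← neg_smul]
  congr 2 <;> ring

end IsHorizontalVariation

/-- The complex Hessian of a field of projections whose range varies holomorphically and whose
kernel varies antiholomorphically. Here `T`, `T'` are the first derivatives in the directions `w`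
and `i w`, while `L`, `M`, `L'` are the second derivatives in the directions `(w, w)`, `(w, i w)`
and `(i w, i w)`. -/
theorem hessian_projection {V : Type*} [Ring V] [Algebra ℂ V] {R T T' L M L' : V}
    (hR : R * R = R) (hT : T * R + R * T = T)
    (hT' : T' * R + R * T' = T')
    (hL : L * R + T * T + (T * T + R * L) = L)
    (hL' : L' * R + T' * T' + (T' * T' + R * L') = L')
    (hr : T' * R = Complex.I • (T * R)) (hl : R * T' = -Complex.I • (R * T))
    (hr1 : M * R + T' * T = Complex.I • (L * R + T * T))
    (hr2 : L' * R + T' * T' = Complex.I • (M * R + T * T'))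
    (hl1 : T * T' + R * M = -Complex.I • (T * T + R * L))
    (hl2 : T' * T' + R * L' = -Complex.I • (T' * T + R * M)) :
    L + L' = (4 : ℂ) • (T * R * (R * T) - R * T * (T * R)) := by
  have hI : ∀ X : V, Complex.I • Complex.I • X = -X := fun X => by
    rw [smul_smul, Complex.I_mul_I, neg_one_smul]
  have e1 := congrArg (Complex.I • ·) hr1
  have e2 := congrArg (Complex.I • ·) hl1
  simp only [smul_add, neg_smul, smul_neg, hI, neg_neg] at e1 e2 hr2 hl2
  have e3 : L + L' = (2 : ℂ) • (Complex.I • (T * T') - Complex.I • (T' * T)) := by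
    linear_combination (norm := module) -hL - hL' + hr2 + e1 + hl2 - e2
  have h0 : R * T * R = 0 := by
    have h1 := congrArg (R * ·) hT
    simp only [mul_add, ← mul_assoc, hR] at h1
    exact add_eq_right.1 h1
  have hAA : T * R * (T * R) = 0 := by rw [mul_assoc, ← mul_assoc R, h0, mul_zero]
  have hBB : R * T * (R * T) = 0 := by rw [← mul_assoc, h0, zero_mul]
  have hT'' : T' = Complex.I • (T * R) - Complex.I • (R * T) := by
    rw [← hT', hr, hl, neg_smul, sub_eq_add_neg]
  rw [e3, hT'']
  generalize T * R = A at *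
  generalize R * T = B at *
  rw [← hT]
  simp only [mul_add, add_mul, mul_sub, sub_mul, mul_smul_comm, smul_mul_assoc, hAA, hBB, smul_sub,
    smul_add, hI, smul_zero]
  module

/-- The identity behind the plurisubharmonicity of `tr(S₁ S₂)`: its complex Hessian, expressed by
the Higgs fields `θ₁`, `θ₂` and their adjoints `β₁`, `β₂`, which anticommute with `S₁`, `S₂`, is a
sum of two squared norms, of `θ₁ - θ₂` and of `β₁ - β₂`. -/
theorem trace_hessian {V : Type*} [Ring V] [Algebra ℂ V] (τ : V →ₗ[ℂ] ℂ)
    (hτ : ∀ X Y, τ (X * Y) = τ (Y * X)) {S₁ S₂ θ₁ θ₂ β₁ β₂ : V}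
    (h₁ : θ₁ * S₁ = -(S₁ * θ₁)) (h₂ : θ₂ * S₂ = -(S₂ * θ₂))
    (k₁ : β₁ * S₁ = -(S₁ * β₁)) (k₂ : β₂ * S₂ = -(S₂ * β₂)) :
    τ ((-8 : ℂ) • ((θ₁ * β₁ + β₁ * θ₁) * S₁) * S₂)
      + τ (S₁ * ((-8 : ℂ) • ((θ₂ * β₂ + β₂ * θ₂) * S₂)))
      + 2 * τ (S₁ * ((-2 : ℂ) • θ₁ + (2 : ℂ) • β₁) * (S₂ * ((-2 : ℂ) • θ₂ + (2 : ℂ) • β₂)))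
      + 2 * τ (S₁ * ((-2 : ℂ) • Complex.I • θ₁ + (2 : ℂ) • -Complex.I • β₁) *
          (S₂ * ((-2 : ℂ) • Complex.I • θ₂ + (2 : ℂ) • -Complex.I • β₂))) =
    8 * (τ (S₁ * (β₁ - β₂) * S₂ * (θ₁ - θ₂)) + τ (S₁ * (θ₁ - θ₂) * S₂ * (β₁ - β₂))) := by
  have a1 : τ (θ₁ * β₁ * S₁ * S₂) = -τ (S₁ * β₁ * S₂ * θ₁) := by
    rw [mul_assoc θ₁, k₁, mul_neg, neg_mul, map_neg, mul_assoc, hτ]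
  have a2 : τ (β₁ * θ₁ * S₁ * S₂) = -τ (S₁ * θ₁ * S₂ * β₁) := by
    rw [mul_assoc β₁, h₁, mul_neg, neg_mul, map_neg, mul_assoc, hτ]
  have a3 : S₁ * (θ₂ * β₂ * S₂) = -(S₁ * θ₂ * S₂ * β₂) := by
    rw [mul_assoc θ₂, k₂]; simp only [mul_neg, mul_assoc]
  have a4 : S₁ * (β₂ * θ₂ * S₂) = -(S₁ * β₂ * S₂ * θ₂) := by
    rw [mul_assoc β₂, h₂]; simp only [mul_neg, mul_assoc]
  have a5 : τ (S₁ * β₂ * S₂ * θ₁) = τ (S₁ * θ₁ * S₂ * β₂) := by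
    have e : S₁ * θ₁ = -(θ₁ * S₁) := by rw [h₁, neg_neg]
    rw [e, mul_assoc S₁, k₂, neg_mul, neg_mul, mul_neg, neg_mul, map_neg, map_neg, mul_assoc θ₁,
      mul_assoc θ₁, hτ θ₁, mul_assoc S₁ S₂]
  have a6 : τ (S₁ * θ₂ * S₂ * β₁) = τ (S₁ * β₁ * S₂ * θ₂) := by
    have e : S₁ * β₁ = -(β₁ * S₁) := by rw [k₁, neg_neg]
    rw [e, mul_assoc S₁, h₂, neg_mul, neg_mul, mul_neg, neg_mul, map_neg, map_neg, mul_assoc β₁,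
      mul_assoc β₁, hτ β₁, mul_assoc S₁ S₂]
  simp only [neg_smul, smul_add, mul_add, add_mul, mul_sub, sub_mul, smul_mul_assoc, mul_smul_comm,
    map_add, map_sub, map_smul, map_neg, smul_eq_mul, a3, a4, mul_neg, neg_mul, smul_neg]
  simp only [← mul_assoc, a1, a2, a5, a6]
  ring_nf
  simp only [Complex.I_sq]
  ring

end

section

variable {ι : Type*} [Fintype ι] [DecidableEq ι] {P : HodgeData ι}

/-! ### The topology of `D` -/

theorem HodgeEnd.isUnit_of_injective {X : HodgeEnd ι} (hX : ∀ v, X v = 0 → v = 0) : IsUnit X := by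
  have hinj : Function.Injective (LinearMapClass.linearMap X : HodgeVec ι →ₗ[ℂ] HodgeVec ι) :=
    (injective_iff_map_eq_zero _).2 hX
  refine ⟨⟨X, HodgeEnd.of (LinearEquiv.ofInjectiveEndo _ hinj).symm.toLinearMap, ?_, ?_⟩, rfl⟩
  · ext1 v
    exact (LinearEquiv.ofInjectiveEndo _ hinj).apply_symm_apply v
  · ext1 v
    exact (LinearEquiv.ofInjectiveEndo _ hinj).symm_apply_apply v

namespace ClassifyingSpace

variable (x : ClassifyingSpace P)

/-- The orthogonal projection onto `F^p` for the Euclidean inner product of `H`. -/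
def orthProj (p : ℕ) : HodgeEnd ι := (x.F p).starProjection

theorem orthProj_mem (p : ℕ) (v : HodgeVec ι) : x.orthProj p v ∈ x.F p :=
  Submodule.starProjection_apply_mem _ _

theorem orthProj_of_mem {p : ℕ} {v : HodgeVec ι} (hv : v ∈ x.F p) : x.orthProj p v = v :=
  Submodule.starProjection_eq_self_iff.2 hv

theorem star_orthProj (p : ℕ) : star (x.orthProj p) = x.orthProj p :=
  (isSelfAdjoint_starProjection (x.F p))

theorem orthProj_mul_proj (p : ℕ) : x.orthProj p * x.proj p = x.proj p :=
  HodgeEnd.ext fun v => x.orthProj_of_mem (x.proj_mem p v)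

theorem proj_mul_orthProj (p : ℕ) : x.proj p * x.orthProj p = x.orthProj p :=
  HodgeEnd.ext fun v => x.proj_of_mem (x.orthProj_mem p v)

theorem orthProj_mul_formOp (p : ℕ) :
    x.orthProj p * formOp P * x.proj p = x.orthProj p * formOp P := by
  rw [mul_assoc, x.isFormAdjoint_proj p, ← mul_assoc]
  congr 1
  have h := congrArg star (x.proj_mul_orthProj p)
  rwa [star_mul, star_orthProj] at h

theorem isUnit_compression (p : ℕ) :
    IsUnit (x.orthProj p * formOp P * x.orthProj p + (1 - x.orthProj p)) := by
  have hPP : x.orthProj p * x.orthProj p = x.orthProj p :=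
    HodgeEnd.ext fun v => x.orthProj_of_mem (x.orthProj_mem p v)
  refine HodgeEnd.isUnit_of_injective fun v hv => ?_
  have h1 : x.orthProj p v = v := by
    have h2 : (1 - x.orthProj p) * (x.orthProj p * formOp P * x.orthProj p + (1 - x.orthProj p)) =
        1 - x.orthProj p := by
      simp only [sub_mul, mul_add, one_mul, mul_sub, mul_one, ← mul_assoc, hPP]
      abel
    have h3 : (1 - x.orthProj p) v = 0 := by rw [← h2, HodgeEnd.mul_apply, hv, map_zero]
    exact (sub_eq_zero.1 h3).symm
  have h2 : x.proj p v = v := x.proj_of_mem (h1 ▸ x.orthProj_mem p v)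
  have h3 : (x.orthProj p * formOp P) v = 0 := by
    have h4 : (x.orthProj p * formOp P) (x.orthProj p v) + (v - x.orthProj p v) = 0 := hv
    rwa [h1, sub_self, add_zero] at h4
  refine (injective_iff_map_eq_zero (formOp P)).1 x.formOp_injective v ?_
  refine ext_inner_left ℂ fun u => ?_
  have h5 : formOp P v = star (x.proj p) (formOp P v) := by
    have h6 := congrArg (fun X : HodgeEnd ι => X v) (x.isFormAdjoint_proj p)
    simp only [HodgeEnd.mul_apply, h2] at h6
    exact h6
  rw [inner_zero_right, h5, HodgeEnd.star_inner_right, ← x.orthProj_mul_proj, HodgeEnd.mul_apply,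
    ← HodgeEnd.star_inner_right, star_orthProj, ← HodgeEnd.mul_apply, h3, inner_zero_right]

/-- The projection onto `F^p` is the orthogonal projection for the form `Q(u, v̄)`, so that it is a
rational expression in the Euclidean orthogonal projection. -/
theorem proj_eq_inverse_mul (p : ℕ) :
    x.proj p = Ring.inverse (x.orthProj p * formOp P * x.orthProj p + (1 - x.orthProj p)) *
      (x.orthProj p * formOp P) := by
  have h : (x.orthProj p * formOp P * x.orthProj p + (1 - x.orthProj p)) * x.proj p =
      x.orthProj p * formOp P := by
    rw [add_mul, mul_assoc _ (x.orthProj p), x.orthProj_mul_proj, x.orthProj_mul_formOp, sub_mul,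
      one_mul, x.orthProj_mul_proj, sub_self, add_zero]
  exact (h ▸ (Ring.inverse_mul_cancel_left _ (x.proj p) (x.isUnit_compression p)).symm :)

theorem isUnit_proj_add_star_sub_one (p : ℕ) : IsUnit (x.proj p + star (x.proj p) - 1) := by
  have hpp : x.proj p * x.proj p = x.proj p := x.proj_mul_of_le le_rfl
  refine HodgeEnd.isUnit_of_injective fun v hv => ?_
  have h1 : x.proj p (star (x.proj p) v) = 0 := by
    have h2 : x.proj p * (x.proj p + star (x.proj p) - 1) = x.proj p * star (x.proj p) := by
      rw [mul_sub, mul_add, hpp, mul_one, add_sub_cancel_left]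
    rw [← HodgeEnd.mul_apply, ← h2, HodgeEnd.mul_apply, hv, map_zero]
  have h2 : star (x.proj p) v = 0 := by
    have h3 := HodgeEnd.star_inner_right (star (x.proj p)) (star (x.proj p) v) v
    rw [star_star, h1, inner_zero_right] at h3
    exact inner_self_eq_zero.1 h3.symm
  have h3 : x.proj p v = v := by
    have h4 : x.proj p v + star (x.proj p) v - v = 0 := hv
    rwa [h2, add_zero, sub_eq_zero] at h4
  have h4 := HodgeEnd.star_inner_right (x.proj p) v v
  rw [h2, h3, inner_zero_right] at h4
  exact inner_self_eq_zero.1 h4.symm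

/-- The Euclidean orthogonal projection onto `F^p` is a rational expression in the projection onto
`F^p` and its Euclidean adjoint. -/
theorem orthProj_eq_mul_inverse (p : ℕ) :
    x.orthProj p = x.proj p * Ring.inverse (x.proj p + star (x.proj p) - 1) := by
  have h : x.orthProj p * (x.proj p + star (x.proj p) - 1) = x.proj p := by
    have h1 := congrArg star (x.proj_mul_orthProj p)
    rw [star_mul, star_orthProj] at h1
    rw [mul_sub, mul_add, x.orthProj_mul_proj, h1, mul_one, add_sub_cancel_right]
  have h2 := Ring.mul_inverse_cancel_right _ (x.orthProj p) (x.isUnit_proj_add_star_sub_one p)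
  rwa [h, eq_comm] at h2

theorem continuous_orthProj (p : ℕ) : Continuous fun x : ClassifyingSpace P => x.orthProj p :=
  have h : Continuous fun (x : ClassifyingSpace P) (p : ℕ) => (x.F p).starProjection :=
    continuous_induced_dom
  (continuous_apply p).comp h

theorem continuous_proj (p : ℕ) : Continuous fun x : ClassifyingSpace P => x.proj p := by
  have h := continuous_orthProj (P := P) p
  refine continuous_iff_continuousAt.2 fun x => ?_
  simp only [proj_eq_inverse_mul]
  refine ContinuousAt.mul ?_ (h.mul continuous_const).continuousAt
  obtain ⟨u, hu⟩ := x.isUnit_compression p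
  have h1 := NormedRing.inverse_continuousAt u
  rw [hu] at h1
  exact h1.comp (f := fun x : ClassifyingSpace P =>
    x.orthProj p * formOp P * x.orthProj p + (1 - x.orthProj p))
    (((h.mul continuous_const).mul h).add (continuous_const.sub h)).continuousAt

theorem continuous_grading (t : ℂ) : Continuous fun x : ClassifyingSpace P => x.grading t :=
  continuous_finsetSum _ fun p _ =>
    ((continuous_proj p).sub (continuous_proj (p + 1))).const_smul (t ^ p)

/-- The polynomial which is `1` at `2 ^ q` for `p ≤ q ≤ n` and `0` at `2 ^ q` for `q < p`. -/
def filtrationPolynomial (n p : ℕ) : Polynomial ℂ :=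
  Lagrange.interpolate (Finset.range (n + 1)) (fun q => (2 : ℂ) ^ q) fun q => if p ≤ q then 1 else 0

theorem eval_filtrationPolynomial {n p q : ℕ} (hq : q ≤ n) :
    (filtrationPolynomial n p).eval ((2 : ℂ) ^ q) = if p ≤ q then 1 else 0 := by
  refine Lagrange.eval_interpolate_at_node _ (fun a _ b _ h => ?_) (Finset.mem_range.2 (by omega))
  exact Nat.pow_right_injective le_rfl (by exact_mod_cast h)

theorem proj_eq_aeval (p : ℕ) :
    x.proj p = Polynomial.aeval (x.grading 2) (filtrationPolynomial P.weight p) := by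
  have h : ∀ (f : Polynomial ℂ) (q : ℕ), q ≤ P.weight →
      Polynomial.aeval (x.grading 2) f * x.hodgeProj q = f.eval ((2 : ℂ) ^ q) • x.hodgeProj q := by
    intro f q hq
    induction f using Polynomial.induction_on' with
    | add f g hf hg => rw [map_add, add_mul, hf, hg, Polynomial.eval_add, add_smul]
    | monomial k a =>
      have hk : ∀ k : ℕ, x.grading 2 ^ k * x.hodgeProj q = ((2 : ℂ) ^ q) ^ k • x.hodgeProj q := by
        intro k
        induction k with
        | zero => simp
        | succ k ih =>
          rw [pow_succ, mul_assoc, x.grading_mul_hodgeProj 2 hq, mul_smul_comm, ih, smul_smul,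
            pow_succ']
      rw [Polynomial.aeval_monomial, mul_assoc, hk, Polynomial.eval_monomial, mul_smul_comm,
        ← Algebra.smul_def, smul_smul, mul_comm]
  conv_rhs => rw [← mul_one (Polynomial.aeval _ _), ← x.sum_hodgeProj, Finset.mul_sum]
  rw [proj_eq_sum_hodgeProj]
  refine Finset.sum_congr rfl fun q hq => ?_
  have hq' : q ≤ P.weight := by rw [Finset.mem_range] at hq; omega
  rw [h _ _ hq', eval_filtrationPolynomial hq', ite_smul, one_smul, zero_smul]

/-- A point of `D` is determined by its grading operator with `t = 2`, and the topology of `D` is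
the one induced by it. -/
theorem isEmbedding_grading :
    Topology.IsEmbedding fun x : ClassifyingSpace P => x.grading 2 := by
  refine ⟨Topology.isInducing_iff_nhds.2 fun x => le_antisymm
    ((continuous_grading 2).tendsto x).le_comap ?_, fun x y h => ?_⟩
  · rw [nhds_induced, ← Filter.tendsto_iff_comap, tendsto_pi_nhds]
    intro p
    have hq : Continuous fun X : HodgeEnd ι =>
        Polynomial.aeval X (filtrationPolynomial P.weight p) := Polynomial.continuous_aeval _
    have hc : ContinuousAt (fun X : HodgeEnd ι =>
        Polynomial.aeval X (filtrationPolynomial P.weight p) *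
          Ring.inverse (Polynomial.aeval X (filtrationPolynomial P.weight p) +
            star (Polynomial.aeval X (filtrationPolynomial P.weight p)) - 1)) (x.grading 2) := by
      refine hq.continuousAt.mul ?_
      obtain ⟨u, hu⟩ := x.isUnit_proj_add_star_sub_one p
      have h1 := NormedRing.inverse_continuousAt u
      rw [hu, proj_eq_aeval] at h1
      exact h1.comp (f := fun X : HodgeEnd ι =>
        Polynomial.aeval X (filtrationPolynomial P.weight p) +
          star (Polynomial.aeval X (filtrationPolynomial P.weight p)) - 1)
        ((hq.add hq.star).sub continuous_const).continuousAt
    have ht := hc.tendsto.comp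
      (Filter.tendsto_comap (f := fun x : ClassifyingSpace P => x.grading 2))
    have he : ∀ y : ClassifyingSpace P, Polynomial.aeval (y.grading 2)
        (filtrationPolynomial P.weight p) * Ring.inverse
          (Polynomial.aeval (y.grading 2) (filtrationPolynomial P.weight p) +
            star (Polynomial.aeval (y.grading 2) (filtrationPolynomial P.weight p)) - 1) =
        y.orthProj p := fun y => by
      rw [← proj_eq_aeval, ← orthProj_eq_mul_inverse]
    simp only [Function.comp_def, he] at ht
    exact ht
  · refine ext_proj fun p => ?_
    rw [proj_eq_aeval, proj_eq_aeval]
    exact congrArg (fun X : HodgeEnd ι => Polynomial.aeval X (filtrationPolynomial P.weight p)) h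

/-! ### The action of `G` -/

theorem proj_smul (g : isometryGroup P) (p : ℕ) :
    (g • x).proj p = HodgeEnd.of (realEquiv (g : GL ι ℝ)).toLinearMap * x.proj p *
      HodgeEnd.of (realEquiv (g : GL ι ℝ)).symm.toLinearMap := by
  symm
  refine proj_eq_of _ ?_ ?_
  · rintro _ ⟨v, hv, rfl⟩
    change realEquiv (g : GL ι ℝ) (x.proj p ((realEquiv (g : GL ι ℝ)).symm
      (realEquiv (g : GL ι ℝ) v))) = realEquiv (g : GL ι ℝ) v
    rw [LinearEquiv.symm_apply_apply, x.proj_of_mem hv]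
  · intro w hw
    change w ∈ conjSub ((x.F _).map _) at hw
    rw [conjSub_map] at hw
    obtain ⟨v, hv, rfl⟩ := hw
    change realEquiv (g : GL ι ℝ) (x.proj p ((realEquiv (g : GL ι ℝ)).symm
      (realEquiv (g : GL ι ℝ) v))) = 0
    rw [LinearEquiv.symm_apply_apply, x.proj_eq_zero_iff.2 hv, map_zero]

theorem grading_smul (g : isometryGroup P) (t : ℂ) :
    (g • x).grading t = HodgeEnd.of (realEquiv (g : GL ι ℝ)).toLinearMap * x.grading t *
      HodgeEnd.of (realEquiv (g : GL ι ℝ)).symm.toLinearMap := by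
  simp only [grading, hodgeProj, proj_smul, Finset.mul_sum, Finset.sum_mul, mul_sub, sub_mul,
    mul_smul_comm, smul_mul_assoc]

theorem trace_grading_smul (y : ClassifyingSpace P) (g : isometryGroup P) (s t : ℂ) :
    ((g • x).grading s * (g • y).grading t).trace = (x.grading s * y.grading t).trace := by
  have h : HodgeEnd.of (realEquiv (g : GL ι ℝ)).symm.toLinearMap *
      HodgeEnd.of (realEquiv (g : GL ι ℝ)).toLinearMap = 1 :=
    HodgeEnd.ext fun v => (realEquiv (g : GL ι ℝ)).symm_apply_apply v
  rw [grading_smul, grading_smul, HodgeEnd.trace_mul_comm]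
  simp only [mul_assoc]
  rw [HodgeEnd.trace_mul_comm]
  simp only [mul_assoc, h, mul_one]
  rw [← mul_assoc _ _ (x.grading s), h, one_mul, HodgeEnd.trace_mul_comm]

end ClassifyingSpace

end

/-! ### Second derivatives and the Levi form -/

section Calculus

variable {E : Type*} [NormedAddCommGroup E] [NormedSpace ℂ E]
  {F : Type*} [NormedAddCommGroup F] [NormedSpace ℝ F]

/-- The second derivative of `G` at `z`, first in the direction `w` and then in the direction
`w'`. -/
def secondDeriv (G : E → F) (z w w' : E) : F := fderiv ℝ (fun y => fderiv ℝ G y w) z w'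

theorem differentiableAt_fderiv_apply {G : E → F} {z : E} (hG : ContDiffAt ℝ 2 G z) (w : E) :
    DifferentiableAt ℝ (fun y => fderiv ℝ G y w) z :=
  ((hG.fderiv_right (m := 1) (by norm_num)).differentiableAt one_ne_zero).clm_apply
    (differentiableAt_const w)

theorem secondDeriv_eq_fderiv_fderiv {G : E → F} {z : E} (hG : ContDiffAt ℝ 2 G z) (w w' : E) :
    secondDeriv G z w w' = fderiv ℝ (fderiv ℝ G) z w' w := by
  have h := (hG.fderiv_right (m := 1) (by norm_num)).differentiableAt one_ne_zero
  rw [secondDeriv, fderiv_clm_apply h (differentiableAt_const w)]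
  simp

theorem secondDeriv_comm {G : E → F} {z : E} (hG : ContDiffAt ℝ 2 G z) (w w' : E) :
    secondDeriv G z w w' = secondDeriv G z w' w := by
  rw [secondDeriv_eq_fderiv_fderiv hG, secondDeriv_eq_fderiv_fderiv hG]
  exact (hG.isSymmSndFDerivAt (by simp)).eq _ _

theorem iteratedFDeriv_two_eq_secondDeriv {G : E → F} {z : E} (hG : ContDiffAt ℝ 2 G z)
    (w w' : E) : iteratedFDeriv ℝ 2 G z ![w, w'] = secondDeriv G z w w' := by
  rw [iteratedFDeriv_two_apply, secondDeriv_comm hG, secondDeriv_eq_fderiv_fderiv hG]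
  rfl

theorem eventually_differentiableAt {G : E → F} {z : E} (hG : ContDiffAt ℝ 2 G z) :
    ∀ᶠ y in 𝓝 z, DifferentiableAt ℝ G y :=
  (hG.eventually (by decide)).mono fun _ h => h.differentiableAt two_ne_zero

theorem secondDeriv_congr {G H : E → F} {z : E} (h : G =ᶠ[𝓝 z] H) (w w' : E) :
    secondDeriv G z w w' = secondDeriv H z w w' := by
  have h1 : (fun y => fderiv ℝ G y w) =ᶠ[𝓝 z] fun y => fderiv ℝ H y w :=
    (Filter.EventuallyEq.fderiv (𝕜 := ℝ) h).mono fun y hy => by simp only [hy]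
  rw [secondDeriv, secondDeriv, h1.fderiv_eq]

theorem secondDeriv_clm_comp {F' : Type*} [NormedAddCommGroup F'] [NormedSpace ℝ F']
    (ℓ : F →L[ℝ] F') {G : E → F} {z : E} (hG : ContDiffAt ℝ 2 G z) (w w' : E) :
    secondDeriv (fun y => ℓ (G y)) z w w' = ℓ (secondDeriv G z w w') := by
  have h : (fun y => fderiv ℝ (fun y => ℓ (G y)) y w) =ᶠ[𝓝 z] fun y => ℓ (fderiv ℝ G y w) :=
    (eventually_differentiableAt hG).mono fun y hy => by
      have := (ℓ.hasFDerivAt.comp y hy.hasFDerivAt).fderiv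
      exact congrArg (fun L : E →L[ℝ] F' => L w) this
  have h2 := (ℓ.hasFDerivAt.comp z (differentiableAt_fderiv_apply hG w).hasFDerivAt).fderiv
  rw [secondDeriv, h.fderiv_eq]
  exact congrArg (fun L : E →L[ℝ] F' => L w') h2

section Algebra

variable {V : Type*} [NormedRing V] [NormedAlgebra ℝ V]

theorem fderiv_mul_apply {G H : E → V} {z : E} (hG : DifferentiableAt ℝ G z)
    (hH : DifferentiableAt ℝ H z) (w : E) :
    fderiv ℝ (fun y => G y * H y) z w = fderiv ℝ G z w * H z + G z * fderiv ℝ H z w := by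
  have h := congrArg (fun L : E →L[ℝ] V => L w) (fderiv_mul' hG hH)
  refine h.trans ?_
  simp [add_comm]

theorem secondDeriv_mul {G H : E → V} {z : E} (hG : ContDiffAt ℝ 2 G z) (hH : ContDiffAt ℝ 2 H z)
    (w w' : E) :
    secondDeriv (fun y => G y * H y) z w w' =
      secondDeriv G z w w' * H z + fderiv ℝ G z w * fderiv ℝ H z w' +
        (fderiv ℝ G z w' * fderiv ℝ H z w + G z * secondDeriv H z w w') := by
  have h : (fun y => fderiv ℝ (fun y => G y * H y) y w) =ᶠ[𝓝 z]
      fun y => fderiv ℝ G y w * H y + G y * fderiv ℝ H y w := by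
    filter_upwards [eventually_differentiableAt hG, eventually_differentiableAt hH] with y h1 h2
    exact fderiv_mul_apply h1 h2 w
  have dG := hG.differentiableAt two_ne_zero
  have dH := hH.differentiableAt two_ne_zero
  have dG' := differentiableAt_fderiv_apply hG w
  have dH' := differentiableAt_fderiv_apply hH w
  rw [secondDeriv, h.fderiv_eq, fderiv_fun_add (dG'.fun_mul dH) (dG.fun_mul dH'),
    add_apply, fderiv_mul_apply dG' dH, fderiv_mul_apply dG dH']
  rfl

end Algebra

/-- The complex Hessian of a field `G` of projections whose range varies holomorphically and whose
kernel varies antiholomorphically. -/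
theorem secondDeriv_projection {V : Type*} [NormedRing V] [NormedAlgebra ℂ V] {G : E → V} {z : E}
    (hG : ContDiffAt ℝ 2 G z) (hidem : ∀ᶠ y in 𝓝 z, G y * G y = G y) (w : E)
    (hr : ∀ᶠ y in 𝓝 z, fderiv ℝ G y (Complex.I • w) * G y = Complex.I • (fderiv ℝ G y w * G y))
    (hl : ∀ᶠ y in 𝓝 z, G y * fderiv ℝ G y (Complex.I • w) =
      -Complex.I • (G y * fderiv ℝ G y w)) :
    secondDeriv G z w w + secondDeriv G z (Complex.I • w) (Complex.I • w) =
      (4 : ℂ) • (fderiv ℝ G z w * G z * (G z * fderiv ℝ G z w) -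
        G z * fderiv ℝ G z w * (fderiv ℝ G z w * G z)) := by
  have dG := hG.differentiableAt two_ne_zero
  have dG' := differentiableAt_fderiv_apply hG
  have h1 : ∀ w, fderiv ℝ G z w * G z + G z * fderiv ℝ G z w = fderiv ℝ G z w := fun w => by
    rw [← fderiv_mul_apply dG dG]
    exact congrArg (fun L : E →L[ℝ] V => L w) (Filter.EventuallyEq.fderiv_eq hidem)
  have h2 : ∀ w, secondDeriv G z w w * G z + fderiv ℝ G z w * fderiv ℝ G z w +
      (fderiv ℝ G z w * fderiv ℝ G z w + G z * secondDeriv G z w w) = secondDeriv G z w w := by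
    intro w
    rw [← secondDeriv_mul hG hG]
    exact secondDeriv_congr hidem w w
  have h3 : ∀ w', secondDeriv G z (Complex.I • w) w' * G z +
      fderiv ℝ G z (Complex.I • w) * fderiv ℝ G z w' =
      Complex.I • (secondDeriv G z w w' * G z + fderiv ℝ G z w * fderiv ℝ G z w') := by
    intro w'
    have e := congrArg (fun L : E →L[ℝ] V => L w') (Filter.EventuallyEq.fderiv_eq hr)
    rw [fderiv_mul_apply (dG' _) dG, fderiv_fun_const_smul ((dG' _).fun_mul dG),
      smul_apply, fderiv_mul_apply (dG' _) dG] at e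
    exact e
  have h4 : ∀ w', fderiv ℝ G z w' * fderiv ℝ G z (Complex.I • w) +
      G z * secondDeriv G z (Complex.I • w) w' =
      -Complex.I • (fderiv ℝ G z w' * fderiv ℝ G z w + G z * secondDeriv G z w w') := by
    intro w'
    have e := congrArg (fun L : E →L[ℝ] V => L w') (Filter.EventuallyEq.fderiv_eq hl)
    rw [fderiv_mul_apply dG (dG' _), fderiv_fun_const_smul (dG.fun_mul (dG' _)),
      smul_apply, fderiv_mul_apply dG (dG' _)] at e
    exact e
  refine hessian_projection (M := secondDeriv G z w (Complex.I • w)) hidem.self_of_nhds (h1 _)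
    (h1 _) (h2 _) (h2 _) hr.self_of_nhds hl.self_of_nhds ?_ (h3 _) ?_ (h4 _)
  · rw [secondDeriv_comm hG w]
    exact h3 w
  · rw [secondDeriv_comm hG w]
    exact h4 w

end Calculus

/-! ### Charts -/

section Charts

variable {E : Type*} [NormedAddCommGroup E] [NormedSpace ℂ E]
  {U : Type*} [TopologicalSpace U] [ChartedSpace E U]
  {F : Type*} [NormedAddCommGroup F] [NormedSpace ℝ F]

theorem contDiffAt_comp_chart_symm_self {n : WithTop ℕ∞} {g : U → F} {x : U}
    (hg : ContMDiffAt 𝓘(ℝ, E) 𝓘(ℝ, F) n g x) :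
    ContDiffAt ℝ n (g ∘ (chartAt E x).symm) (chartAt E x x) := by
  have h := (contMDiffAt_iff.1 hg).2
  simp only [contDiffWithinAt_univ, mfld_simps] at h
  exact h

theorem contMDiffAt_of_comp_chart_symm {n : WithTop ℕ∞} {g : U → F} {x : U}
    (hg : ContDiffAt ℝ n (g ∘ (chartAt E x).symm) (chartAt E x x)) :
    ContMDiffAt 𝓘(ℝ, E) 𝓘(ℝ, F) n g x := by
  refine contMDiffAt_iff.2 ⟨?_, ?_⟩
  · have h := hg.continuousAt.comp ((chartAt E x).continuousAt (mem_chart_source E x))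
    refine h.congr ?_
    filter_upwards [(chartAt E x).open_source.mem_nhds (mem_chart_source E x)] with y hy
    simp [hy]
  · simp only [contDiffWithinAt_univ, mfld_simps]
    exact hg

theorem mfderiv_apply_eq {g : U → F} {x : U} (hg : MDifferentiableAt 𝓘(ℝ, E) 𝓘(ℝ, F) g x) (w : E) :
    (mfderiv 𝓘(ℝ, E) 𝓘(ℝ, F) g x : E →L[ℝ] F) w =
      fderiv ℝ (g ∘ (chartAt E x).symm) (chartAt E x x) w := by
  rw [hg.mfderiv]
  simp only [fderivWithin_univ, mfld_simps]
  rfl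

/-- Near a point `y` of the chart at `x`, the chart at `x` is the chart at `y` composed with a
holomorphic change of coordinates `τ`. -/
theorem exists_coordChange [IsManifold 𝓘(ℂ, E) ω U] {x y : U} (hy : y ∈ (chartAt E x).source) :
    ∃ τ : E → E, ContDiffAt ℂ ω τ (chartAt E x y) ∧ τ (chartAt E x y) = chartAt E y y ∧
      ∀ {A : Type*} (g : U → A), g ∘ (chartAt E x).symm =ᶠ[𝓝 (chartAt E x y)]
        (g ∘ (chartAt E y).symm) ∘ τ := by
  refine ⟨chartAt E y ∘ (chartAt E x).symm, ?_, ?_, fun g => ?_⟩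
  · have h := contDiffWithinAt_ext_coord_change (I := 𝓘(ℂ, E)) (n := ω) y x
      (y := chartAt E x y) (by simp [hy])
    simpa [contDiffWithinAt_univ] using h
  · simp [hy]
  · have h1 : ∀ᶠ z in 𝓝 (chartAt E x y), (chartAt E x).symm z ∈ (chartAt E y).source := by
      refine ((chartAt E x).continuousAt_symm ((chartAt E x).map_source hy)).eventually ?_
      rw [(chartAt E x).left_inv hy]
      exact (chartAt E y).open_source.mem_nhds (mem_chart_source E y)
    filter_upwards [h1] with z hz
    simp [hz]

theorem contDiffAt_comp_chart_symm [IsManifold 𝓘(ℂ, E) ω U] {n : WithTop ℕ∞} {g : U → F}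
    {x y : U} (hy : y ∈ (chartAt E x).source) (hg : ContMDiffAt 𝓘(ℝ, E) 𝓘(ℝ, F) n g y) :
    ContDiffAt ℝ n (g ∘ (chartAt E x).symm) (chartAt E x y) := by
  obtain ⟨τ, hτ, hτy, h⟩ := exists_coordChange (E := E) hy
  have h1 := contDiffAt_comp_chart_symm_self hg
  rw [← hτy] at h1
  exact ((h1.comp _ ((hτ.restrict_scalars ℝ).of_le le_top)).congr_of_eventuallyEq (h g))

/-- The derivative in the chart at `x` is the derivative in the chart at a nearby point `y`,
composed with a complex linear map. -/
theorem exists_fderiv_comp_chart_symm [IsManifold 𝓘(ℂ, E) ω U] {x y : U}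
    (hy : y ∈ (chartAt E x).source) :
    ∃ τ' : E →L[ℂ] E, ∀ (g : U → F), ContMDiffAt 𝓘(ℝ, E) 𝓘(ℝ, F) 1 g y → ∀ w,
      fderiv ℝ (g ∘ (chartAt E x).symm) (chartAt E x y) w =
        fderiv ℝ (g ∘ (chartAt E y).symm) (chartAt E y y) (τ' w) := by
  obtain ⟨τ, hτ, hτy, h⟩ := exists_coordChange (E := E) hy
  refine ⟨fderiv ℂ τ (chartAt E x y), fun g hg w => ?_⟩
  have h1 := (contDiffAt_comp_chart_symm_self hg).differentiableAt one_ne_zero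
  have h2 := hτ.differentiableAt (by simp)
  rw [← hτy] at h1
  rw [(h g).fderiv_eq, fderiv_comp _ h1 (h2.restrictScalars ℝ), hτy, h2.fderiv_restrictScalars ℝ]
  rfl

end Charts

section

variable {ι : Type*} [Fintype ι] [DecidableEq ι] {P : HodgeData ι}
  {E : Type*} [NormedAddCommGroup E] [NormedSpace ℂ E]
  {U : Type*} [TopologicalSpace U] [ChartedSpace E U]
  {f : U → ClassifyingSpace P}

/-! ### The differential of a holomorphic map to `D` -/

theorem IsHolomorphic.contMDiff_proj (hf : IsHolomorphic (E := E) f) (p : ℕ) :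
    ContMDiff 𝓘(ℝ, E) 𝓘(ℝ, HodgeEnd ι) ∞ (fun y => (f y).proj p) := by
  have h : ContMDiff 𝓘(ℝ, E) 𝓘(ℝ, HodgeEnd ι) ∞ (fun y => (f y).orthProj p) := hf.1 p
  intro y
  have hc : ContDiffAt ℝ ∞ (fun X : HodgeEnd ι =>
      Ring.inverse (X * formOp P * X + (1 - X)) * (X * formOp P)) ((f y).orthProj p) := by
    have h1 : ContDiff ℝ ∞ fun X : HodgeEnd ι => X * formOp P * X + (1 - X) :=
      ((contDiff_id.mul contDiff_const).mul contDiff_id).add (contDiff_const.sub contDiff_id)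
    obtain ⟨u, hu⟩ := (f y).isUnit_compression p
    have h2 := contDiffAt_ringInverse (n := ∞) ℝ u
    rw [hu] at h2
    exact (ContDiffAt.comp (g := Ring.inverse) ((f y).orthProj p) h2 h1.contDiffAt).mul
      (contDiff_id.mul contDiff_const).contDiffAt
  have h3 := hc.contMDiffAt.comp y (h y)
  simp only [ClassifyingSpace.proj_eq_inverse_mul]
  exact h3

/-- The projection onto `F^p(f y)` as a function of the coordinates of `y` in the chart at `x`. -/
def chartProj (f : U → ClassifyingSpace P) (x : U) (p : ℕ) : E → HodgeEnd ι :=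
  (fun y => (f y).proj p) ∘ (chartAt E x).symm

/-- The derivatives of the projections onto the filtration in the direction `w`. -/
def projDeriv (f : U → ClassifyingSpace P) (x : U) (w : E) (p : ℕ) : HodgeEnd ι :=
  fderiv ℝ (chartProj f x p) (chartAt E x x) w

theorem chartProj_self (x : U) (p : ℕ) : chartProj f x p (chartAt E x x) = (f x).proj p := by
  simp [chartProj]

theorem IsHolomorphic.contDiffAt_chartProj (hf : IsHolomorphic (E := E) f) (x : U) (p : ℕ) :
    ContDiffAt ℝ ∞ (chartProj f x p) (chartAt E x x) :=
  contDiffAt_comp_chart_symm_self (hf.contMDiff_proj p x)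

theorem IsHolomorphic.projDeriv_leibniz (hf : IsHolomorphic (E := E) f) (x : U) (w : E)
    (p q : ℕ) : projDeriv f x w p * (f x).proj q + (f x).proj p * projDeriv f x w q =
      projDeriv f x w (max p q) := by
  have h := fderiv_mul_apply ((hf.contDiffAt_chartProj x p).differentiableAt (by simp))
    ((hf.contDiffAt_chartProj x q).differentiableAt (by simp)) w
  rw [chartProj_self, chartProj_self] at h
  refine h.symm.trans ?_
  simp only [chartProj, Function.comp_apply, ClassifyingSpace.proj_mul_proj]
  rfl

theorem IsHolomorphic.isFormAdjoint_projDeriv (hf : IsHolomorphic (E := E) f) (x : U) (w : E)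
    (p : ℕ) : IsFormAdjoint P (projDeriv f x w p) (projDeriv f x w p) := by
  let ℓ : HodgeEnd ι →ₗ[ℝ] HodgeEnd ι :=
    { toFun := fun X => formOp P * X - star X * formOp P
      map_add' := fun X Y => by rw [mul_add, star_add, add_mul]; abel
      map_smul' := fun c X => by
        have h : star (c • X) = c • star X := by
          rw [← Complex.coe_smul, star_smul, Complex.star_def, Complex.conj_ofReal,
            Complex.coe_smul]
        rw [h, mul_smul_comm, smul_mul_assoc, smul_sub, RingHom.id_apply] }
  have hℓ : ∀ X, ℓ X = 0 ↔ IsFormAdjoint P X X := fun X => sub_eq_zero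
  have h1 := ((LinearMap.toContinuousLinearMap ℓ).hasFDerivAt.comp _
    ((hf.contDiffAt_chartProj x p).differentiableAt (by simp)).hasFDerivAt).fderiv
  have h2 : (LinearMap.toContinuousLinearMap ℓ : HodgeEnd ι → HodgeEnd ι) ∘ chartProj f x p =
      fun _ : E => 0 :=
    funext fun z => (hℓ _).2 ((f _).isFormAdjoint_proj p)
  rw [h2, fderiv_fun_const] at h1
  exact (hℓ _).1 (congrArg (fun L : E →L[ℝ] HodgeEnd ι => L w) h1).symm

theorem IsHolomorphic.proj_mul_projDeriv_mul_proj (hf : IsHolomorphic (E := E) f) (x : U) (w : E)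
    (p : ℕ) : (f x).proj p * projDeriv f x w p * (f x).proj p = 0 := by
  have h1 := congrArg ((f x).proj p * ·) (hf.projDeriv_leibniz x w p p)
  simp only [max_self, mul_add, ← mul_assoc, (f x).proj_mul_proj] at h1
  exact add_eq_right.1 h1

/-- The differential, computed with the projections of the Hodge filtration in place of the
Euclidean projections. -/
theorem IsHolomorphic.differential_apply (hf : IsHolomorphic (E := E) f) (x : U) (w : E) (p : ℕ)
    (v : (f x).F p) :
    differential f x w p v = ((f x).F p).mkQ (projDeriv f x w p (v : HodgeVec ι)) := by
  have ho : ContMDiff 𝓘(ℝ, E) 𝓘(ℝ, HodgeEnd ι) ∞ (fun y => (f y).orthProj p) := hf.1 p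
  have hmd : mfderiv 𝓘(ℝ, E) 𝓘(ℝ, HodgeEnd ι) (fun y => (f y).orthProj p) x w =
      fderiv ℝ ((fun y => (f y).orthProj p) ∘ (chartAt E x).symm) (chartAt E x x) w :=
    mfderiv_apply_eq ((ho x).mdifferentiableAt (by simp)) w
  have h := fderiv_mul_apply ((contDiffAt_comp_chart_symm_self (ho x)).differentiableAt (by simp))
    ((hf.contDiffAt_chartProj x p).differentiableAt (by simp)) w
  have h1 : (fun z : E => ((fun y => (f y).orthProj p) ∘ (chartAt E x).symm) z *
      chartProj f x p z) = chartProj f x p :=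
    funext fun z => (f _).orthProj_mul_proj p
  rw [h1, chartProj_self, ← hmd] at h
  have h2 : projDeriv f x w p v = (id (mfderiv 𝓘(ℝ, E) 𝓘(ℝ, HodgeEnd ι)
      (fun y => (f y).orthProj p) x w) : HodgeEnd ι) v +
        (f x).orthProj p (projDeriv f x w p v) := by
    have h3 : projDeriv f x w p v = (id (mfderiv 𝓘(ℝ, E) 𝓘(ℝ, HodgeEnd ι)
      (fun y => (f y).orthProj p) x w) : HodgeEnd ι) ((f x).proj p v) +
        ((fun y => (f y).orthProj p) ∘ (chartAt E x).symm) (chartAt E x x)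
          (projDeriv f x w p v) :=
      congrArg (fun X : HodgeEnd ι => X (v : HodgeVec ι)) h
    rw [(f x).proj_of_mem v.2, Function.comp_apply, (chartAt E x).left_inv (mem_chart_source E x)]
      at h3
    exact h3
  have h3 : ((f x).F p).mkQ ((f x).orthProj p (projDeriv f x w p v)) = 0 :=
    (Submodule.Quotient.mk_eq_zero _).2 ((f x).orthProj_mem p _)
  rw [h2, map_add, h3, add_zero]
  rfl

theorem IsHolomorphic.projDeriv_I_smul_mul_proj (hf : IsHolomorphic (E := E) f) (x : U) (w : E)
    (p : ℕ) : projDeriv f x (Complex.I • w) p * (f x).proj p =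
      Complex.I • (projDeriv f x w p * (f x).proj p) := by
  have hz : ∀ w, (f x).proj p * (projDeriv f x w p * (f x).proj p) = 0 := fun w => by
    rw [← mul_assoc, hf.proj_mul_projDeriv_mul_proj]
  ext1 u
  have h1 := LinearMap.congr_fun (congrFun (hf.2 x w) p) ⟨_, (f x).proj_mem p u⟩
  rw [Pi.smul_apply, LinearMap.smul_apply, hf.differential_apply, hf.differential_apply,
    ← map_smul, ← sub_eq_zero, ← map_sub, Submodule.mkQ_apply, Submodule.Quotient.mk_eq_zero] at h1
  have h2 := (f x).proj_of_mem h1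
  have h3 : ∀ w, (f x).proj p (projDeriv f x w p ((f x).proj p u)) = 0 := fun w =>
    congrArg (fun X : HodgeEnd ι => X u) (hz w)
  rw [map_sub, map_smul, h3, h3, smul_zero, sub_zero] at h2
  exact (sub_eq_zero.1 h2.symm)

theorem IsHolomorphic.proj_mul_projDeriv_I_smul (hf : IsHolomorphic (E := E) f) (x : U) (w : E)
    (p : ℕ) : (f x).proj p * projDeriv f x (Complex.I • w) p =
      -Complex.I • ((f x).proj p * projDeriv f x w p) := by
  have h : ∀ w, IsFormAdjoint P (projDeriv f x w p * (f x).proj p)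
      ((f x).proj p * projDeriv f x w p) := fun w =>
    (hf.isFormAdjoint_projDeriv x w p).mul ((f x).isFormAdjoint_proj p)
  have h1 := (h w).smul Complex.I
  rw [← hf.projDeriv_I_smul_mul_proj, Complex.conj_I] at h1
  exact (f x).isFormAdjoint_unique (h _) h1

theorem IsHorizontalSlice.isHorizontalVariation (hf : IsHorizontalSlice (E := E) f) (x : U)
    (w : E) : IsHorizontalVariation (f x) (projDeriv f x w) where
  leibniz := hf.holomorphic.projDeriv_leibniz x w
  formAdjoint := hf.holomorphic.isFormAdjoint_projDeriv x w
  horizontal p := by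
    ext1 u
    refine (f x).proj_of_mem ?_
    have h1 := hf.horizontal x w p (LinearMap.mem_range_self _ ⟨_, (f x).proj_mem p u⟩)
    rw [hf.holomorphic.differential_apply] at h1
    obtain ⟨v, hv, hvu⟩ := h1
    rw [← sub_eq_zero, ← map_sub, Submodule.mkQ_apply, Submodule.Quotient.mk_eq_zero] at hvu
    have h2 := Submodule.sub_mem _ hv ((f x).F_antitone (Nat.sub_le p 1) hvu)
    rwa [sub_sub_cancel] at h2

/-- The Higgs field of `f` at `x` in the direction `w`. -/
def higgsField (f : U → ClassifyingSpace P) (x : U) (w : E) : HodgeEnd ι :=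
  higgs (f x) (projDeriv f x w)

theorem IsHorizontalSlice.toEnd_differential (hf : IsHorizontalSlice (E := E) f) (x : U) (w : E) :
    toEnd (f x) (differential f x w) = LinearMapClass.linearMap (higgsField f x w) := by
  have hv := hf.isHorizontalVariation x w
  ext1 u
  have hterm : ∀ p, ((conjSub ((f x).F (P.weight + 1 - p))).subtype ∘ₗ
      (Submodule.quotientEquivOfIsCompl _ _ ((f x).isCompl p)).toLinearMap ∘ₗ
        differential f x w p ∘ₗ hodgeComponent (f x) p) u =
      (projDeriv f x w p * (f x).hodgeProj p) u := by
    intro p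
    simp only [LinearMap.comp_apply]
    rw [hf.holomorphic.differential_apply, ClassifyingSpace.coe_hodgeComponent]
    have h1 : (f x).proj p (projDeriv f x w p ((f x).hodgeProj p u)) = 0 := by
      rw [← (f x).proj_of_mem ((f x).hodgeProj_mem p u).1]
      exact congrArg (fun X : HodgeEnd ι => X ((f x).hodgeProj p u)) (hv.proj_mul_mul_proj p)
    change (Submodule.projectionOnto _ _ ((f x).isCompl p).symm _ : HodgeVec ι) = _
    have h2 := Submodule.projection_add_projection_eq_self ((f x).isCompl p)
      (projDeriv f x w p ((f x).hodgeProj p u))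
    change (f x).proj p _ + _ = _ at h2
    rw [h1, zero_add] at h2
    exact h2
  have h0 : projDeriv f x w 0 = 0 := by
    have h1 := hv.leibniz 0 0
    rw [(f x).proj_zero, mul_one, one_mul, max_self] at h1
    exact add_eq_left.1 h1
  have hp : ∀ p, projDeriv f x w (p + 1) * (f x).hodgeProj (p + 1) =
      projDeriv f x w (p + 1) * (f x).proj (p + 1) := fun p => by
    rw [← hv.mul_hodgeProj, mul_assoc]
    congr 1
    simp [ClassifyingSpace.hodgeProj, mul_sub, ClassifyingSpace.proj_mul_proj]
  rw [toEnd, LinearMap.sum_apply, Finset.sum_congr rfl fun p _ => hterm p, Finset.sum_range_succ',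
    h0, zero_mul, HodgeEnd.zero_apply, add_zero]
  simp only [hp]
  exact (HodgeEnd.sum_apply _ _ _).symm

theorem IsHorizontalSlice.higgsField_I_smul (hf : IsHorizontalSlice (E := E) f) (x : U) (w : E) :
    higgsField f x (Complex.I • w) = Complex.I • higgsField f x w := by
  simp only [higgsField, higgs, hf.holomorphic.projDeriv_I_smul_mul_proj, Finset.smul_sum]

theorem IsHorizontalSlice.higgsAdj_I_smul (hf : IsHorizontalSlice (E := E) f) (x : U) (w : E) :
    higgsAdj (f x) (projDeriv f x (Complex.I • w)) =
      -Complex.I • higgsAdj (f x) (projDeriv f x w) := by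
  simp only [higgsAdj, hf.holomorphic.proj_mul_projDeriv_I_smul, Finset.smul_sum]

/-- The Hodge metric in terms of the Higgs field `θ` and its adjoint for the flat form. -/
theorem IsHorizontalSlice.hodgeMetric_eq (hf : IsHorizontalSlice (E := E) f) (x : U) (w w' : E) :
    hodgeMetric f x w w' =
      -(higgsAdj (f x) (projDeriv f x w') * higgsField f x w).trace := by
  have hv := hf.isHorizontalVariation x w'
  rw [hodgeMetric, invariantMetric, hf.toEnd_differential, hf.toEnd_differential,
    (f x).endForm_eq_trace (higgsField f x w) (higgsField f x w') _ hv.isFormAdjoint_higgs.symm,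
    hv.grading_mul_higgsAdj, neg_one_smul, neg_mul, neg_mul, mul_assoc (higgsAdj _ _),
    ClassifyingSpace.grading_mul_grading, neg_one_mul, neg_neg, ClassifyingSpace.grading_one,
    mul_one, map_neg]

/-- The derivative of the grading operator along a horizontal slice. -/
theorem IsHorizontalSlice.fderiv_grading (hf : IsHorizontalSlice (E := E) f) {t : ℂ} (ht : t ≠ 0)
    (x : U) (w : E) :
    fderiv ℝ ((fun y => (f y).grading t) ∘ (chartAt E x).symm) (chartAt E x x) w =
      (f x).grading t * ((t - 1) • higgsField f x w +
        (1 - t⁻¹) • higgsAdj (f x) (projDeriv f x w)) := by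
  rw [higgsField, ← (hf.isHorizontalVariation x w).sum_smul_eq ht]
  have h : (fun y => (f y).grading t) ∘ (chartAt E x).symm = fun z : E =>
      1 + ∑ p ∈ Finset.range P.weight, (t ^ (p + 1) - t ^ p) • chartProj f x (p + 1) z :=
    funext fun z => (f _).grading_eq t
  have hd : ∀ p, DifferentiableAt ℝ (chartProj f x p) (chartAt E x x) := fun p =>
    (hf.holomorphic.contDiffAt_chartProj x p).differentiableAt (by simp)
  rw [h, fderiv_const_add, fderiv_fun_sum fun p _ => (hd _).fun_const_smul _, sum_apply]
  refine Finset.sum_congr rfl fun p _ => ?_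
  rw [fderiv_fun_const_smul (hd _)]
  rfl

theorem IsHolomorphic.contDiffAt_grading (hf : IsHolomorphic (E := E) f) (t : ℂ) (x : U) :
    ContDiffAt ℝ ∞ ((fun y => (f y).grading t) ∘ (chartAt E x).symm) (chartAt E x x) := by
  have h : (fun y => (f y).grading t) ∘ (chartAt E x).symm = fun z : E =>
      1 + ∑ p ∈ Finset.range P.weight, (t ^ (p + 1) - t ^ p) • chartProj f x (p + 1) z :=
    funext fun z => (f _).grading_eq t
  rw [h]
  exact contDiffAt_const.add
    (ContDiffAt.sum fun p _ => (hf.contDiffAt_chartProj x (p + 1)).const_smul _)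

/-! ### The complex Hessian of the Weil operator -/

/-- In the chart at `x`, near `x`, the projection onto `F^p` satisfies the Cauchy-Riemann equation
for its range and the conjugate equation for its kernel. -/
theorem IsHolomorphic.eventually_cauchyRiemann [IsManifold 𝓘(ℂ, E) ω U]
    (hf : IsHolomorphic (E := E) f) (x : U) (w : E) (p : ℕ) :
    (∀ᶠ z in 𝓝 (chartAt E x x), fderiv ℝ (chartProj f x p) z (Complex.I • w) * chartProj f x p z =
      Complex.I • (fderiv ℝ (chartProj f x p) z w * chartProj f x p z)) ∧
    (∀ᶠ z in 𝓝 (chartAt E x x), chartProj f x p z * fderiv ℝ (chartProj f x p) z (Complex.I • w) =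
      -Complex.I • (chartProj f x p z * fderiv ℝ (chartProj f x p) z w)) := by
  have h : ∀ y ∈ (chartAt E x).source, ∃ τ' : E →L[ℂ] E, ∀ w,
      fderiv ℝ (chartProj f x p) (chartAt E x y) w = projDeriv f y (τ' w) p := by
    intro y hy
    obtain ⟨τ', hτ'⟩ := exists_fderiv_comp_chart_symm (E := E) (F := HodgeEnd ι) hy
    exact ⟨τ', hτ' _ ((hf.contMDiff_proj p y).of_le (by simp))⟩
  have ht := (chartAt E x).open_target.mem_nhds (mem_chart_target E x)
  constructor <;> filter_upwards [ht] with z hz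
  all_goals
    obtain ⟨τ', hτ'⟩ := h _ ((chartAt E x).map_target hz)
    rw [(chartAt E x).right_inv hz] at hτ'
    rw [hτ', hτ', map_smul]
  · exact hf.projDeriv_I_smul_mul_proj _ _ _
  · exact hf.proj_mul_projDeriv_I_smul _ _ _

theorem IsHorizontalSlice.hessian_grading [IsManifold 𝓘(ℂ, E) ω U]
    (hf : IsHorizontalSlice (E := E) f) (x : U) (w : E) :
    secondDeriv ((fun y => (f y).grading (-1)) ∘ (chartAt E x).symm) (chartAt E x x) w w +
      secondDeriv ((fun y => (f y).grading (-1)) ∘ (chartAt E x).symm) (chartAt E x x)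
        (Complex.I • w) (Complex.I • w) =
    (-8 : ℂ) • ((higgsField f x w * higgsAdj (f x) (projDeriv f x w) +
      higgsAdj (f x) (projDeriv f x w) * higgsField f x w) * (f x).grading (-1)) := by
  have hC : ∀ p, ContDiffAt ℝ 2 (chartProj f x p) (chartAt E x x) := fun p =>
    (hf.holomorphic.contDiffAt_chartProj x p).of_le (WithTop.coe_le_coe.2 (le_top : (2 : ℕ∞) ≤ ⊤))
  have h : (fun y => (f y).grading (-1)) ∘ (chartAt E x).symm = fun z : E =>
      1 + ∑ p ∈ Finset.range P.weight,
        ((-1 : ℂ) ^ (p + 1) - (-1) ^ p) • chartProj f x (p + 1) z :=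
    funext fun z => (f _).grading_eq (-1)
  have hD : ∀ w, secondDeriv ((fun y => (f y).grading (-1)) ∘ (chartAt E x).symm)
      (chartAt E x x) w w = ∑ p ∈ Finset.range P.weight,
        ((-1 : ℂ) ^ (p + 1) - (-1) ^ p) •
          secondDeriv (chartProj f x (p + 1)) (chartAt E x x) w w := by
    intro w
    have h1 : (fun z => fderiv ℝ ((fun y => (f y).grading (-1)) ∘ (chartAt E x).symm) z w)
        =ᶠ[𝓝 (chartAt E x x)] fun z => ∑ p ∈ Finset.range P.weight,
          ((-1 : ℂ) ^ (p + 1) - (-1) ^ p) • fderiv ℝ (chartProj f x (p + 1)) z w := by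
      have hd : ∀ᶠ z in 𝓝 (chartAt E x x), ∀ p ∈ Finset.range P.weight,
          DifferentiableAt ℝ (chartProj f x (p + 1)) z :=
        (Filter.eventually_all_finset _).2 fun p _ => eventually_differentiableAt (hC (p + 1))
      filter_upwards [hd] with z hz
      rw [h, fderiv_const_add, fderiv_fun_sum fun p hp => (hz p hp).fun_const_smul _, sum_apply]
      refine Finset.sum_congr rfl fun p hp => ?_
      rw [fderiv_fun_const_smul (hz p hp)]
      rfl
    have hd := fun p => differentiableAt_fderiv_apply (hC p) w
    rw [secondDeriv, h1.fderiv_eq, fderiv_fun_sum fun p _ => (hd _).fun_const_smul _, sum_apply]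
    refine Finset.sum_congr rfl fun p hp => ?_
    rw [fderiv_fun_const_smul (hd _)]
    rfl
  rw [hD, hD, ← Finset.sum_add_distrib]
  have h2 : ∀ p, secondDeriv (chartProj f x p) (chartAt E x x) w w +
      secondDeriv (chartProj f x p) (chartAt E x x) (Complex.I • w) (Complex.I • w) = _ := fun p =>
    secondDeriv_projection (hC p)
      (Filter.Eventually.of_forall fun z => (f _).proj_mul_of_le le_rfl) w
      (hf.holomorphic.eventually_cauchyRiemann x w p).1
      (hf.holomorphic.eventually_cauchyRiemann x w p).2
  simp only [← smul_add, h2, chartProj_self]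
  have h3 := (hf.isHorizontalVariation x w).sum_smul_commutator
  have h4 := congrArg ((4 : ℂ) • ·) h3
  simp only [Finset.smul_sum, smul_smul] at h4
  rw [higgsField, show (-8 : ℂ) = 4 * -2 by norm_num, ← h4]
  refine Finset.sum_congr rfl fun p _ => ?_
  rw [smul_smul, mul_comm]
  rfl

end

section Rigidity

variable {ι : Type*} [Fintype ι] [DecidableEq ι] {P : HodgeData ι}
  {E : Type*} [NormedAddCommGroup E] [NormedSpace ℂ E]
  {U : Type*} [TopologicalSpace U] [ChartedSpace E U]
  {f₁ f₂ : U → ClassifyingSpace P}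

/-! ### The Hodge norm of the identity map from `H` with the Hodge structures `f₁` to `f₂` -/

/-- The real part of the trace, as a real linear functional. -/
def reTrace (ι : Type*) [Fintype ι] : HodgeEnd ι →L[ℝ] ℝ :=
  LinearMap.toContinuousLinearMap (Complex.reLm ∘ₗ (HodgeEnd.trace.restrictScalars ℝ))

theorem reTrace_apply (X : HodgeEnd ι) : reTrace ι X = X.trace.re := rfl

/-- The squared Hodge norm of the identity of `H`, as a map between the Hodge structures `f₁ y` and
`f₂ y`. As the two Weil operators are `i^{-n} S₁` and `i^{-n} S₂`, it is the trace of `S₁ S₂`. -/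
def identityNorm (f₁ f₂ : U → ClassifyingSpace P) (y : U) : ℝ :=
  reTrace ι ((f₁ y).grading (-1) * (f₂ y).grading (-1))

theorem contMDiff_identityNorm (hf₁ : IsHolomorphic (E := E) f₁) (hf₂ : IsHolomorphic (E := E) f₂) :
    ContMDiff 𝓘(ℝ, E) 𝓘(ℝ, ℝ) ∞ (identityNorm f₁ f₂) := fun x =>
  contMDiffAt_of_comp_chart_symm ((reTrace ι).contDiff.contDiffAt.comp (chartAt E x x)
    ((hf₁.contDiffAt_grading (-1) x).mul (hf₂.contDiffAt_grading (-1) x)))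

/-- The complex Hessian of the norm of the identity is the sum of the squared norms of the
difference of the Higgs fields and of its adjoint. -/
theorem leviForm_identityNorm [IsManifold 𝓘(ℂ, E) ω U] (hf₁ : IsHorizontalSlice (E := E) f₁)
    (hf₂ : IsHorizontalSlice (E := E) f₂) (x : U) (w : E) :
    leviForm (identityNorm f₁ f₂) x w = 2 *
      (((f₁ x).grading (-1) * (higgsAdj (f₁ x) (projDeriv f₁ x w) -
          higgsAdj (f₂ x) (projDeriv f₂ x w)) *
        (f₂ x).grading (-1) * (higgsField f₁ x w - higgsField f₂ x w)).trace +
      ((f₁ x).grading (-1) * (higgsField f₁ x w - higgsField f₂ x w) * (f₂ x).grading (-1) *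
        (higgsAdj (f₁ x) (projDeriv f₁ x w) - higgsAdj (f₂ x) (projDeriv f₂ x w))).trace).re := by
  have h2 : (2 : ℕ∞ω) ≤ ∞ := WithTop.coe_le_coe.2 (le_top : (2 : ℕ∞) ≤ ⊤)
  have c₁ := (hf₁.holomorphic.contDiffAt_grading (-1) x).of_le h2
  have c₂ := (hf₂.holomorphic.contDiffAt_grading (-1) x).of_le h2
  have hc := c₁.mul c₂
  have hu : identityNorm f₁ f₂ ∘ (chartAt E x).symm = fun z : E => reTrace ι
      (((fun y => (f₁ y).grading (-1)) ∘ (chartAt E x).symm) z *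
        ((fun y => (f₂ y).grading (-1)) ∘ (chartAt E x).symm) z) := rfl
  have hcu : ContDiffAt ℝ 2 (identityNorm f₁ f₂ ∘ (chartAt E x).symm) (chartAt E x x) :=
    (reTrace ι).contDiff.contDiffAt.comp (chartAt E x x) hc
  have e : ∀ f : U → ClassifyingSpace P, IsHorizontalSlice (E := E) f → ∀ v : E,
      fderiv ℝ ((fun y => (f y).grading (-1)) ∘ (chartAt E x).symm) (chartAt E x x) v =
      (f x).grading (-1) * ((-2 : ℂ) • higgsField f x v +
        (2 : ℂ) • higgsAdj (f x) (projDeriv f x v)) := by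
    intro f hf v
    rw [hf.fderiv_grading (neg_ne_zero.2 one_ne_zero)]
    norm_num
  have ev : ∀ f : U → ClassifyingSpace P,
      ((fun y => (f y).grading (-1)) ∘ (chartAt E x).symm) (chartAt E x x) =
        (f x).grading (-1) := fun f => by simp
  have hsum : ∀ f : U → ClassifyingSpace P, IsHorizontalSlice (E := E) f →
      higgsField f x w * (f x).grading (-1) = -((f x).grading (-1) * higgsField f x w) ∧
      higgsAdj (f x) (projDeriv f x w) * (f x).grading (-1) =
        -((f x).grading (-1) * higgsAdj (f x) (projDeriv f x w)) := fun f hf => by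
    have hv := hf.isHorizontalVariation x w
    refine ⟨(hv.higgs_mul_grading (-1)).trans (neg_one_smul _ _), ?_⟩
    rw [hv.grading_mul_higgsAdj (-1), neg_one_smul, neg_neg]
  have key := trace_hessian HodgeEnd.trace HodgeEnd.trace_mul_comm (hsum f₁ hf₁).1 (hsum f₂ hf₂).1
    (hsum f₁ hf₁).2 (hsum f₂ hf₂).2
  rw [leviForm, iteratedFDeriv_two_eq_secondDeriv hcu, iteratedFDeriv_two_eq_secondDeriv hcu, hu,
    secondDeriv_clm_comp _ hc, secondDeriv_clm_comp _ hc, secondDeriv_mul c₁ c₂,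
    secondDeriv_mul c₁ c₂, e f₁ hf₁, e f₂ hf₂, e f₁ hf₁, e f₂ hf₂, ev, ev, hf₁.higgsField_I_smul,
    hf₂.higgsField_I_smul, hf₁.higgsAdj_I_smul, hf₂.higgsAdj_I_smul]
  rw [← hf₁.hessian_grading x w, ← hf₂.hessian_grading x w] at key
  have key' := congrArg Complex.re key
  simp only [add_mul, mul_add, map_add, Complex.add_re, reTrace_apply] at key' ⊢
  simp only [Complex.mul_re, Complex.re_ofNat, Complex.im_ofNat] at key'
  linarith

theorem isFormAdjoint_higgsField_sub (hf₁ : IsHorizontalSlice (E := E) f₁)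
    (hf₂ : IsHorizontalSlice (E := E) f₂) (x : U) (w : E) :
    IsFormAdjoint P (higgsField f₁ x w - higgsField f₂ x w)
      (higgsAdj (f₁ x) (projDeriv f₁ x w) - higgsAdj (f₂ x) (projDeriv f₂ x w)) :=
  (hf₁.isHorizontalVariation x w).isFormAdjoint_higgs.sub
    (hf₂.isHorizontalVariation x w).isFormAdjoint_higgs

theorem leviForm_identityNorm_nonneg [IsManifold 𝓘(ℂ, E) ω U]
    (hf₁ : IsHorizontalSlice (E := E) f₁) (hf₂ : IsHorizontalSlice (E := E) f₂) (x : U) (w : E) :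
    0 ≤ leviForm (identityNorm f₁ f₂) x w ∧
      (leviForm (identityNorm f₁ f₂) x w = 0 → higgsField f₁ x w = higgsField f₂ x w) := by
  have h := isFormAdjoint_higgsField_sub hf₁ hf₂ x w
  have h1 := (f₁ x).trace_norm_nonneg (f₂ x) h
  have h2 := (f₁ x).trace_norm_nonneg (f₂ x) h.symm
  have h1' := Complex.nonneg_iff.1 h1.1
  have h2' := Complex.nonneg_iff.1 h2.1
  rw [leviForm_identityNorm hf₁ hf₂, Complex.add_re]
  refine ⟨by linarith [h1'.1, h2'.1], fun h0 => sub_eq_zero.1 (h1.2 ?_)⟩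
  exact Complex.ext (by rw [Complex.zero_re]; linarith [h1'.1, h2'.1]) h1'.2.symm

/-- The flat form `Q(u, v̄)` does not depend on the slice, so that the Higgs field determines its
adjoint. -/
theorem higgsAdj_eq_of_higgsField_eq (hf₁ : IsHorizontalSlice (E := E) f₁)
    (hf₂ : IsHorizontalSlice (E := E) f₂) {x : U} {w : E}
    (h : higgsField f₁ x w = higgsField f₂ x w) :
    higgsAdj (f₁ x) (projDeriv f₁ x w) = higgsAdj (f₂ x) (projDeriv f₂ x w) := by
  have h1 := (hf₁.isHorizontalVariation x w).isFormAdjoint_higgs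
  change IsFormAdjoint P (higgsField f₁ x w) _ at h1
  rw [h] at h1
  exact (f₁ x).isFormAdjoint_unique h1 (hf₂.isHorizontalVariation x w).isFormAdjoint_higgs

/-! ### Reconstruction of `f₂` from `f₁` -/

/-- A function on a connected manifold whose derivative vanishes is constant; the derivative is
taken at each point in the chart at this point. -/
theorem eq_of_fderiv_eq_zero {F : Type*} [NormedAddCommGroup F] [NormedSpace ℝ F]
    [IsManifold 𝓘(ℂ, E) ω U] [ConnectedSpace U] {g : U → F}
    (hg : ContMDiff 𝓘(ℝ, E) 𝓘(ℝ, F) 1 g)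
    (h0 : ∀ x w, fderiv ℝ (g ∘ (chartAt E x).symm) (chartAt E x x) w = 0) (x y : U) :
    g x = g y := by
  refine IsLocallyConstant.apply_eq_of_preconnectedSpace
    ((IsLocallyConstant.iff_eventually_eq g).2 fun x => ?_) x y
  obtain ⟨r, hr, hball⟩ := Metric.isOpen_iff.1 (chartAt E x).open_target _ (mem_chart_target E x)
  have hz : ∀ z ∈ Metric.ball (chartAt E x x) r,
      DifferentiableAt ℝ (g ∘ (chartAt E x).symm) z ∧
        fderiv ℝ (g ∘ (chartAt E x).symm) z = 0 := by
    intro z hz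
    have hs := (chartAt E x).map_target (hball hz)
    have hd := (contDiffAt_comp_chart_symm hs (hg _)).differentiableAt one_ne_zero
    obtain ⟨τ', hτ'⟩ := exists_fderiv_comp_chart_symm (F := F) hs
    rw [(chartAt E x).right_inv (hball hz)] at hd hτ'
    refine ⟨hd, ContinuousLinearMap.ext fun w => ?_⟩
    rw [hτ' g (hg _), h0]
    rfl
  have hconst : ∀ z ∈ Metric.ball (chartAt E x x) r,
      (g ∘ (chartAt E x).symm) z = (g ∘ (chartAt E x).symm) (chartAt E x x) := fun z hz' =>
    (convex_ball _ _).is_const_of_fderivWithin_eq_zero (𝕜 := ℝ)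
      (fun z hz' => (hz z hz').1.differentiableWithinAt)
      (fun z hz' => by rw [fderivWithin_of_isOpen Metric.isOpen_ball hz', (hz z hz').2])
      hz' (Metric.mem_ball_self hr)
  have h1 := ((chartAt E x).continuousAt (mem_chart_source E x)).eventually
    (Metric.ball_mem_nhds _ hr)
  filter_upwards [h1, (chartAt E x).open_source.mem_nhds (mem_chart_source E x)] with y hy hys
  simpa [hys] using hconst _ hy

/-- If the Higgs fields of two slices agree, then the product of the grading operator of `f₂` with
the inverse of the one of `f₁` is constant. -/
theorem grading_mul_grading_inv_const [IsManifold 𝓘(ℂ, E) ω U] [ConnectedSpace U]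
    (hf₁ : IsHorizontalSlice (E := E) f₁) (hf₂ : IsHorizontalSlice (E := E) f₂)
    (h : ∀ x (w : E), higgsField f₁ x w = higgsField f₂ x w) (x y : U) :
    (f₂ x).grading 2 * (f₁ x).grading 2⁻¹ = (f₂ y).grading 2 * (f₁ y).grading 2⁻¹ := by
  have hg₁ := fun x => hf₁.holomorphic.contDiffAt_grading 2⁻¹ x
  have hg₂ := fun x => hf₂.holomorphic.contDiffAt_grading 2 x
  refine eq_of_fderiv_eq_zero (E := E) (g := fun x => (f₂ x).grading 2 * (f₁ x).grading 2⁻¹)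
    (fun x => ContMDiffAt.of_le
      (contMDiffAt_of_comp_chart_symm ((hg₂ x).mul (hg₁ x))) (by simp)) (fun x w => ?_) x y
  have h1 := fderiv_mul_apply ((hg₂ x).differentiableAt (by simp))
    ((hg₁ x).differentiableAt (by simp)) w
  refine h1.trans ?_
  have hv := hf₁.isHorizontalVariation x w
  have e1 : higgsField f₁ x w * (f₁ x).grading 2⁻¹ = _ := hv.higgs_mul_grading 2⁻¹
  have e2 := hv.grading_mul_higgsAdj 2⁻¹
  have e3 : higgsAdj (f₁ x) (projDeriv f₁ x w) * (f₁ x).grading 2⁻¹ =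
      (2 : ℂ) • ((f₁ x).grading 2⁻¹ * higgsAdj (f₁ x) (projDeriv f₁ x w)) := by
    rw [e2, smul_smul, mul_inv_cancel₀ two_ne_zero, one_smul]
  rw [hf₂.fderiv_grading two_ne_zero, hf₁.fderiv_grading (inv_ne_zero two_ne_zero), ← h,
    ← higgsAdj_eq_of_higgsField_eq hf₁ hf₂ (h x w)]
  simp only [Function.comp_apply, (chartAt E x).left_inv (mem_chart_source E x), mul_add, add_mul,
    mul_smul_comm, smul_mul_assoc, mul_assoc, e1, e3]
  change _ = (0 : HodgeEnd ι)
  rw [← higgsField]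
  match_scalars <;> norm_num

end Rigidity

/-- Two maps to `D` which correspond to each other under a homeomorphism of a space in which `D` is
embedded have homeomorphic images. -/
theorem exists_homeomorph_range {X D V : Type*} [TopologicalSpace D] [TopologicalSpace V]
    {em : D → V} (hem : Topology.IsEmbedding em) (L : V ≃ₜ V) {f₁ f₂ : X → D}
    (h : ∀ x, em (f₂ x) = L (em (f₁ x))) :
    ∃ F : Set.range f₁ ≃ₜ Set.range f₂, ∀ x, (F ⟨f₁ x, Set.mem_range_self x⟩ : D) = f₂ x := by
  have aux : ∀ (L : V ≃ₜ V) (f₁ f₂ : X → D), (∀ x, em (f₂ x) = L (em (f₁ x))) →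
      ∃ F : Set.range f₁ → Set.range f₂, Continuous F ∧
        ∀ d : Set.range f₁, em (F d) = L (em d) := by
    intro L f₁ f₂ h
    have hF : ∀ d : Set.range f₁, ∃ d' : Set.range f₂, em d' = L (em d) := by
      rintro ⟨_, x, rfl⟩
      exact ⟨⟨f₂ x, x, rfl⟩, h x⟩
    choose F hF using hF
    refine ⟨F, ?_, hF⟩
    refine (hem.comp Topology.IsEmbedding.subtypeVal).continuous_iff.2 ?_
    simp only [Function.comp_def, hF]
    exact L.continuous.comp (hem.continuous.comp continuous_subtype_val)
  obtain ⟨F, hFc, hF⟩ := aux L f₁ f₂ h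
  obtain ⟨G, hGc, hG⟩ := aux L.symm f₂ f₁ fun x => by rw [h, L.symm_apply_apply]
  refine ⟨⟨⟨F, G, fun d => ?_, fun d => ?_⟩, hFc, hGc⟩, fun x => hem.injective ?_⟩
  · exact Subtype.ext (hem.injective (by rw [hG, hF, L.symm_apply_apply]))
  · exact Subtype.ext (hem.injective (by rw [hF, hG, L.apply_symm_apply]))
  · exact (hF _).trans (h x).symm

section Rigidity

variable {ι : Type*} [Fintype ι] [DecidableEq ι] {P : HodgeData ι}
  {E : Type*} [NormedAddCommGroup E] [NormedSpace ℂ E]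
  {U : Type*} [TopologicalSpace U] [ChartedSpace E U]
  {f₁ f₂ : U → ClassifyingSpace P}

/-- Slices with the same Higgs field have homeomorphic images and the same Hodge metric: their
grading operators differ by left multiplication by a constant automorphism of `H`. -/
theorem exists_isHodgeIsometry_of_higgsField_eq [IsManifold 𝓘(ℂ, E) ω U] [ConnectedSpace U]
    (hf₁ : IsHorizontalSlice (E := E) f₁) (hf₂ : IsHorizontalSlice (E := E) f₂)
    (h : ∀ x (w : E), higgsField f₁ x w = higgsField f₂ x w) :
    ∃ F : Set.range f₁ ≃ₜ Set.range f₂, IsHodgeIsometry (E := E) f₁ f₂ F := by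
  obtain ⟨x₀⟩ := (inferInstance : Nonempty U)
  have hA : (f₂ x₀).grading 2 * (f₁ x₀).grading 2⁻¹ * ((f₁ x₀).grading 2 * (f₂ x₀).grading 2⁻¹) =
      1 := by
    rw [mul_assoc, ← mul_assoc ((f₁ x₀).grading 2⁻¹), (f₁ x₀).grading_inv_mul two_ne_zero, one_mul,
      (f₂ x₀).grading_mul_inv two_ne_zero]
  have hB : (f₁ x₀).grading 2 * (f₂ x₀).grading 2⁻¹ * ((f₂ x₀).grading 2 * (f₁ x₀).grading 2⁻¹) =
      1 := by
    rw [mul_assoc, ← mul_assoc ((f₂ x₀).grading 2⁻¹), (f₂ x₀).grading_inv_mul two_ne_zero, one_mul,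
      (f₁ x₀).grading_mul_inv two_ne_zero]
  let L : HodgeEnd ι ≃ₜ HodgeEnd ι :=
    { toFun := fun X => (f₂ x₀).grading 2 * (f₁ x₀).grading 2⁻¹ * X
      invFun := fun X => (f₁ x₀).grading 2 * (f₂ x₀).grading 2⁻¹ * X
      left_inv := fun X => by beta_reduce; rw [← mul_assoc, hB, one_mul]
      right_inv := fun X => by beta_reduce; rw [← mul_assoc, hA, one_mul]
      continuous_toFun := continuous_const.mul continuous_id
      continuous_invFun := continuous_const.mul continuous_id }
  obtain ⟨F, hF⟩ := exists_homeomorph_range ClassifyingSpace.isEmbedding_grading L (f₁ := f₁)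
    (f₂ := f₂) fun x => by
      change _ = (f₂ x₀).grading 2 * (f₁ x₀).grading 2⁻¹ * (f₁ x).grading 2
      rw [← grading_mul_grading_inv_const hf₁ hf₂ h x x₀, mul_assoc,
        (f₁ x).grading_inv_mul two_ne_zero, mul_one]
  refine ⟨F, hF, fun x w w' => ?_⟩
  rw [hf₁.hodgeMetric_eq, hf₂.hodgeMetric_eq, h, higgsAdj_eq_of_higgsField_eq hf₁ hf₂ (h x w')]

/-- If every smooth plurisubharmonic function on `Γ \ U` is constant, then the norm of the identity
is constant, so that the Higgs fields of the two slices agree. -/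
theorem higgsField_eq_of_onlyConstantPsh [IsManifold 𝓘(ℂ, E) ω U]
    {Γ : Type*} [Group Γ] [MulAction Γ U] (ρ : Γ →* leftTranslations P)
    (hf₁ : IsHorizontalSlice (E := E) f₁) (hf₂ : IsHorizontalSlice (E := E) f₂)
    (heq₁ : ∀ (γ : Γ) (x : U), f₁ (γ • x) = (ρ γ : Equiv.Perm (ClassifyingSpace P)) (f₁ x))
    (heq₂ : ∀ (γ : Γ) (x : U), f₂ (γ • x) = (ρ γ : Equiv.Perm (ClassifyingSpace P)) (f₂ x))
    (hpsh : OnlyConstantPsh E U Γ) (x : U) (w : E) : higgsField f₁ x w = higgsField f₂ x w := by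
  have hinv : ∀ (γ : Γ) (y : U), identityNorm f₁ f₂ (γ • y) = identityNorm f₁ f₂ y := by
    intro γ y
    obtain ⟨g, hg⟩ := (ρ γ).2
    have hact : ∀ z : ClassifyingSpace P, (ρ γ : Equiv.Perm (ClassifyingSpace P)) z = g • z :=
      fun z => by rw [← hg]; rfl
    rw [identityNorm, identityNorm, heq₁, heq₂, hact, hact, reTrace_apply, reTrace_apply,
      ClassifyingSpace.trace_grading_smul]
  let u : MulAction.orbitRel.Quotient Γ U → ℝ := Quotient.lift (identityNorm f₁ f₂) (by
    rintro _ b ⟨γ, rfl⟩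
    exact hinv γ b)
  have hconst := hpsh u (contMDiff_identityNorm hf₁.holomorphic hf₂.holomorphic)
    (fun y v => (leviForm_identityNorm_nonneg hf₁ hf₂ y v).1)
  refine (leviForm_identityNorm_nonneg hf₁ hf₂ x w).2 ?_
  have hc : identityNorm f₁ f₂ = fun _ => identityNorm f₁ f₂ x :=
    funext fun y => hconst (Quotient.mk'' y) (Quotient.mk'' x)
  rw [leviForm, hc]
  simp [Function.comp_def, iteratedFDeriv_const_of_ne (𝕜 := ℝ) two_ne_zero]

end Rigidity

/-! ### Second derivatives along curves and under holomorphic maps -/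

section SecondDeriv

variable {E : Type*} [NormedAddCommGroup E] [NormedSpace ℂ E]
  {E' : Type*} [NormedAddCommGroup E'] [NormedSpace ℂ E']
  {F : Type*} [NormedAddCommGroup F] [NormedSpace ℝ F]

theorem secondDeriv_add {G H : E → F} {z : E} (hG : ContDiffAt ℝ 2 G z) (hH : ContDiffAt ℝ 2 H z)
    (w w' : E) : secondDeriv (fun y => G y + H y) z w w' =
      secondDeriv G z w w' + secondDeriv H z w w' := by
  have h : (fun y => fderiv ℝ (fun y => G y + H y) y w) =ᶠ[𝓝 z]
      fun y => fderiv ℝ G y w + fderiv ℝ H y w := by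
    filter_upwards [eventually_differentiableAt hG, eventually_differentiableAt hH] with y h1 h2
    rw [fderiv_fun_add h1 h2, add_apply]
  rw [secondDeriv, h.fderiv_eq, fderiv_fun_add (differentiableAt_fderiv_apply hG w)
    (differentiableAt_fderiv_apply hH w), add_apply]
  rfl

theorem secondDeriv_comp {G : E' → F} {τ : E → E'} {z : E} (hG : ContDiffAt ℝ 2 G (τ z))
    (hτ : ContDiffAt ℝ 2 τ z) (w w' : E) :
    secondDeriv (G ∘ τ) z w w' = secondDeriv G (τ z) (fderiv ℝ τ z w) (fderiv ℝ τ z w') +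
      fderiv ℝ G (τ z) (secondDeriv τ z w w') := by
  have h : (fun y => fderiv ℝ (G ∘ τ) y w) =ᶠ[𝓝 z] fun y => fderiv ℝ G (τ y) (fderiv ℝ τ y w) := by
    filter_upwards [hτ.continuousAt.eventually (eventually_differentiableAt hG),
      eventually_differentiableAt hτ] with y h1 h2
    rw [fderiv_comp _ h1 h2]
    rfl
  have hτ1 := hτ.differentiableAt two_ne_zero
  have hG1 : DifferentiableAt ℝ (fderiv ℝ G) (τ z) :=
    (hG.fderiv_right (m := 1) (by norm_num)).differentiableAt one_ne_zero
  have hc : DifferentiableAt ℝ (fun y => fderiv ℝ G (τ y)) z := hG1.comp z hτ1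
  have hc' : fderiv ℝ (fun y => fderiv ℝ G (τ y)) z = (fderiv ℝ (fderiv ℝ G) (τ z)).comp
      (fderiv ℝ τ z) := fderiv_comp z hG1 hτ1
  rw [secondDeriv, h.fderiv_eq, fderiv_clm_apply hc (differentiableAt_fderiv_apply hτ w), hc',
    secondDeriv_eq_fderiv_fderiv hG]
  simp [secondDeriv, add_comm]

/-- The complex Hessian is invariant under holomorphic maps. -/
theorem secondDeriv_comp_holomorphic {G : E' → F} {τ : E → E'} {z : E}
    (hG : ContDiffAt ℝ 2 G (τ z)) (hτ : ContDiffAt ℂ 2 τ z) (w : E) :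
    secondDeriv (G ∘ τ) z w w + secondDeriv (G ∘ τ) z (Complex.I • w) (Complex.I • w) =
      secondDeriv G (τ z) (fderiv ℂ τ z w) (fderiv ℂ τ z w) +
        secondDeriv G (τ z) (Complex.I • fderiv ℂ τ z w) (Complex.I • fderiv ℂ τ z w) := by
  have hτr := hτ.restrict_scalars ℝ
  have hd : ∀ w, fderiv ℝ τ z w = fderiv ℂ τ z w := fun w => by
    rw [(hτ.differentiableAt two_ne_zero).fderiv_restrictScalars ℝ]
    rfl
  have hI : ∀ w w', secondDeriv τ z (Complex.I • w) w' = Complex.I • secondDeriv τ z w w' := by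
    intro w w'
    have h : (fun y => fderiv ℝ τ y (Complex.I • w)) =ᶠ[𝓝 z]
        fun y => Complex.I • fderiv ℝ τ y w := by
      filter_upwards [hτ.eventually (by decide)] with y hy
      rw [(hy.differentiableAt two_ne_zero).fderiv_restrictScalars ℝ]
      exact map_smul (fderiv ℂ τ y) _ _
    rw [secondDeriv, h.fderiv_eq, fderiv_fun_const_smul (differentiableAt_fderiv_apply hτr w)]
    rfl
  have h2 : secondDeriv τ z (Complex.I • w) (Complex.I • w) = -secondDeriv τ z w w := by
    rw [hI, secondDeriv_comm hτr, hI, smul_smul, Complex.I_mul_I, neg_one_smul]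
  rw [secondDeriv_comp hG hτr, secondDeriv_comp hG hτr, h2, hd, hd, map_smul, map_neg]
  abel

/-- The second derivative along a parabola. -/
theorem deriv_deriv_comp_parabola {G : E → ℝ} {z : E} (hG : ContDiffAt ℝ 2 G z) (v b : E) :
    deriv (fun s : ℝ => G (z + s • v + s ^ 2 • b)) 0 = fderiv ℝ G z v ∧
    deriv (deriv fun s : ℝ => G (z + s • v + s ^ 2 • b)) 0 =
      secondDeriv G z v v + 2 * fderiv ℝ G z b := by
  have hc : ∀ s : ℝ, HasDerivAt (fun s : ℝ => z + s • v + s ^ 2 • b) (v + (2 * s) • b) s := by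
    intro s
    have h1 := ((hasDerivAt_id s).smul_const v).const_add z
    have h2 := (hasDerivAt_pow 2 s).smul_const b
    exact (h1.add h2).congr_deriv (by simp)
  have hc0 : (fun s : ℝ => z + s • v + s ^ 2 • b) 0 = z := by simp
  have hev : ∀ᶠ s : ℝ in 𝓝 0, HasDerivAt (fun s : ℝ => G (z + s • v + s ^ 2 • b))
      (fderiv ℝ G (z + s • v + s ^ 2 • b) (v + (2 * s) • b)) s := by
    have h1 := (hc 0).continuousAt.eventually (hc0.symm ▸ eventually_differentiableAt hG)
    filter_upwards [h1] with s hs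
    exact hs.hasFDerivAt.comp_hasDerivAt s (hc s)
  refine ⟨?_, ?_⟩
  · rw [hev.self_of_nhds.deriv]
    simp
  · have h1 : deriv (fun s : ℝ => G (z + s • v + s ^ 2 • b)) =ᶠ[𝓝 0]
        fun s => fderiv ℝ G (z + s • v + s ^ 2 • b) (v + (2 * s) • b) :=
      hev.mono fun s hs => hs.deriv
    have hG1 : HasFDerivAt (fderiv ℝ G) (fderiv ℝ (fderiv ℝ G) z)
        ((fun s : ℝ => z + s • v + s ^ 2 • b) 0) := by
      rw [hc0]
      exact ((hG.fderiv_right (m := 1) (by norm_num)).differentiableAt one_ne_zero).hasFDerivAt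
    have h2 := hG1.comp_hasDerivAt 0 (hc 0)
    have h3 : HasDerivAt (fun s : ℝ => v + (2 * s) • b) ((2 : ℝ) • b) 0 := by
      have := (((hasDerivAt_id (0 : ℝ)).const_mul 2).smul_const b).const_add v
      simpa using this
    have h4 := (h2.clm_apply h3).deriv
    rw [h1.deriv_eq]
    refine h4.trans ?_
    rw [secondDeriv_eq_fderiv_fderiv hG]
    simp

theorem deriv_deriv_nonpos_of_isLocalMax {g : ℝ → ℝ} {s : ℝ} (hg : ContinuousAt g s)
    (h : IsLocalMax g s) : deriv (deriv g) s ≤ 0 := by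
  by_contra! hpos
  have hmin := isLocalMin_of_deriv_deriv_pos hpos h.deriv_eq_zero hg
  have hconst : g =ᶠ[𝓝 s] fun _ => g s := by
    filter_upwards [h, hmin] with t h1 h2
    exact le_antisymm h1 h2
  have h1 : deriv g =ᶠ[𝓝 s] fun _ => 0 := by
    have := hconst.deriv
    simpa using this
  rw [h1.deriv_eq] at hpos
  simp at hpos

theorem secondDeriv_nonpos_of_isLocalMax {G : E → ℝ} {z : E} (hG : ContDiffAt ℝ 2 G z)
    (h : IsLocalMax G z) (v : E) : secondDeriv G z v v ≤ 0 := by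
  have h1 := (deriv_deriv_comp_parabola hG v 0).2
  rw [map_zero, mul_zero, add_zero] at h1
  have hc : ContinuousAt (fun s : ℝ => z + s • v + s ^ 2 • (0 : E)) 0 := by fun_prop
  have hc0 : z + (0 : ℝ) • v + (0 : ℝ) ^ 2 • (0 : E) = z := by simp
  rw [← h1]
  refine deriv_deriv_nonpos_of_isLocalMax ?_ ?_
  · refine ContinuousAt.comp (g := G) ?_ hc
    rw [hc0]
    exact hG.continuousAt
  · have h2 := hc.eventually (hc0.symm ▸ h)
    filter_upwards [h2] with s hs
    simpa using hs

end SecondDeriv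

/-! ### Maxima on sublevel sets of a function with a negative direction of its complex Hessian -/

section Concave

variable {E : Type*} [NormedAddCommGroup E] [NormedSpace ℂ E]

/-- If `φ` has a strict local maximum at `z` along a parabola, then the parabola stays in the
sublevel set of `φ` through `z`. If `ψ` has a local maximum at `z` on this sublevel set, then its second
derivative along the parabola is nonpositive. -/
theorem deriv_parabola_nonpos_of_isMax_sublevel {φ ψ : E → ℝ} {z v b : E} (hφ : ContDiffAt ℝ 2 φ z)
    (hψ : ContDiffAt ℝ 2 ψ z) (h : ∀ᶠ y in 𝓝 z, φ y ≤ φ z → ψ y ≤ ψ z) (hv : fderiv ℝ φ z v = 0)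
    (hneg : secondDeriv φ z v v + 2 * fderiv ℝ φ z b < 0) :
    secondDeriv ψ z v v + 2 * fderiv ℝ ψ z b ≤ 0 := by
  obtain ⟨h1, h2⟩ := deriv_deriv_comp_parabola hφ v b
  have hc : ContinuousAt (fun s : ℝ => z + s • v + s ^ 2 • b) 0 := by fun_prop
  have hc0 : z + (0 : ℝ) • v + (0 : ℝ) ^ 2 • b = z := by simp
  have hcont : ∀ G : E → ℝ, ContDiffAt ℝ 2 G z →
      ContinuousAt (fun s : ℝ => G (z + s • v + s ^ 2 • b)) 0 := fun G hG => by
    refine ContinuousAt.comp (g := G) ?_ hc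
    rw [hc0]
    exact hG.continuousAt
  have hmax := isLocalMax_of_deriv_deriv_neg (h2.trans_lt hneg) (h1.trans hv) (hcont φ hφ)
  rw [← (deriv_deriv_comp_parabola hψ v b).2]
  refine deriv_deriv_nonpos_of_isLocalMax (hcont ψ hψ) ?_
  filter_upwards [hmax, hc.eventually (hc0.symm ▸ h)] with s hs1 hs2
  simp only [hc0] at hs1 hs2 ⊢
  exact hs2 hs1

/-- If the complex Hessian of `φ` is negative definite on a subspace of dimension `2`, then there is
a holomorphic disc `ζ ↦ z + ζ v + ζ² b` such that `φ` has a nondegenerate local maximum at `z` along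
its real axis and along its imaginary axis. -/
theorem exists_disc {φ : E → ℝ} {z : E} (hφ : ContDiffAt ℝ 2 φ z) {W : Submodule ℂ E}
    (hW : Module.finrank ℂ W = 2) (hneg : ∀ v ∈ W, v ≠ 0 →
      secondDeriv φ z v v + secondDeriv φ z (Complex.I • v) (Complex.I • v) < 0) :
    ∃ v ∈ W, ∃ b : E, v ≠ 0 ∧ fderiv ℝ φ z v = 0 ∧ fderiv ℝ φ z (Complex.I • v) = 0 ∧
      secondDeriv φ z v v + 2 * fderiv ℝ φ z b < 0 ∧
      secondDeriv φ z (Complex.I • v) (Complex.I • v) - 2 * fderiv ℝ φ z b < 0 := by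
  have hfin : FiniteDimensional ℂ W := Module.finite_of_finrank_pos (by omega)
  by_cases h0 : fderiv ℝ φ z = 0
  · -- At a critical point `b` has no effect on the second derivatives; instead, `v` is rotated
    -- until the real Hessian takes the same value at `v` and `i v`.
    obtain ⟨v, hv⟩ : ∃ v : W, v ≠ 0 := by
      have : Nontrivial W := Module.nontrivial_of_finrank_pos (R := ℂ) (by omega)
      exact exists_ne 0
    let r : ℝ → E := fun t => Complex.exp (t * Complex.I) • (v : E)
    have hr : Continuous r := by
      fun_prop
    let k : ℝ → ℝ := fun t => secondDeriv φ z (r t) (r t) -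
      secondDeriv φ z (Complex.I • r t) (Complex.I • r t)
    have hk : Continuous k := by
      simp only [k, secondDeriv_eq_fderiv_fderiv hφ]
      fun_prop
    have hpi : r (Real.pi / 2) = Complex.I • r 0 := by
      simp [r, Complex.exp_pi_div_two_mul_I]
    have hneg' : ∀ w, secondDeriv φ z (-w) (-w) = secondDeriv φ z w w := fun w => by
      simp [secondDeriv_eq_fderiv_fderiv hφ]
    have hk' : k (Real.pi / 2) = -k 0 := by
      simp only [k, hpi, smul_smul, Complex.I_mul_I, neg_one_smul, hneg']
      ring
    obtain ⟨t, ht⟩ : (0 : ℝ) ∈ Set.range k := by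
      rcases le_total (k 0) 0 with h | h
      · exact mem_range_of_exists_le_of_exists_ge hk ⟨0, h⟩ ⟨Real.pi / 2, by rw [hk']; linarith⟩
      · exact mem_range_of_exists_le_of_exists_ge hk ⟨Real.pi / 2, by rw [hk']; linarith⟩ ⟨0, h⟩
    have hrW : r t ∈ W := W.smul_mem _ v.2
    have hr0 : r t ≠ 0 := smul_ne_zero (Complex.exp_ne_zero _) (fun h => hv (Subtype.ext h))
    have h1 := hneg _ hrW hr0
    simp only [k] at ht
    refine ⟨r t, hrW, 0, hr0, by simp [h0], by simp [h0], ?_, ?_⟩ <;> simp only [map_zero] <;>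
      linarith
  · -- Otherwise `b` adjusts the second derivatives along `v` and `i v` to the same value.
    obtain ⟨b₀, hb₀⟩ : ∃ b₀, fderiv ℝ φ z b₀ ≠ 0 := by
      by_contra! hcon
      exact h0 (ContinuousLinearMap.ext hcon)
    let ℓ : W →ₗ[ℂ] ℂ :=
      { toFun := fun v => (fderiv ℝ φ z v : ℂ) - Complex.I * fderiv ℝ φ z (Complex.I • (v : E))
        map_add' := fun u v => by
          simp only [Submodule.coe_add, smul_add, map_add, Complex.ofReal_add]; ring
        map_smul' := fun c v => by
          have hc : ∀ u : E, fderiv ℝ φ z (c • u) =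
              c.re * fderiv ℝ φ z u + c.im * fderiv ℝ φ z (Complex.I • u) := fun u => by
            conv_lhs => rw [← Complex.re_add_im c, add_smul, map_add, mul_smul, Complex.coe_smul,
              Complex.coe_smul, map_smul, map_smul]
            rfl
          have hII : Complex.I • Complex.I • (v : E) = -(v : E) := by
            rw [smul_smul, Complex.I_mul_I, neg_one_smul]
          rw [Submodule.coe_smul, smul_comm Complex.I c, hc, hc, hII, map_neg, RingHom.id_apply,
            smul_eq_mul]
          apply Complex.ext
          · simp
          · simp [add_comm] }
    have hker : LinearMap.ker ℓ ≠ ⊥ := by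
      refine LinearMap.ker_ne_bot_of_finrank_lt ?_
      rw [hW, Module.finrank_self]
      norm_num
    obtain ⟨v, hv, hv0⟩ := (Submodule.ne_bot_iff _).1 hker
    have hv' : (fderiv ℝ φ z v : ℂ) - Complex.I * fderiv ℝ φ z (Complex.I • (v : E)) = 0 := hv
    have hre := congrArg Complex.re hv'
    have him := congrArg Complex.im hv'
    simp at hre him
    have h1 := hneg v v.2 (fun h => hv0 (Subtype.ext h))
    refine ⟨v, v.2, ((secondDeriv φ z (Complex.I • (v : E)) (Complex.I • (v : E)) -
      secondDeriv φ z v v) / 4 / fderiv ℝ φ z b₀) • b₀, fun h => hv0 (Subtype.ext h), hre, him,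
      ?_, ?_⟩ <;> rw [map_smul, smul_eq_mul, div_mul_cancel₀ _ hb₀] <;> linarith

/-- Let `u` be plurisubharmonic and let the complex Hessian of `φ` be negative definite on a
subspace of dimension `2`. Then the restriction of `u - ε φ` to the sublevel set of `φ` through `z`
has no local maximum at `z`. -/
theorem not_isLocalMax_on_sublevel {φ u : E → ℝ} {z : E} (hφ : ContDiffAt ℝ 2 φ z)
    (hu : ContDiffAt ℝ 2 u z) {W : Submodule ℂ E} (hW : Module.finrank ℂ W = 2)
    (hneg : ∀ v ∈ W, v ≠ 0 →
      secondDeriv φ z v v + secondDeriv φ z (Complex.I • v) (Complex.I • v) < 0)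
    (hpsh : ∀ v, 0 ≤ secondDeriv u z v v + secondDeriv u z (Complex.I • v) (Complex.I • v))
    {ε : ℝ} (hε : 0 < ε) :
    ¬ ∀ᶠ y in 𝓝 z, φ y ≤ φ z → u y + -ε * φ y ≤ u z + -ε * φ z := by
  intro h
  obtain ⟨v, hvW, b, hv0, hv, hIv, h1, h2⟩ := exists_disc hφ hW hneg
  have hφ' : ContDiffAt ℝ 2 (fun y => -ε * φ y) z := contDiffAt_const.mul hφ
  have hψ : ContDiffAt ℝ 2 (fun y => u y + -ε * φ y) z := hu.add hφ'
  have hsd : ∀ w, secondDeriv (fun y => u y + -ε * φ y) z w w =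
      secondDeriv u z w w + -ε * secondDeriv φ z w w := fun w => by
    rw [secondDeriv_add hu hφ']
    congr 1
    exact secondDeriv_clm_comp ((-ε) • ContinuousLinearMap.id ℝ ℝ) hφ w w
  have h3 := deriv_parabola_nonpos_of_isMax_sublevel hφ hψ h hv h1
  have h4 := deriv_parabola_nonpos_of_isMax_sublevel (b := -b) hφ hψ h hIv
    (by rw [map_neg]; linarith)
  rw [map_neg] at h4
  rw [hsd] at h3 h4
  have h5 := mul_pos_of_neg_of_neg (neg_lt_zero.2 hε) (hneg v hvW hv0)
  have h6 := hpsh v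
  linarith

end Concave

/-! ### The strong maximum principle -/

section MaximumPrinciple

/-- The function `|z - c|⁻²` on `ℂ`, with Laplacian `4 |z - c|⁻⁴`: the barrier in the proof of the
strong maximum principle. -/
def barrier (c z : ℂ) : ℝ := ((z.re - c.re) ^ 2 + (z.im - c.im) ^ 2)⁻¹

theorem barrier_eq (c z : ℂ) : barrier c z = (‖z - c‖ ^ 2)⁻¹ := by
  rw [barrier, Complex.sq_norm, Complex.normSq_apply]
  simp [sq]

theorem re_sq_add_im_sq_pos {c z : ℂ} (h : z ≠ c) : 0 < (z.re - c.re) ^ 2 + (z.im - c.im) ^ 2 := by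
  have h1 : 0 < Complex.normSq (z - c) := Complex.normSq_pos.2 (sub_ne_zero.2 h)
  rw [Complex.normSq_apply] at h1
  simpa [sq] using h1

theorem contDiffAt_barrier {c z : ℂ} (h : z ≠ c) : ContDiffAt ℝ 2 (barrier c) z := by
  have hre : ContDiffAt ℝ 2 (fun w : ℂ => w.re) z := Complex.reCLM.contDiff.contDiffAt
  have him : ContDiffAt ℝ 2 (fun w : ℂ => w.im) z := Complex.imCLM.contDiff.contDiffAt
  exact (((hre.sub contDiffAt_const).pow 2).add ((him.sub contDiffAt_const).pow 2)).inv
    (re_sq_add_im_sq_pos h).ne'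

theorem deriv_deriv_inv_quadratic {a b : ℝ} (ha : 0 < a) :
    deriv (deriv fun s : ℝ => (a + 2 * b * s + s ^ 2)⁻¹) 0 = 8 * b ^ 2 / a ^ 3 - 2 / a ^ 2 := by
  have hq : ∀ s : ℝ, HasDerivAt (fun s : ℝ => a + 2 * b * s + s ^ 2) (2 * b + 2 * s) s := fun s =>
    ((((hasDerivAt_id s).const_mul (2 * b)).const_add a).add (hasDerivAt_pow 2 s)).congr_deriv
      (by simp)
  have hpos : ∀ᶠ s : ℝ in 𝓝 0, a + 2 * b * s + s ^ 2 ≠ 0 := by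
    refine (hq 0).continuousAt.eventually_ne ?_
    simpa using ha.ne'
  have h1 : deriv (fun s : ℝ => (a + 2 * b * s + s ^ 2)⁻¹) =ᶠ[𝓝 0]
      fun s => -(2 * b + 2 * s) / (a + 2 * b * s + s ^ 2) ^ 2 :=
    hpos.mono fun s hs => ((hq s).inv hs).deriv
  have h2 : HasDerivAt (fun s : ℝ => -(2 * b + 2 * s)) (-2) 0 :=
    (((hasDerivAt_id (0 : ℝ)).const_mul 2).const_add (2 * b)).neg.congr_deriv (by simp)
  have h3 := h2.div ((hq 0).pow 2) (by simpa using ha.ne')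
  rw [h1.deriv_eq]
  refine h3.deriv.trans ?_
  simp
  field_simp
  ring

theorem laplacian_barrier_pos {c z : ℂ} (h : z ≠ c) :
    0 < secondDeriv (barrier c) z 1 1 + secondDeriv (barrier c) z Complex.I Complex.I := by
  have hpos := re_sq_add_im_sq_pos h
  have h1 := (deriv_deriv_comp_parabola (contDiffAt_barrier h) 1 0).2
  have h2 := (deriv_deriv_comp_parabola (contDiffAt_barrier h) Complex.I 0).2
  rw [map_zero, mul_zero, add_zero] at h1 h2
  have e1 : (fun s : ℝ => barrier c (z + s • (1 : ℂ) + s ^ 2 • (0 : ℂ))) = fun s : ℝ =>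
      (((z.re - c.re) ^ 2 + (z.im - c.im) ^ 2) + 2 * (z.re - c.re) * s + s ^ 2)⁻¹ := by
    funext s
    simp [barrier]
    ring
  have e2 : (fun s : ℝ => barrier c (z + s • Complex.I + s ^ 2 • (0 : ℂ))) = fun s : ℝ =>
      (((z.re - c.re) ^ 2 + (z.im - c.im) ^ 2) + 2 * (z.im - c.im) * s + s ^ 2)⁻¹ := by
    funext s
    simp [barrier]
    ring
  rw [e1, deriv_deriv_inv_quadratic hpos] at h1
  rw [e2, deriv_deriv_inv_quadratic hpos] at h2
  rw [← h1, ← h2]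
  set a := (z.re - c.re) ^ 2 + (z.im - c.im) ^ 2 with ha
  have h3 : 8 * (z.re - c.re) ^ 2 / a ^ 3 - 2 / a ^ 2 + (8 * (z.im - c.im) ^ 2 / a ^ 3 - 2 / a ^ 2)
      = 4 / a ^ 2 := by
    have : 8 * (z.re - c.re) ^ 2 / a ^ 3 + 8 * (z.im - c.im) ^ 2 / a ^ 3 = 8 / a ^ 2 := by
      rw [← add_div, ← mul_add, ← ha]
      field_simp
    linear_combination this
  rw [h3]
  positivity

variable {g : ℂ → ℝ} {Ω : Set ℂ} {M : ℝ}

/-- Hopf's argument: a subharmonic function which is less than `M` on a disc and equal to `M` at a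
boundary point of the disc exceeds `M` near that point. -/
theorem not_subharmonic_of_touching_disc {y x : ℂ} {r : ℝ} (hr : 0 < r) (hxy : dist x y = r)
    (hg : ∀ z ∈ Metric.closedBall x (r / 4), ContDiffAt ℝ 2 g z)
    (hsub : ∀ z ∈ Metric.closedBall x (r / 4),
      0 ≤ secondDeriv g z 1 1 + secondDeriv g z Complex.I Complex.I)
    (hM : ∀ z ∈ Metric.closedBall x (r / 4), g z ≤ M)
    (hlt : ∀ z ∈ Metric.closedBall x (r / 4), z ∈ Metric.ball y r → g z < M) :
    g x ≠ M := by
  intro hgx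
  -- The disc with centre the midpoint `c` of `x` and `y` touches the boundary at `x` only.
  set c : ℂ := midpoint ℝ x y with hc
  have hcx : ‖x - c‖ = r / 2 := by
    rw [← dist_eq_norm, hc, dist_left_midpoint, hxy]
    norm_num
    ring
  have hxc : c - y = x - c := by
    rw [hc, midpoint_eq_smul_add]
    simp
    ring
  have htouch : ∀ z, ‖z - c‖ ≤ r / 2 → z ≠ x → z ∈ Metric.ball y r := by
    intro z hz hzx
    rw [Metric.mem_ball, dist_eq_norm]
    by_contra! hge
    have hp := parallelogram_law_with_norm ℝ (z - c) (x - c)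
    rw [hcx] at hp
    have e1 : z - c + (x - c) = z - y := by rw [← hxc]; ring
    have e2 : z - c - (x - c) = z - x := by ring
    rw [e1, e2] at hp
    have hpos : 0 < ‖z - x‖ := norm_pos_iff.2 (sub_ne_zero.2 hzx)
    nlinarith [norm_nonneg (z - c)]
  have hfar : ∀ z ∈ Metric.closedBall x (r / 4), r / 4 ≤ ‖z - c‖ := by
    intro z hz
    rw [Metric.mem_closedBall, dist_eq_norm] at hz
    have := norm_sub_le (x - c) (x - z)
    rw [show x - c - (x - z) = z - c by ring, norm_sub_rev x z, hcx] at this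
    have := norm_le_norm_add_norm_sub (z - c) (x - c)
    rw [show z - c - (x - c) = z - x by ring, hcx] at this
    linarith
  have hne : ∀ z ∈ Metric.closedBall x (r / 4), z ≠ c := by
    rintro z hz rfl
    have := hfar _ hz
    rw [sub_self, norm_zero] at this
    linarith
  have hgc : ContinuousOn g (Metric.closedBall x (r / 4)) :=
    fun z hz => (hg z hz).continuousAt.continuousWithinAt
  obtain ⟨m, hmM, hm⟩ : ∃ m < M, ∀ z ∈ Metric.sphere x (r / 4), ‖z - c‖ ≤ r / 2 → g z ≤ m := by
    have hK : IsCompact (Metric.sphere x (r / 4) ∩ Metric.closedBall c (r / 2)) :=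
      (isCompact_sphere x (r / 4)).inter_right Metric.isClosed_closedBall
    rcases (Metric.sphere x (r / 4) ∩ Metric.closedBall c (r / 2)).eq_empty_or_nonempty with h | h
    · refine ⟨M - 1, by linarith, fun z hz hzc => ?_⟩
      have : z ∈ Metric.sphere x (r / 4) ∩ Metric.closedBall c (r / 2) :=
        ⟨hz, by rwa [Metric.mem_closedBall, dist_eq_norm]⟩
      rw [h] at this
      exact this.elim
    · obtain ⟨z₀, hz₀, hmax⟩ := hK.exists_isMaxOn h
        (hgc.mono fun z hz => Metric.sphere_subset_closedBall hz.1)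
      refine ⟨g z₀, hlt z₀ (Metric.sphere_subset_closedBall hz₀.1) (htouch z₀ ?_ ?_),
        fun z hz hzc => hmax ⟨hz, by rwa [Metric.mem_closedBall, dist_eq_norm]⟩⟩
      · simpa [dist_eq_norm] using hz₀.2
      · rintro rfl
        have := hz₀.1
        rw [Metric.mem_sphere, dist_self] at this
        linarith
  -- On the closed disc of radius `r / 4` around `x` the barrier is at most `16 / r ^ 2`.
  set ε : ℝ := (M - m) * r ^ 2 / 16 with hε
  have hε0 : 0 < ε := by
    have := sub_pos.2 hmM
    positivity
  have hb : ∀ z ∈ Metric.closedBall x (r / 4), ContDiffAt ℝ 2 (fun w => ε * barrier c w) z :=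
    fun z hz => contDiffAt_const.mul (contDiffAt_barrier (hne z hz))
  have hw : ∀ z ∈ Metric.closedBall x (r / 4), ContDiffAt ℝ 2 (fun w => g w + ε * barrier c w) z :=
    fun z hz => (hg z hz).add (hb z hz)
  have hsphere : ∀ z ∈ Metric.sphere x (r / 4),
      g z + ε * barrier c z < g x + ε * barrier c x := by
    intro z hz
    have hz' := Metric.sphere_subset_closedBall hz
    have hbx : barrier c x = 4 / r ^ 2 := by
      rw [barrier_eq, hcx]
      field_simp
      norm_num
    rw [hgx, hbx]
    rcases le_or_gt ‖z - c‖ (r / 2) with h | h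
    · have h1 : barrier c z ≤ 16 / r ^ 2 := by
        rw [barrier_eq, show 16 / r ^ 2 = ((r / 4) ^ 2)⁻¹ by field_simp; norm_num]
        have := hfar z hz'
        gcongr
      have h2 : ε * barrier c z ≤ M - m := by
        refine (mul_le_mul_of_nonneg_left h1 hε0.le).trans_eq ?_
        rw [hε]
        field_simp
      have h3 : 0 < ε * (4 / r ^ 2) := by positivity
      linarith [hm z hz h]
    · have h1 : barrier c z < 4 / r ^ 2 := by
        rw [barrier_eq, show 4 / r ^ 2 = ((r / 2) ^ 2)⁻¹ by field_simp; norm_num]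
        gcongr
      have h2 := mul_lt_mul_of_pos_left h1 hε0
      linarith [hM z hz']
  have hx : x ∈ Metric.closedBall x (r / 4) := Metric.mem_closedBall_self (by positivity)
  obtain ⟨z₀, hz₀, hmax⟩ := (isCompact_closedBall x (r / 4)).exists_isMaxOn ⟨x, hx⟩
    (f := fun w => g w + ε * barrier c w)
    fun z hz => (hw z hz).continuousAt.continuousWithinAt
  have hz₀' : z₀ ∈ Metric.ball x (r / 4) := by
    refine Metric.mem_ball.2 (lt_of_le_of_ne (Metric.mem_closedBall.1 hz₀) fun h => ?_)
    exact absurd (hmax hx) (not_le.2 (hsphere z₀ (Metric.mem_sphere.2 h)))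
  have hloc : IsLocalMax (fun w => g w + ε * barrier c w) z₀ :=
    hmax.isLocalMax (Filter.mem_of_superset (Metric.isOpen_ball.mem_nhds hz₀')
      Metric.ball_subset_closedBall)
  have hsd : ∀ w, secondDeriv (fun y => g y + ε * barrier c y) z₀ w w =
      secondDeriv g z₀ w w + ε * secondDeriv (barrier c) z₀ w w := fun w => by
    rw [secondDeriv_add (hg z₀ hz₀) (hb z₀ hz₀)]
    congr 1
    exact secondDeriv_clm_comp (ε • ContinuousLinearMap.id ℝ ℝ) (contDiffAt_barrier (hne z₀ hz₀))
      w w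
  have h1 := secondDeriv_nonpos_of_isLocalMax (hw z₀ hz₀) hloc 1
  have h2 := secondDeriv_nonpos_of_isLocalMax (hw z₀ hz₀) hloc Complex.I
  rw [hsd] at h1 h2
  have h3 := mul_pos hε0 (laplacian_barrier_pos (hne z₀ hz₀))
  have h4 := hsub z₀ hz₀
  linarith

theorem eventually_eq_of_subharmonic (hΩ : IsOpen Ω) (hg : ∀ z ∈ Ω, ContDiffAt ℝ 2 g z)
    (hsub : ∀ z ∈ Ω, 0 ≤ secondDeriv g z 1 1 + secondDeriv g z Complex.I Complex.I)
    (hM : ∀ z ∈ Ω, g z ≤ M) {p : ℂ} (hp : p ∈ Ω) (hgp : g p = M) : ∀ᶠ z in 𝓝 p, g z = M := by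
  obtain ⟨R, hR, hRΩ⟩ := Metric.isOpen_iff.1 hΩ p hp
  by_contra hcon
  obtain ⟨y, hyM, hy⟩ := ((Filter.not_eventually.1 hcon).and_eventually
    (Metric.ball_mem_nhds p (by positivity : 0 < R / 4))).exists
  -- The point `x` nearest to `y` among the points near `p` at which `g` takes the value `M`.
  have hball : Metric.closedBall y (dist p y) ⊆ Ω := fun z hz => hRΩ (by
    rw [Metric.mem_closedBall, dist_comm p y] at hz
    rw [Metric.mem_ball]
    linarith [dist_triangle z y p])
  have hcl : IsCompact (Metric.closedBall y (dist p y) ∩ g ⁻¹' {M}) :=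
    (isCompact_closedBall y (dist p y)).of_isClosed_subset
      (ContinuousOn.preimage_isClosed_of_isClosed
        (fun z hz => (hg z (hball hz)).continuousAt.continuousWithinAt)
        Metric.isClosed_closedBall isClosed_singleton) Set.inter_subset_left
  obtain ⟨x, ⟨hx, hgx⟩, hmin⟩ := hcl.exists_isMinOn ⟨p, Metric.mem_closedBall.2 le_rfl, hgp⟩
    (f := fun z => dist z y) (by fun_prop)
  have hxy : 0 < dist x y := dist_pos.2 fun h => hyM (h ▸ hgx)
  rw [Metric.mem_closedBall] at hx
  have hsubset : Metric.closedBall x (dist x y / 4) ⊆ Ω := fun z hz => hRΩ (by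
    rw [Metric.mem_closedBall] at hz
    rw [Metric.mem_ball]
    rw [dist_comm p y] at hx
    linarith [dist_triangle4 z x y p])
  refine not_subharmonic_of_touching_disc hxy rfl (fun z hz => hg z (hsubset hz))
    (fun z hz => hsub z (hsubset hz)) (fun z hz => hM z (hsubset hz)) (fun z hz hzy => ?_) hgx
  refine lt_of_le_of_ne (hM z (hsubset hz)) fun h => ?_
  rw [Metric.mem_ball] at hzy
  exact absurd (hmin ⟨Metric.mem_closedBall.2 (hzy.le.trans hx), h⟩) (not_le.2 hzy)

theorem eqOn_of_subharmonic (hΩ : IsOpen Ω) (hΩc : IsPreconnected Ω)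
    (hg : ∀ z ∈ Ω, ContDiffAt ℝ 2 g z)
    (hsub : ∀ z ∈ Ω, 0 ≤ secondDeriv g z 1 1 + secondDeriv g z Complex.I Complex.I)
    (hM : ∀ z ∈ Ω, g z ≤ M) {p : ℂ} (hp : p ∈ Ω) (hgp : g p = M) {z : ℂ} (hz : z ∈ Ω) :
    g z = M := by
  have h1 : IsOpen (Ω ∩ {z | g z = M}) := isOpen_iff_mem_nhds.2 fun z hz =>
    Filter.inter_mem (hΩ.mem_nhds hz.1) (eventually_eq_of_subharmonic hΩ hg hsub hM hz.1 hz.2)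
  have h2 : IsOpen (Ω ∩ {z | g z < M}) := isOpen_iff_mem_nhds.2 fun z hz =>
    Filter.inter_mem (hΩ.mem_nhds hz.1) ((hg z hz.1).continuousAt.eventually_lt
      continuousAt_const hz.2)
  have h3 : Disjoint (Ω ∩ {z | g z = M}) (Ω ∩ {z | g z < M}) :=
    Set.disjoint_left.2 fun z ha hb => hb.2.ne ha.2
  refine (hΩc.subset_left_of_subset_union h1 h2 h3 (fun z hz => ?_) ⟨p, hp, hp, hgp⟩ hz).2
  rcases (hM z hz).eq_or_lt with h | h
  · exact Or.inl ⟨hz, h⟩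
  · exact Or.inr ⟨hz, h⟩

end MaximumPrinciple

/-! ### Plurisubharmonic functions on manifolds -/

section Manifold

variable {E : Type*} [NormedAddCommGroup E] [NormedSpace ℂ E]
  {U : Type*} [TopologicalSpace U] [ChartedSpace E U]

theorem leviForm_eq {u : U → ℝ} {x : U} (hu : ContMDiffAt 𝓘(ℝ, E) 𝓘(ℝ, ℝ) 2 u x) (v : E) :
    secondDeriv (u ∘ (chartAt E x).symm) (chartAt E x x) v v +
      secondDeriv (u ∘ (chartAt E x).symm) (chartAt E x x) (Complex.I • v) (Complex.I • v) =
        4 * leviForm u x v := by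
  have h := contDiffAt_comp_chart_symm_self hu
  rw [leviForm, iteratedFDeriv_two_eq_secondDeriv h, iteratedFDeriv_two_eq_secondDeriv h]
  ring

variable [IsManifold 𝓘(ℂ, E) ω U]

theorem exists_hessian_chart_eq_leviForm {u : U → ℝ} {x y : U}
    (hy : y ∈ (chartAt E x).source)
    (hu : ContMDiffAt 𝓘(ℝ, E) 𝓘(ℝ, ℝ) 2 u y) (v : E) :
    ∃ w : E, secondDeriv (u ∘ (chartAt E x).symm) (chartAt E x y) v v +
      secondDeriv (u ∘ (chartAt E x).symm) (chartAt E x y) (Complex.I • v) (Complex.I • v) =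
        4 * leviForm u y w := by
  obtain ⟨τ, hτ, hτy, h⟩ := exists_coordChange (E := E) hy
  have h1 := contDiffAt_comp_chart_symm_self hu
  rw [← hτy] at h1
  refine ⟨fderiv ℂ τ (chartAt E x y) v, ?_⟩
  rw [secondDeriv_congr (h u), secondDeriv_congr (h u),
    secondDeriv_comp_holomorphic h1 (hτ.of_le le_top), hτy, leviForm_eq hu]

/-- The strong maximum principle for plurisubharmonic functions: near `x`, it follows from the
maximum principle on complex lines through `x` in a chart. -/
theorem eq_of_psh_of_le [PreconnectedSpace U] {u : U → ℝ}
    (hu : ContMDiff 𝓘(ℝ, E) 𝓘(ℝ, ℝ) 2 u) (hpsh : ∀ x v, 0 ≤ leviForm (E := E) u x v) {M : ℝ}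
    (hM : ∀ x, u x ≤ M) {x₀ : U} (hx₀ : u x₀ = M) (x : U) : u x = M := by
  have hopen : IsOpen {x | u x = M} := by
    refine isOpen_iff_mem_nhds.2 fun x hx => ?_
    obtain ⟨δ, hδ, hball⟩ := Metric.isOpen_iff.1 (chartAt E x).open_target _
      (mem_chart_target E x)
    have hnhds : ∀ᶠ y in 𝓝 x, y ∈ (chartAt E x).source ∧
        chartAt E x y ∈ Metric.ball (chartAt E x x) δ :=
      Filter.Eventually.and
        ((chartAt E x).open_source.mem_nhds (mem_chart_source E x))
        (((chartAt E x).continuousAt (mem_chart_source E x)).eventually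
          (Metric.ball_mem_nhds _ hδ))
    filter_upwards [hnhds] with y ⟨hys, hyb⟩
    set d : E := chartAt E x y - chartAt E x x with hd
    let τ : ℂ → E := fun ζ => chartAt E x x + ζ • d
    have hτ : ∀ ζ, ContDiffAt ℂ 2 τ ζ := fun ζ =>
      contDiffAt_const.add (contDiffAt_id.smul contDiffAt_const)
    have hτ' : ∀ ζ, fderiv ℂ τ ζ 1 = d := fun ζ => by
      have h1 : HasDerivAt τ ((1 : ℂ) • d) ζ :=
        ((hasDerivAt_id ζ).smul_const d).const_add (chartAt E x x)
      rw [fderiv_apply_one_eq_deriv, h1.deriv, one_smul]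
    have hτc : Continuous τ := by fun_prop
    have hτ0 : τ 0 = chartAt E x x := by simp [τ]
    have hτ1 : τ 1 = chartAt E x y := by simp [τ, hd]
    set Ω : Set ℂ := τ ⁻¹' Metric.ball (chartAt E x x) δ with hΩ
    have hconv : Convex ℝ Ω := by
      intro a ha b hb s t hs ht hst
      have : τ (s • a + t • b) = s • τ a + t • τ b := by
        have h1 : chartAt E x x = s • chartAt E x x + t • chartAt E x x := by
          rw [← add_smul, hst, one_smul]
        simp only [τ, add_smul, smul_add, smul_assoc]
        nth_rewrite 1 [h1]
        abel
      rw [hΩ, Set.mem_preimage, this]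
      exact convex_ball _ _ ha hb hs ht hst
    have hsymm : ∀ ζ ∈ Ω, ∃ y ∈ (chartAt E x).source, chartAt E x y = τ ζ := fun ζ hζ =>
      ⟨(chartAt E x).symm (τ ζ), (chartAt E x).map_target (hball hζ),
        (chartAt E x).right_inv (hball hζ)⟩
    have hG : ∀ ζ ∈ Ω, ContDiffAt ℝ 2 (u ∘ (chartAt E x).symm) (τ ζ) := fun ζ hζ => by
      obtain ⟨y, hy, hyζ⟩ := hsymm ζ hζ
      exact hyζ ▸ contDiffAt_comp_chart_symm hy hu.contMDiffAt
    have h := eqOn_of_subharmonic (g := (u ∘ (chartAt E x).symm) ∘ τ) (M := M)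
      (Metric.isOpen_ball.preimage hτc) hconv.isPreconnected
      (fun ζ hζ => (hG ζ hζ).comp ζ ((hτ ζ).restrict_scalars ℝ))
      (fun ζ hζ => ?_) (fun ζ _ => hM _) (p := 0) (z := 1) ?_ ?_ ?_
    · simpa [hτ1, hys] using h
    · have h1 := secondDeriv_comp_holomorphic (hG ζ hζ) (hτ ζ) 1
      rw [smul_eq_mul, mul_one, hτ'] at h1
      rw [h1]
      obtain ⟨y, hy, hyζ⟩ := hsymm ζ hζ
      rw [← hyζ]
      obtain ⟨w, hw⟩ := exists_hessian_chart_eq_leviForm hy hu.contMDiffAt d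
      rw [hw]
      exact mul_nonneg zero_le_four (hpsh y w)
    · simpa [hΩ, hτ0] using hδ
    · simpa [hτ0] using hx
    · simpa [hΩ, hτ1] using hyb
  have hclosed : IsClosed {x | u x = M} := isClosed_eq hu.continuous continuous_const
  have h := IsClopen.eq_univ ⟨hclosed, hopen⟩ ⟨x₀, hx₀⟩
  have hx : x ∈ {x | u x = M} := by
    rw [h]
    exact Set.mem_univ x
  exact hx

/-- On the part of `Γ \ U` where the complex Hessian of the exhaustion function `φ` has two negative
eigenvalues, `u - ε φ` has no maximum on a sublevel set of `φ`. Hence `u` attains its maximum, on a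
compact sublevel set, and the strong maximum principle applies. -/
theorem onlyConstantPsh_of_isConcave [ConnectedSpace U] {Γ : Type*} [Group Γ] [MulAction Γ U]
    (h : IsConcave E U Γ) : OnlyConstantPsh E U Γ := by
  obtain ⟨φ, hφ, hcpt, K, hK, hneg⟩ := h
  intro u hu hpsh
  have hu2 := hu.of_le (n := ∞) (m := 2) (WithTop.coe_le_coe.2 (le_top : (2 : ℕ∞) ≤ ⊤))
  have hφc : Continuous φ := isQuotientMap_quotient_mk'.continuous_iff.2 hφ.continuous
  have huc : Continuous u := isQuotientMap_quotient_mk'.continuous_iff.2 hu.continuous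
  obtain ⟨x₁⟩ := (inferInstance : Nonempty U)
  obtain ⟨k, hk⟩ := hK.bddAbove_image hφc.continuousOn
  set c : ℝ := max k (φ (Quotient.mk'' x₁)) with hc
  have hKc : ∀ q ∈ K, φ q ≤ c := fun q hq => (hk ⟨q, hq, rfl⟩).trans (le_max_left _ _)
  have hne : {q | φ q ≤ c}.Nonempty := ⟨Quotient.mk'' x₁, (le_max_right k _ : φ _ ≤ c)⟩
  obtain ⟨qM, -, hmax⟩ := (hcpt c).exists_isMaxOn hne huc.continuousOn
  obtain ⟨qm, hqm, hmin⟩ := (hcpt c).exists_isMinOn hne hφc.continuousOn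
  have hbound : ∀ q, c < φ q → ∀ ε > 0, u q + -ε * φ q ≤ u qM + -ε * φ qm := by
    intro q hq ε hε
    obtain ⟨q₀, hq₀, hmax₀⟩ := (hcpt (φ q)).exists_isMaxOn ⟨q, le_refl (φ q)⟩
      (f := fun q => u q + -ε * φ q) (by fun_prop)
    have hq₀c : φ q₀ ≤ c := by
      by_contra! hlt
      induction q₀ using Quotient.inductionOn' with | h x => ?_
      obtain ⟨W, hW, hWneg⟩ := hneg x fun hx => (hKc _ hx).not_gt hlt
      refine not_isLocalMax_on_sublevel (contDiffAt_comp_chart_symm_self (hφ.contMDiffAt (x := x)))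
        (contDiffAt_comp_chart_symm_self (hu2.contMDiffAt (x := x))) hW (fun v hv hv0 => ?_)
        (fun v => ?_) hε
        (Filter.Eventually.of_forall fun y hy => ?_)
      · rw [leviForm_eq hφ.contMDiffAt]
        linarith [hWneg v hv hv0]
      · rw [leviForm_eq hu2.contMDiffAt]
        exact mul_nonneg zero_le_four (hpsh x v)
      · simp only [Function.comp_apply, (chartAt E x).left_inv (mem_chart_source E x)] at hy ⊢
        exact hmax₀ (hy.trans hq₀)
    have h1 : u q + -ε * φ q ≤ u q₀ + -ε * φ q₀ := hmax₀ (le_refl (φ q))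
    have h2 : u q₀ ≤ u qM := hmax hq₀c
    have h3 : φ qm ≤ φ q₀ := hmin hq₀c
    nlinarith
  have hM : ∀ q, u q ≤ u qM := by
    intro q
    rcases le_or_gt (φ q) c with hq | hq
    · exact hmax hq
    · have hpos : 0 < φ q - φ qm := sub_pos.2 (lt_of_le_of_lt hqm hq)
      refine le_of_forall_pos_le_add fun ε hε => ?_
      have h1 := hbound q hq (ε / (φ q - φ qm)) (div_pos hε hpos)
      have h2 : ε / (φ q - φ qm) * (φ q - φ qm) = ε := div_mul_cancel₀ _ hpos.ne'
      linarith
  obtain ⟨x₀, hx₀⟩ := Quotient.exists_rep qM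
  have hconst : ∀ q, u q = u qM := fun q =>
    Quotient.inductionOn' q fun x => eq_of_psh_of_le (E := E) (x₀ := x₀) hu2 hpsh
      (fun x => hM (Quotient.mk'' x)) (congrArg u hx₀) x
  exact fun a b => (hconst a).trans (hconst b).symm

end Manifold

end HodgeSlice

end

theorem theorem4p1
    {ι : Type*} [Fintype ι] [DecidableEq ι] (P : HodgeSlice.HodgeData ι)
    {E : Type*} [NormedAddCommGroup E] [NormedSpace ℂ E] [FiniteDimensional ℂ E]
    {U : Type*} [TopologicalSpace U] [T2Space U] [SecondCountableTopology U] [ConnectedSpace U]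
    [ChartedSpace E U] [IsManifold 𝓘(ℂ, E) ω U]
    {Γ : Type*} [Group Γ] [MulAction Γ U]
    (hΓ : ∀ γ : Γ, ContMDiff 𝓘(ℂ, E) 𝓘(ℂ, E) ω (fun x : U => γ • x))
    (ρ : Γ →* HodgeSlice.leftTranslations P)
    (f₁ f₂ : U → HodgeSlice.ClassifyingSpace P)
    (hf₁ : HodgeSlice.IsHorizontalSlice (E := E) f₁)
    (hf₂ : HodgeSlice.IsHorizontalSlice (E := E) f₂)
    (heq₁ : ∀ (γ : Γ) (x : U),
      f₁ (γ • x) = (ρ γ : Equiv.Perm (HodgeSlice.ClassifyingSpace P)) (f₁ x))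
    (heq₂ : ∀ (γ : Γ) (x : U),
      f₂ (γ • x) = (ρ γ : Equiv.Perm (HodgeSlice.ClassifyingSpace P)) (f₂ x)) :
    (HodgeSlice.IsConcave E U Γ → HodgeSlice.OnlyConstantPsh E U Γ) ∧
    (HodgeSlice.OnlyConstantPsh E U Γ →
      ∃ F : Set.range f₁ ≃ₜ Set.range f₂, HodgeSlice.IsHodgeIsometry (E := E) f₁ f₂ F) :=
  ⟨HodgeSlice.onlyConstantPsh_of_isConcave, fun h =>
    HodgeSlice.exists_isHodgeIsometry_of_higgsField_eq hf₁ hf₂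
      (HodgeSlice.higgsField_eq_of_onlyConstantPsh ρ hf₁ hf₂ heq₁ heq₂ h)⟩
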